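/- Let $\mathbb{T}^2=(S^1)^2$ act continuously on $\mathbb{CP}^2$ so that $\mathbb{CP}^2$ is a quasitoric manifold over a simple $2$-dimensional convex polytope $P\subset\mathbb{R}^2$, with orbit projection $\mathfrak{q}:\mathbb{CP}^2\to P$; that is, the action is locally standard (each point has a $\mathbb{T}^2$-stable open neighbourhood that is homeomorphic, equivariantly up to an automorphism of $\mathbb{T}^2$, to a $\mathbb{T}^2$-stable open subset of $\mathbb{C}^2$ with the coordinatewise action), and $\mathfrak{q}$ is a quotient map whose fibres are exactly the orbits and which maps every $l$-dimensional orbit to a point in the relative interior of an $l$-dimensional face of $P$. Then $P$ is a triangle, and for every labelling $F_1,F_2,F_3$ of its edges the following holds. For a matrix $\eta\in SL(2,\mathbb{Z})$ with rows $r_1,r_2$ define functions $\eta',\eta''$ from $\{F_1,F_2,F_3\}$ to $\mathbb{Z}^2/\{\pm1\}$ by $$\eta'(F_1)=\eta''(F_1)=[r_1],\quad \eta'(F_2)=\eta''(F_2)=[r_2],\quad \eta'(F_3)=[r_1+r_2],\quad \eta''(F_3)=[r_1-r_2];$$ they depend only on the class $[\eta]_{eq}\in SL(2,\mathbb{Z})/\sim_{eq}$,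 where $\eta\sim_{eq}-\eta$. For $\lambda\in\{\eta',\eta''\}$ let $\mathbb{CP}^2_{\lambda}=(\mathbb{T}^2\times P)/\sim$ with the quotient topology, where $(t,p)\sim(u,p')$ if and only if $p=p'$ and $tu^{-1}$ lies in the subgroup of $\mathbb{T}^2$ generated by the circles $\{(z^{a},z^{b}):z\in S^1\}$, $[(a,b)]=\lambda(F_i)$, over all $i$ with $p\in F_i$; the torus $\mathbb{T}^2$ acts by multiplication on the first factor, and $\mathbb{CP}^2_\lambda\to P$ is the projection to the second factor. Then there is a unique class $[\eta]_{eq}\in SL(2,\mathbb{Z})/\sim_{eq}$ such that $\mathbb{CP}^2$ with the given action is equivariantly homeomorphic, by a homeomorphism covering the identity of $P$, to $\mathbb{CP}^2_{\eta'}$ or to $\mathbb{CP}^2_{\eta''}$. -/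

import Mathlib

open scoped LinearAlgebra.Projectivization

/-- The compact torus `𝕋ⁿ = (S¹)ⁿ`. -/
abbrev Torus (n : ℕ) : Type := Fin n → Circle

/-- The complex projective space `ℂPⁿ`. -/
def ComplexProjectiveSpace (n : ℕ) : Type := ℙ ℂ (Fin (n + 1) → ℂ)

/-- `ℂPⁿ` carries the quotient topology from `ℂⁿ⁺¹ ∖ {0}`. -/
noncomputable instance (n : ℕ) : TopologicalSpace (ComplexProjectiveSpace n) :=
  TopologicalSpace.coinduced
    (Projectivization.mk' ℂ : {v : Fin (n + 1) → ℂ // v ≠ 0} → ℙ ℂ (Fin (n + 1) → ℂ)) inferInstance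

section Polytopes

variable {n : ℕ}

/-- `G` is a nonempty face of the convex polytope `P` (possibly `P` itself): the set of points of
`P` at which some linear functional attains its maximum over `P`. -/
def IsFace (P G : Set (EuclideanSpace ℝ (Fin n))) : Prop :=
  G.Nonempty ∧ IsExposed ℝ P G

/-- The dimension of a (nonempty) face: the dimension of its affine span. -/
noncomputable def faceDim (G : Set (EuclideanSpace ℝ (Fin n))) : ℕ :=
  Module.finrank ℝ (vectorSpan ℝ G)

/-- The facets of `P ⊆ ℝⁿ`: the faces of codimension one. -/
def Facet (P : Set (EuclideanSpace ℝ (Fin n))) : Type :=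
  {G : Set (EuclideanSpace ℝ (Fin n)) // IsFace P G ∧ faceDim G + 1 = n}

/-- `P` is an `n`-dimensional simple convex polytope in `ℝⁿ`: the convex hull of a finite set, with
nonempty interior, such that every vertex lies on exactly `n` facets. -/
structure IsSimplePolytope (P : Set (EuclideanSpace ℝ (Fin n))) : Prop where
  exists_finite : ∃ S : Set (EuclideanSpace ℝ (Fin n)), S.Finite ∧ P = convexHull ℝ S
  interior_nonempty : (interior P).Nonempty
  simple : ∀ v ∈ P.extremePoints ℝ, Nat.card {G : Facet P // v ∈ G.1} = n

end Polytopes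

section QuasitoricManifolds

variable {n : ℕ} {M : Type*} [TopologicalSpace M] [MulAction (Torus n) M]

variable (n M) in
/-- A `𝕋ⁿ`-action on `M` is locally standard: every point has a `𝕋ⁿ`-stable open neighbourhood
(the source of `ψ`) that is homeomorphic, equivariantly up to an automorphism `δ` of `𝕋ⁿ`, to an
open subset (the target of `ψ`, which is then `𝕋ⁿ`-stable) of `ℂⁿ` with the coordinatewise
action. -/
def IsLocallyStandard : Prop :=
  ∀ y : M, ∃ (ψ : OpenPartialHomeomorph M (Fin n → ℂ)) (δ : Torus n ≃ₜ* Torus n),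
    y ∈ ψ.source ∧
    ∀ (t : Torus n), ∀ x ∈ ψ.source,
      t • x ∈ ψ.source ∧ ψ (t • x) = fun i => (δ t i : ℂ) * ψ x i

variable (n) in
/-- The orbit of `x` is `l`-dimensional, i.e. it is a torus of dimension `l`. -/
def HasOrbitDim (x : M) (l : ℕ) : Prop :=
  Nonempty (MulAction.orbit (Torus n) x ≃ₜ Torus l)

/-- `q : M → P` exhibits the `𝕋ⁿ`-space `M` as a quasitoric manifold over the `n`-dimensional
simple polytope `P`: the action is locally standard and `q` is an orbit projection (a quotient map
whose fibres are the orbits) which maps every `l`-dimensional orbit to a point in the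
relative interior of an `l`-dimensional face of `P`. -/
structure IsQuasitoric (P : Set (EuclideanSpace ℝ (Fin n))) (q : M → P) : Prop where
  simplePolytope : IsSimplePolytope P
  locallyStandard : IsLocallyStandard n M
  isQuotientMap : Topology.IsQuotientMap q
  eq_iff : ∀ x y : M, q x = q y ↔ x ∈ MulAction.orbit (Torus n) y
  orbit_dim : ∀ (x : M) (l : ℕ), HasOrbitDim n x l →
    ∃ G, IsFace P G ∧ faceDim G = l ∧ (q x : EuclideanSpace ℝ (Fin n)) ∈ intrinsicInterior ℝ G

end QuasitoricManifolds

section CharacteristicFunctions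

/-- The relation `y = x ∨ y = -x` on `ℤⁿ`. -/
def signSetoid (n : ℕ) : Setoid (Fin n → ℤ) where
  r x y := y = x ∨ y = -x
  iseqv :=
    { refl := fun _ => Or.inl rfl
      symm := by
        rintro x y (h | h)
        · exact Or.inl h.symm
        · exact Or.inr (by rw [h, neg_neg])
      trans := by
        rintro x y z (rfl | rfl) (rfl | rfl)
        · exact Or.inl rfl
        · exact Or.inr rfl
        · exact Or.inr rfl
        · exact Or.inl (neg_neg x) }

/-- The quotient `ℤⁿ / {±1}`. -/
def SignClass (n : ℕ) : Type := Quotient (signSetoid n)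

/-- The class `[x]` in `ℤⁿ / {±1}`. -/
def SignClass.mk {n : ℕ} (x : Fin n → ℤ) : SignClass n := Quotient.mk (signSetoid n) x

/-- The one-parameter subgroup `z ↦ (z ^ v₁, …, z ^ vₙ)` of `𝕋ⁿ` with direction `v ∈ ℤⁿ`. -/
noncomputable def oneParam {n : ℕ} (v : Fin n → ℤ) : Circle →* Torus n where
  toFun z := fun i => z ^ v i
  map_one' := by funext i; simp
  map_mul' a b := by funext i; simp [mul_zpow]

theorem oneParam_range_neg {n : ℕ} (v : Fin n → ℤ) :
    (oneParam (-v)).range = (oneParam v).range := by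
  ext t
  constructor
  · rintro ⟨z, rfl⟩
    exact ⟨z⁻¹, by funext i; simp [oneParam]⟩
  · rintro ⟨z, rfl⟩
    exact ⟨z⁻¹, by funext i; simp [oneParam]⟩

/-- The subgroup `{(z ^ v₁, …, z ^ vₙ) : z ∈ S¹}` of `𝕋ⁿ` determined by `[v] ∈ ℤⁿ / {±1}`. -/
noncomputable def SignClass.circle {n : ℕ} : SignClass n → Subgroup (Torus n) :=
  Quotient.lift (fun v => (oneParam v).range) (by
    rintro v w (rfl | rfl)
    · rfl
    · exact (oneParam_range_neg v).symm)

variable {n : ℕ} (P : Set (EuclideanSpace ℝ (Fin n))) (η : Facet P → SignClass n)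

/-- For a point `p ∈ P`, the subgroup of `𝕋ⁿ` generated by the circles of the characteristic
vectors of all facets containing `p`, i.e. of all facets containing the face which has `p` in its
relative interior. -/
noncomputable def isotropyTorus (p : P) : Subgroup (Torus n) :=
  ⨆ G : {G : Facet P // (p : EuclideanSpace ℝ (Fin n)) ∈ G.1}, (η G.1).circle

/-- The relation on `𝕋ⁿ × P` with `(t, p) ∼ (u, p')` iff `p = p'` and `t u⁻¹` lies in the
isotropy torus of `p`. -/
def modelSetoid : Setoid (Torus n × P) where
  r a b := a.2 = b.2 ∧ a.1 * b.1⁻¹ ∈ isotropyTorus P η a.2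
  iseqv :=
    { refl := fun a => ⟨rfl, by simp [one_mem]⟩
      symm := by
        rintro ⟨t, p⟩ ⟨u, p'⟩ ⟨h, h'⟩
        obtain rfl : p = p' := h
        refine ⟨rfl, ?_⟩
        have := inv_mem h'
        simpa using this
      trans := by
        rintro ⟨t, p⟩ ⟨u, p'⟩ ⟨w, p''⟩ ⟨h, h'⟩ ⟨k, k'⟩
        obtain rfl : p = p' := h
        obtain rfl : p = p'' := k
        refine ⟨rfl, ?_⟩
        have := mul_mem h' k'
        simpa [mul_assoc] using this }

/-- The quasitoric manifold `M(P, η) = (𝕋ⁿ × P) / ∼` constructed from the pair `(P, η)`. -/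
def ModelManifold : Type := Quotient (modelSetoid P η)

/-- `M(P, η)` carries the quotient topology. -/
instance : TopologicalSpace (ModelManifold P η) :=
  inferInstanceAs (TopologicalSpace (Quotient (modelSetoid P η)))

/-- The `𝕋ⁿ`-action on `M(P, η)` induced by the group operation of `𝕋ⁿ`. -/
noncomputable instance : MulAction (Torus n) (ModelManifold P η) where
  smul t := Quotient.map (fun a : Torus n × P => (t * a.1, a.2)) (by
    rintro ⟨u, p⟩ ⟨w, p'⟩ ⟨h, h'⟩
    refine ⟨h, ?_⟩
    have e : t * u * (t * w)⁻¹ = u * w⁻¹ := by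
      rw [mul_inv, mul_mul_mul_comm, mul_inv_cancel, one_mul]
    change t * u * (t * w)⁻¹ ∈ _
    rw [e]
    exact h')
  one_smul x := by
    induction x using Quotient.inductionOn with
    | h a => exact congrArg (Quotient.mk _) (Prod.ext (one_mul _) rfl)
  mul_smul s t x := by
    induction x using Quotient.inductionOn with
    | h a => exact congrArg (Quotient.mk _) (Prod.ext (mul_assoc _ _ _) rfl)

/-- The projection `M(P, η) → P`. -/
def ModelManifold.proj : ModelManifold P η → P :=
  Quotient.lift (fun a : Torus n × P => a.2) (fun _ _ h => h.1)

/-- The `𝕋ⁿ`-space `M` with projection `q : M → P` is equivariantly homeomorphic, over the identity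
of `P`, to the quasitoric manifold `M(P, η)`. -/
def IsEquivariantlyHomeomorphicToModel {M : Type*} [TopologicalSpace M] [MulAction (Torus n) M]
    (q : M → P) : Prop :=
  ∃ f : M ≃ₜ ModelManifold P η,
    (∀ (t : Torus n) (x : M), f (t • x) = t • f x) ∧
    ∀ x : M, ModelManifold.proj P η (f x) = q x

end CharacteristicFunctions

section Triangle

open Matrix

/-- The equivalence relation `A ∼ -A` on `SL(2, ℤ)`. -/
def slSetoid : Setoid (SpecialLinearGroup (Fin 2) ℤ) where
  r A B := B = A ∨ B = -A
  iseqv :=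
    { refl := fun _ => Or.inl rfl
      symm := by
        rintro A B (h | h)
        · exact Or.inl h.symm
        · exact Or.inr (by rw [h, neg_neg])
      trans := by
        rintro A B C (rfl | rfl) (rfl | rfl)
        · exact Or.inl rfl
        · exact Or.inr rfl
        · exact Or.inr rfl
        · exact Or.inl (neg_neg A) }

/-- The quotient `SL(2, ℤ) / {±1}`. -/
def SLModSign : Type := Quotient slSetoid

theorem SignClass.mk_neg {n : ℕ} (v : Fin n → ℤ) : SignClass.mk (-v) = SignClass.mk v :=
  (Quotient.sound (s := signSetoid n) (Or.inr rfl)).symm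

variable {P : Set (EuclideanSpace ℝ (Fin 2))}

/-- `η'(F₁) = [r₁]`, `η'(F₂) = [r₂]`, `η'(F₃) = [r₁ + r₂]`, where `r₁, r₂` are the rows of a matrix
in the class `[η] ∈ SL(2, ℤ) / {±1}` and `F₁, F₂, F₃` are the facets of the triangle `P`. -/
def etaPrime (F : Fin 3 ≃ Facet P) : SLModSign → Facet P → SignClass 2 :=
  Quotient.lift
    (fun A G => ![SignClass.mk (A.1 0), SignClass.mk (A.1 1),
      SignClass.mk (A.1 0 + A.1 1)] (F.symm G))
    (by
      rintro A B (rfl | rfl)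
      · rfl
      · have h : ∀ i, (-A).1 i = -(A.1 i) := fun i => rfl
        simp only [h, ← neg_add, SignClass.mk_neg])

/-- `η''(F₁) = [r₁]`, `η''(F₂) = [r₂]`, `η''(F₃) = [r₁ - r₂]`, where `r₁, r₂` are the rows of a
matrix in the class `[η] ∈ SL(2, ℤ) / {±1}` and `F₁, F₂, F₃` are the facets of the triangle `P`. -/
def etaDoublePrime (F : Fin 3 ≃ Facet P) : SLModSign → Facet P → SignClass 2 :=
  Quotient.lift
    (fun A G => ![SignClass.mk (A.1 0), SignClass.mk (A.1 1),
      SignClass.mk (A.1 0 - A.1 1)] (F.symm G))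
    (by
      rintro A B (rfl | rfl)
      · rfl
      · have h : ∀ i, (-A).1 i = -(A.1 i) := fun i => rfl
        have h' : -(A.1 0) - -(A.1 1) = -(A.1 0 - A.1 1) := by abel
        simp only [h, h', SignClass.mk_neg])

end Triangle

/-! The classification half rests on a global continuous section `σ` of the orbit map. Locally, a
chart gives one by replacing all coordinates by their moduli. Local sections over a polygon are
glued across lines by subdividing a box (`IsQuasitoric.exists_section`). Given `σ`, the map `(t, p)
↦ t • σ p` presents the manifold as a quotient of `𝕋² × P`, and only isotropy groups matter: they
are trivial over the interior, everything over a vertex, and a circle with primitive direction `±v`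
over each open edge. In a chart at a vertex the two edges there are the two coordinate axes, so
their directions form a lattice basis (`IsQuasitoric.charVec_minor`).

Over a triangle any two edges meet, so the directions `a, b, c` have pairwise determinants `±1`.
Choosing signs with `det (a, b) = 1` forces `c = ±a ± b`, which is `η'` or `η''`. Conversely a model
determines the rows of its matrix up to individual signs, and determinant one ties the two signs
together; this gives uniqueness.

That `P` is a triangle reflects that `ℂP²` has second Betti number one. This is proved by hand with
line bundles, written as continuous families of rank-one orthogonal projections. Pulled back to `ℂ³
∖ {0}` such a family is trivial, and the winding of the trivialisation along `z ↦ z x` is its degree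
`a`. A disc in `ℂP²` with collapsed boundary lifts to `ℂ³ ∖ {0}` and has a degree `d`, and the
restriction of the family to that sphere has degree `a * d` (`exists_discDeg`). Each edge `F` gives
a line bundle (`IsQuasitoric.exists_lineFamily`) and a sphere, its preimage. The bundle of `F` pairs
to `±1` with the sphere of an adjacent edge and to `0` with that of a disjoint edge
(`IsQuasitoric.exists_edgeDegree`). If `P` were not a triangle, there would be consecutive edges
`F₁, F₂, F₃` with `F₁, F₃` disjoint. Then `a₁ d₂ = ±1`, `a₁ d₃ = 0` and `a₂ d₃ = ±1`, which is
impossible in `ℤ`. -/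

/-! ### Winding numbers of loops in `ℂ ∖ {0}`. -/

section Winding

/-- A nowhere vanishing continuous function on a normed space has a continuous logarithm. -/
theorem exists_continuous_exp_eq {W : Type*} [NormedAddCommGroup W] [NormedSpace ℝ W]
    {f : W → ℂ} (hf : Continuous f) (h0 : ∀ x, f x ≠ 0) :
    ∃ h : W → ℂ, Continuous h ∧ ∀ x, Complex.exp (h x) = f x := by
  have hs : IsSimplyConnected (Set.univ : Set W) := by
    have : SimplyConnectedSpace (Set.univ : Set W) :=
      (Homeomorph.Set.univ W).toHomotopyEquiv.simplyConnectedSpace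
    exact this
  obtain ⟨h, hc, he⟩ := Complex.exists_continuousOn_eqOn_exp_comp hs isOpen_univ
    (g := f) hf.continuousOn (by simpa using h0)
  exact ⟨h, continuousOn_univ.1 hc, fun x => he (Set.mem_univ x)⟩

/-- A continuous function on a preconnected set whose exponential is `1` is constant. -/
theorem exists_eq_two_pi_of_exp_eq_one {X : Type*} [TopologicalSpace X] {s : Set X}
    (hs : IsPreconnected s) {d : X → ℂ} (hd : ContinuousOn d s)
    (he : ∀ x ∈ s, Complex.exp (d x) = 1) :
    ∃ n : ℤ, ∀ x ∈ s, d x = n * (2 * Real.pi * Complex.I) := by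
  choose! n hn using fun x hx => Complex.exp_eq_one_iff.1 (he x hx)
  have hpi : (2 * Real.pi * Complex.I : ℂ) ≠ 0 := Complex.two_pi_I_ne_zero
  have hc : ContinuousOn n s := by
    rw [Int.isClosedEmbedding_coe_real.isInducing.continuousOn_iff]
    have : ContinuousOn (fun x => (d x / (2 * Real.pi * Complex.I)).re) s :=
      Complex.continuous_re.comp_continuousOn (hd.div_const _)
    refine this.congr fun x hx => ?_
    simp only [Function.comp]
    rw [hn x hx, mul_div_assoc, div_self hpi]
    simp
  rcases s.eq_empty_or_nonempty with rfl | ⟨x0, hx0⟩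
  · exact ⟨0, by simp⟩
  refine ⟨n x0, fun x hx => ?_⟩
  rw [hn x hx, hs.constant hc hx hx0]

/-- `c : S¹ → ℂ∖{0}` has winding number `n`. -/
def HasDeg (c : Circle → ℂ) (n : ℤ) : Prop :=
  ∃ h : Circle → ℂ, Continuous h ∧ ∀ z : Circle, c z = (z : ℂ) ^ n * Complex.exp (h z)

theorem HasDeg.congr {c c' : Circle → ℂ} {n : ℤ} (h : HasDeg c n) (e : ∀ z, c' z = c z) :
    HasDeg c' n := by
  obtain ⟨g, hg, hg'⟩ := h
  exact ⟨g, hg, fun z => by rw [e, hg']⟩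

/-- Subtracting the linear part `n θ i` from the logarithm leaves a periodic function, which
descends along the covering `Circle.exp`. -/
theorem hasDeg_of_lift {c : Circle → ℂ} {n : ℤ} {L : ℝ → ℂ} (hL : Continuous L)
    (he : ∀ θ, Complex.exp (L θ) = c (Circle.exp θ))
    (hp : ∀ θ, L (θ + 2 * Real.pi) - L θ = n * (2 * Real.pi * Complex.I)) : HasDeg c n := by
  have hcov := Circle.isCoveringMap_exp
  have hq : Topology.IsQuotientMap Circle.exp := hcov.isQuotientMap Circle.exp_surjective
  let g : ℝ → ℂ := fun θ => L θ - n * θ * Complex.I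
  have hgp : Function.Periodic g (2 * Real.pi) := by
    intro θ
    have := hp θ
    simp only [g]
    push_cast
    linear_combination this
  have hgc : Continuous g := by fun_prop
  have hfac : ∀ a b, Circle.exp a = Circle.exp b → g a = g b := by
    intro a b hab
    obtain ⟨m, hm⟩ := Circle.exp_eq_exp.1 hab
    rw [hm]
    exact hgp.int_mul m b
  let h : Circle → ℂ := fun z => g (Complex.arg z)
  have hh : ∀ θ, h (Circle.exp θ) = g θ := fun θ =>
    hfac _ _ (by rw [Circle.exp_arg])
  refine ⟨h, ?_, fun z => ?_⟩
  · rw [hq.continuous_iff]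
    exact hgc.congr fun θ => (hh θ).symm
  · obtain ⟨θ, rfl⟩ := Circle.exp_surjective z
    rw [hh, ← he, Circle.coe_exp, ← Complex.exp_int_mul, ← Complex.exp_add]
    congr 1
    simp only [g]; ring

theorem HasDeg.exists_lift {c : Circle → ℂ} {n : ℤ} (h : HasDeg c n) :
    ∃ L : ℝ → ℂ, Continuous L ∧ (∀ θ, Complex.exp (L θ) = c (Circle.exp θ)) ∧
      ∀ θ, L (θ + 2 * Real.pi) - L θ = n * (2 * Real.pi * Complex.I) := by
  obtain ⟨g, hg, hgc⟩ := h
  refine ⟨fun θ => n * (θ * Complex.I) + g (Circle.exp θ), by fun_prop, fun θ => ?_, fun θ => ?_⟩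
  · rw [hgc, Circle.coe_exp, Complex.exp_add, Complex.exp_int_mul]
  · have : Circle.exp (θ + 2 * Real.pi) = Circle.exp θ := Circle.periodic_exp θ
    beta_reduce
    rw [this]; push_cast; ring

/-- Two logarithms of the same loop along `ℝ` differ by a constant, so they have the same increment
over a period. -/
theorem HasDeg.unique {c : Circle → ℂ} {n m : ℤ} (h : HasDeg c n) (h' : HasDeg c m) : n = m := by
  obtain ⟨L, hL, he, hp⟩ := h.exists_lift
  obtain ⟨L', hL', he', hp'⟩ := h'.exists_lift
  obtain ⟨k, hk⟩ := exists_eq_two_pi_of_exp_eq_one (d := fun θ => L θ - L' θ)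
    isPreconnected_univ (by fun_prop) (fun θ _ => by
      rw [Complex.exp_sub, he, he', div_self]
      rw [← he]; exact Complex.exp_ne_zero _)
  have h0 := hk 0 trivial
  have h1 := hk (0 + 2 * Real.pi) trivial
  have e : (n : ℂ) * (2 * Real.pi * Complex.I) = m * (2 * Real.pi * Complex.I) := by
    linear_combination h1 - h0 - hp 0 + hp' 0
  exact_mod_cast mul_right_cancel₀ Complex.two_pi_I_ne_zero e

theorem HasDeg.mul {c d : Circle → ℂ} {n m : ℤ} (hc : HasDeg c n) (hd : HasDeg d m) :
    HasDeg (fun z => c z * d z) (n + m) := by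
  obtain ⟨g, hg, hgc⟩ := hc
  obtain ⟨g', hg', hgc'⟩ := hd
  refine ⟨fun z => g z + g' z, by fun_prop, fun z => ?_⟩
  beta_reduce
  rw [hgc, hgc', zpow_add₀ z.coe_ne_zero, Complex.exp_add]; ring

theorem hasDeg_zpow (n : ℤ) : HasDeg (fun z => (z : ℂ) ^ n) n :=
  ⟨fun _ => 0, continuous_const, fun z => by simp⟩

theorem hasDeg_zero_of_exp {c : Circle → ℂ} {h : Circle → ℂ} (hh : Continuous h)
    (e : ∀ z, c z = Complex.exp (h z)) : HasDeg c 0 :=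
  ⟨h, hh, fun z => by simp [e]⟩

theorem hasDeg_const {a : ℂ} (ha : a ≠ 0) : HasDeg (fun _ => a) 0 :=
  hasDeg_zero_of_exp (h := fun _ => Complex.log a) continuous_const
    (fun _ => (Complex.exp_log ha).symm)

/-- The winding number does not change along a homotopy. -/
theorem HasDeg.of_homotopy {κ : ℝ → Circle → ℂ} (hκ : Continuous (Function.uncurry κ))
    (h0 : ∀ u z, κ u z ≠ 0) {a b : ℝ} {n : ℤ} (h : HasDeg (κ a) n) : HasDeg (κ b) n := by
  obtain ⟨L, hL, he⟩ := exists_continuous_exp_eq (W := ℝ × ℝ)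
    (f := fun p => κ p.1 (Circle.exp p.2))
    (hκ.comp (continuous_fst.prodMk (Circle.exp.continuous.comp continuous_snd)))
    (fun _ => h0 _ _)
  -- The increment over a period takes values in `2πiℤ` and is continuous on the connected parameter
  -- plane, so one integer serves for all stages of the homotopy.
  obtain ⟨k, hk⟩ := exists_eq_two_pi_of_exp_eq_one
    (d := fun p : ℝ × ℝ => L (p.1, p.2 + 2 * Real.pi) - L p)
    isPreconnected_univ (by fun_prop) (fun p _ => by
      have : Circle.exp (p.2 + 2 * Real.pi) = Circle.exp p.2 := Circle.periodic_exp _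
      rw [Complex.exp_sub, he, he, this, div_self (h0 _ _)])
  have key : ∀ u, HasDeg (κ u) k := fun u =>
    hasDeg_of_lift (L := fun θ => L (u, θ)) (by fun_prop) (fun θ => he (u, θ))
      (fun θ => hk (u, θ) trivial)
  rw [h.unique (key a)]
  exact key b

theorem exists_hasDeg {c : Circle → ℂ} (hc : Continuous c) (h0 : ∀ z, c z ≠ 0) :
    ∃ n, HasDeg c n := by
  obtain ⟨L, hL, he⟩ := exists_continuous_exp_eq (W := ℝ)
    (f := fun p => c (Circle.exp p)) (by fun_prop) (fun _ => h0 _)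
  obtain ⟨k, hk⟩ := exists_eq_two_pi_of_exp_eq_one
    (d := fun p : ℝ => L (p + 2 * Real.pi) - L p)
    isPreconnected_univ (by fun_prop) (fun p _ => by
      have : Circle.exp (p + 2 * Real.pi) = Circle.exp p := Circle.periodic_exp _
      rw [Complex.exp_sub, he, he, this, div_self (h0 _)])
  exact ⟨k, hasDeg_of_lift hL he (fun θ => hk θ trivial)⟩

/-- A loop that extends over the plane has winding number zero. -/
theorem hasDeg_zero_of_extends {k : ℂ → ℂ} (hk : Continuous k) (h0 : ∀ z, k z ≠ 0) :
    HasDeg (fun z => k z) 0 := by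
  obtain ⟨L, hL, he⟩ := exists_continuous_exp_eq hk h0
  exact hasDeg_zero_of_exp (h := fun z => L z) (by fun_prop) (fun z => (he z).symm)

theorem HasDeg.comp {c : Circle → Circle} {e : Circle → ℂ} {d a : ℤ} (hcc : Continuous c)
    (hc : HasDeg (fun z => c z) d) (he : HasDeg e a) : HasDeg (fun z => e (c z)) (a * d) := by
  obtain ⟨g, hg, hgc⟩ := hc
  obtain ⟨g', hg', hgc'⟩ := he
  refine ⟨fun z => a * g z + g' (c z), by fun_prop, fun z => ?_⟩
  have hz : ((c z : Circle) : ℂ) = _ := hgc z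
  beta_reduce
  rw [hgc', hz, mul_zpow, ← zpow_mul, Complex.exp_add, Complex.exp_int_mul, mul_comm d a]
  ring

end Winding

/-! ### Continuous families of complex lines as rank-one orthogonal projections. -/

section LineFamilies

variable {V : Type*} [NormedAddCommGroup V] [InnerProductSpace ℂ V]

/-- The orthogonal projection onto the line spanned by `v`. -/
noncomputable def lineProj (v : V) : V →L[ℂ] V :=
  ((‖v‖ : ℂ) ^ 2)⁻¹ • (innerSL ℂ v).smulRight v

theorem lineProj_apply (v w : V) : lineProj v w = (((‖v‖ : ℂ) ^ 2)⁻¹ * inner ℂ v w) • v := by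
  simp [lineProj, smul_smul]

theorem lineProj_self {v : V} (hv : v ≠ 0) : lineProj v v = v := by
  have : (‖v‖ : ℂ) ≠ 0 := by simpa using hv
  rw [lineProj_apply, inner_self_eq_norm_sq_to_K]
  simp [this]

/-- This invariance lets `lineProj` descend to projective space. -/
theorem lineProj_smul {c : ℂ} (hc : c ≠ 0) (v : V) : lineProj (c • v) = lineProj v := by
  ext w
  rw [lineProj_apply, lineProj_apply, norm_smul, inner_smul_left, smul_smul]
  congr 1
  have h : (starRingEnd ℂ) c * c = (‖c‖ : ℂ) ^ 2 := by
    rw [mul_comm, Complex.mul_conj, Complex.normSq_eq_norm_sq]; simp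
  have h2 : (‖c‖ : ℂ) ≠ 0 := by simpa using hc
  push_cast
  have : ((‖c‖ * ‖v‖ : ℂ) ^ 2)⁻¹ * ((starRingEnd ℂ) c * inner ℂ v w) * c
    = (((‖c‖ : ℂ) ^ 2)⁻¹ * ((starRingEnd ℂ) c * c)) * (((‖v‖ : ℂ) ^ 2)⁻¹ * inner ℂ v w) := by
    rw [mul_pow, mul_inv]; ring
  rw [this, h, inv_mul_cancel₀ (pow_ne_zero 2 h2), one_mul]

theorem eq_smul_of_lineProj_eq {v w : V} (h : lineProj v w = w) : ∃ c : ℂ, w = c • v :=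
  ⟨_, by rw [← lineProj_apply, h]⟩

theorem continuousOn_lineProj : ContinuousOn (lineProj : V → V →L[ℂ] V) {0}ᶜ := by
  unfold lineProj
  refine ContinuousOn.smul (f := fun v : V => ((‖v‖ : ℂ) ^ 2)⁻¹) ?_ ?_
  · apply ContinuousOn.inv₀
    · fun_prop
    · intro v hv; simpa using hv
  · apply Continuous.continuousOn
    have : Continuous fun v : V => (ContinuousLinearMap.smulRightL ℂ V V (innerSL ℂ v)) v :=
      ((ContinuousLinearMap.smulRightL ℂ V V).continuous.comp (innerSL ℂ).continuous).clm_apply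
        continuous_id
    exact this

/-- The operator `Q` is the orthogonal projection onto some line. -/
def IsLineProj (Q : V →L[ℂ] V) : Prop := ∃ v : V, v ≠ 0 ∧ Q = lineProj v

theorem IsLineProj.apply_apply {Q : V →L[ℂ] V} (h : IsLineProj Q) (w : V) : Q (Q w) = Q w := by
  obtain ⟨v, hv, rfl⟩ := h
  conv_lhs => rw [lineProj_apply v w, map_smul, lineProj_self hv, ← lineProj_apply]

theorem IsLineProj.exists_fixed {Q : V →L[ℂ] V} (h : IsLineProj Q) : ∃ v, v ≠ 0 ∧ Q v = v := by
  obtain ⟨v, hv, rfl⟩ := h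
  exact ⟨v, hv, lineProj_self hv⟩

/-- The scalar `c` with `w = c v`, when `w` is a multiple of `v`. -/
noncomputable def lineRatio (v w : V) : ℂ := ((‖v‖ : ℂ) ^ 2)⁻¹ * inner ℂ v w

theorem lineRatio_smul_self {v : V} (hv : v ≠ 0) (c : ℂ) : lineRatio v (c • v) = c := by
  have : (‖v‖ : ℂ) ≠ 0 := by simpa using hv
  rw [lineRatio, inner_smul_right, inner_self_eq_norm_sq_to_K]
  simp [field]

theorem IsLineProj.eq_lineRatio_smul {Q : V →L[ℂ] V} (h : IsLineProj Q) {v w : V} (hv : v ≠ 0)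
    (hQv : Q v = v) (hQw : Q w = w) : w = lineRatio v w • v := by
  obtain ⟨u, hu, rfl⟩ := h
  obtain ⟨a, ha⟩ := eq_smul_of_lineProj_eq hQv
  obtain ⟨b, rfl⟩ := eq_smul_of_lineProj_eq hQw
  have ha0 : a ≠ 0 := by rintro rfl; exact hv (by simpa using ha)
  have : b • u = (b * a⁻¹) • v := by rw [ha, smul_smul]; simp [ha0]
  conv_lhs => rw [this]
  rw [this, lineRatio_smul_self hv]

theorem ContinuousOn.lineRatio {X : Type*} [TopologicalSpace X] {s : Set X} {v w : X → V}
    (hv : ContinuousOn v s) (hw : ContinuousOn w s) (h0 : ∀ x ∈ s, v x ≠ 0) :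
    ContinuousOn (fun x => lineRatio (v x) (w x)) s := by
  unfold _root_.lineRatio
  apply ContinuousOn.mul
  · apply ContinuousOn.inv₀
    · fun_prop
    · intro x hx; simpa using h0 x hx
  · exact ContinuousOn.inner (𝕜 := ℂ) hv hw

theorem IsLineProj.lineRatio_ne_zero {Q : V →L[ℂ] V} (h : IsLineProj Q) {v w : V} (hv : v ≠ 0)
    (hw : w ≠ 0) (hQv : Q v = v) (hQw : Q w = w) : lineRatio v w ≠ 0 := by
  intro h0
  apply hw
  rw [h.eq_lineRatio_smul hv hQv hQw, h0, zero_smul]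

variable {W : Type*} [NormedAddCommGroup W] [NormedSpace ℝ W]

/-- A continuous family of lines over a closed ball has a nowhere vanishing section. -/
theorem exists_section_closedBall [ProperSpace W] {Q : W → V →L[ℂ] V}
    (hQ : ContinuousOn Q (Metric.closedBall 0 1))
    (hl : ∀ x ∈ Metric.closedBall (0 : W) 1, IsLineProj (Q x)) :
    ∃ v : W → V, ContinuousOn v (Metric.closedBall 0 1) ∧
      ∀ x ∈ Metric.closedBall (0 : W) 1, v x ≠ 0 ∧ Q x (v x) = v x := by
  have huc := (isCompact_closedBall (0 : W) 1).uniformContinuousOn_of_continuous hQ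
  obtain ⟨δ, hδ, hu⟩ := Metric.uniformContinuousOn_iff.1 huc 1 one_pos
  -- With steps of length at most `1 / N < δ` along each ray, consecutive projections are at
  -- distance less than one, so projecting a nonzero vector of one line to the next never kills it.
  obtain ⟨N, hN⟩ := exists_nat_gt (1 / δ)
  have hNpos : (0 : ℝ) < N := lt_trans (by positivity) hN
  obtain ⟨v0, hv0, hv0'⟩ := (hl 0 (by simp)).exists_fixed
  have hmem : ∀ j : ℕ, j ≤ N → ∀ x ∈ Metric.closedBall (0 : W) 1,
      ((j : ℝ) / N) • x ∈ Metric.closedBall (0 : W) 1 := by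
    intro j hj x hx
    rw [mem_closedBall_zero_iff] at *
    rw [norm_smul, Real.norm_of_nonneg (by positivity)]
    have : (j : ℝ) / N ≤ 1 := by
      rw [div_le_one hNpos]; exact_mod_cast hj
    calc (j : ℝ) / N * ‖x‖ ≤ 1 * 1 := by gcongr
      _ = 1 := one_mul 1
  have key : ∀ j : ℕ, j ≤ N → ∃ v : W → V, ContinuousOn v (Metric.closedBall 0 1) ∧
      ∀ x ∈ Metric.closedBall (0 : W) 1, v x ≠ 0 ∧ Q (((j : ℝ) / N) • x) (v x) = v x := by
    intro j
    induction j with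
    | zero => exact fun _ => ⟨fun _ => v0, continuousOn_const, fun x _ => by simp [hv0, hv0']⟩
    | succ j ih =>
      intro hj
      obtain ⟨v, hvc, hv⟩ := ih (by omega)
      refine ⟨fun x => Q ((((j + 1 : ℕ) : ℝ) / N) • x) (v x), ?_, fun x hx => ⟨?_, ?_⟩⟩
      · refine ContinuousOn.clm_apply (hQ.comp ?_ (fun x hx => hmem _ hj x hx)) hvc
        fun_prop
      · intro h
        have h0 : Q ((((j + 1 : ℕ) : ℝ) / N) • x) (v x) = 0 := h
        have hm1 := hmem (j + 1) hj x hx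
        have hm0 := hmem j (by omega) x hx
        have hd : dist ((((j + 1 : ℕ) : ℝ) / N) • x) (((j : ℝ) / N) • x) < δ := by
          rw [dist_eq_norm, ← sub_smul, norm_smul]
          have : ((j + 1 : ℕ) : ℝ) / N - j / N = 1 / N := by push_cast; ring
          rw [this, Real.norm_of_nonneg (by positivity)]
          rw [mem_closedBall_zero_iff] at hx
          calc 1 / (N : ℝ) * ‖x‖ ≤ 1 / N * 1 := by gcongr
            _ < δ := by
              rw [mul_one, div_lt_iff₀ hNpos]
              rw [div_lt_iff₀ hδ] at hN
              linarith
        have hlt := hu _ hm1 _ hm0 hd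
        rw [dist_eq_norm] at hlt
        have h1 : ‖v x‖ = ‖(Q ((((j + 1 : ℕ) : ℝ) / N) • x) - Q (((j : ℝ) / N) • x)) (v x)‖ := by
          rw [sub_apply, (hv x hx).2, h0, zero_sub, norm_neg]
        have h2 := ContinuousLinearMap.le_opNorm
          (Q ((((j + 1 : ℕ) : ℝ) / N) • x) - Q (((j : ℝ) / N) • x)) (v x)
        have h3 : 0 < ‖v x‖ := norm_pos_iff.2 (hv x hx).1
        nlinarith
      · exact (hl _ (hmem _ hj x hx)).apply_apply _
  obtain ⟨v, hvc, hv⟩ := key N le_rfl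
  refine ⟨v, hvc, fun x hx => ?_⟩
  have := hv x hx
  rwa [div_self hNpos.ne', one_smul] at this

end LineFamilies

/-! ### Logarithms and sections over spheres, obtained from two hemispheres. -/

section Spheres

variable {W : Type*} [NormedAddCommGroup W] [NormedSpace ℝ W]

/-- Glue two functions on the unit ball to a function on the suspension of the unit sphere,
extended to be constant on open rays. -/
noncomputable def glueBalls {X : Type*} (f g : W → X) (y : W × ℝ) : X :=
  if 0 ≤ y.2 then f ((‖y.1‖ + |y.2|)⁻¹ • y.1) else g ((‖y.1‖ + |y.2|)⁻¹ • y.1)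

omit [NormedSpace ℝ W] in
theorem ell_pos {y : W × ℝ} (hy : y ≠ 0) : 0 < ‖y.1‖ + |y.2| := by
  by_contra h
  have h1 := norm_nonneg y.1
  have h2 := abs_nonneg y.2
  exact hy (Prod.ext (norm_eq_zero.1 (by linarith)) (abs_eq_zero.1 (by linarith)))

theorem ell_smul_mem {y : W × ℝ} (hy : y ≠ 0) :
    (‖y.1‖ + |y.2|)⁻¹ • y.1 ∈ Metric.closedBall (0 : W) 1 := by
  have h := ell_pos hy
  rw [mem_closedBall_zero_iff, norm_smul, Real.norm_of_nonneg (by positivity), inv_mul_le_iff₀ h]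
  linarith [abs_nonneg y.2]

/-- The two branches meet only over `y.2 = 0`, where the normalised point has norm one and `f = g`.
-/
theorem continuousOn_glueBalls {X : Type*} [TopologicalSpace X] {f g : W → X}
    (hf : ContinuousOn f (Metric.closedBall 0 1)) (hg : ContinuousOn g (Metric.closedBall 0 1))
    (hfg : ∀ x ∈ Metric.sphere (0 : W) 1, f x = g x) : ContinuousOn (glueBalls f g) {0}ᶜ := by
  have hc : ContinuousOn (fun y : W × ℝ => (‖y.1‖ + |y.2|)⁻¹ • y.1) {0}ᶜ := by
    refine ContinuousOn.smul (ContinuousOn.inv₀ (by fun_prop) fun y hy => (ell_pos hy).ne') ?_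
    fun_prop
  have hm : Set.MapsTo (fun y : W × ℝ => (‖y.1‖ + |y.2|)⁻¹ • y.1) {0}ᶜ (Metric.closedBall 0 1) :=
    fun y hy => ell_smul_mem hy
  have hf' := continuousOn_iff_continuous_domRestrict.1 (hf.comp hc hm)
  have hg' := continuousOn_iff_continuous_domRestrict.1 (hg.comp hc hm)
  rw [continuousOn_iff_continuous_domRestrict]
  refine Continuous.if_le (f := fun y : ({0}ᶜ : Set (W × ℝ)) => (0 : ℝ)) (g := fun y => y.1.2)
    hf' hg' continuous_const (by fun_prop) ?_
  rintro ⟨y, hy⟩ (h0 : 0 = y.2)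
  apply hfg
  have h := ell_pos hy
  rw [← h0, abs_zero, add_zero] at h ⊢
  rw [mem_sphere_zero_iff_norm, norm_smul, Real.norm_of_nonneg (by positivity)]
  exact inv_mul_cancel₀ h.ne'

theorem glueBalls_smul {X : Type*} (f g : W → X) {r : ℝ} (hr : 0 < r) (y : W × ℝ) :
    glueBalls f g (r • y) = glueBalls f g y := by
  have h : (‖(r • y).1‖ + |(r • y).2|)⁻¹ • (r • y).1 = (‖y.1‖ + |y.2|)⁻¹ • y.1 := by
    simp only [Prod.smul_fst, Prod.smul_snd, norm_smul, smul_eq_mul, abs_mul, abs_of_pos hr,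
      Real.norm_of_nonneg hr.le, ← mul_add, mul_inv, smul_smul]
    congr 1
    field_simp
  have h2 : (0 ≤ (r • y).2) ↔ 0 ≤ y.2 := by
    simp only [Prod.smul_snd, smul_eq_mul]
    exact mul_nonneg_iff_of_pos_left hr
  unfold glueBalls
  simp only [h, h2]

/-- The radial retraction onto the unit ball. -/
noncomputable def ballRetract (x : W) : W := (max 1 ‖x‖)⁻¹ • x

theorem continuous_ballRetract : Continuous (ballRetract : W → W) := by
  unfold ballRetract
  refine Continuous.smul (Continuous.inv₀ (by fun_prop) fun x => ?_) continuous_id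
  have := le_max_left 1 ‖x‖
  positivity

theorem ballRetract_mem (x : W) : ballRetract x ∈ Metric.closedBall (0 : W) 1 := by
  have h1 := le_max_left 1 ‖x‖
  have h2 := le_max_right 1 ‖x‖
  have h : 0 < max 1 ‖x‖ := by linarith
  rw [mem_closedBall_zero_iff, ballRetract, norm_smul, Real.norm_of_nonneg (by positivity),
    inv_mul_le_iff₀ h]
  linarith

theorem ballRetract_of_mem {x : W} (hx : x ∈ Metric.closedBall (0 : W) 1) :
    ballRetract x = x := by
  rw [mem_closedBall_zero_iff] at hx
  simp [ballRetract, max_eq_left hx]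

omit [NormedSpace ℝ W] in
/-- The lower and upper hemispheres as graphs over the ball avoid the origin. -/
theorem hemi_ne_zero (x : W) {ε : ℝ} (hε : ε ≠ 0) : (x, ε * (1 - ‖x‖)) ≠ (0 : W × ℝ) := by
  intro h
  have h1 : x = 0 := congrArg Prod.fst h
  have h2 := congrArg Prod.snd h
  simp [h1] at h2
  exact hε h2

/-- With `ε` the sign of `y.2`, the point on the graph of `ε (1 - ‖x‖)` is the positive multiple
`(‖y.1‖ + |y.2|)⁻¹ • y`. -/
theorem eq_of_homogeneous {X : Type*} {k : W × ℝ → X}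
    (hk : ∀ r : ℝ, 0 < r → ∀ y, k (r • y) = k y) {y : W × ℝ} (hy : y ≠ 0) {ε : ℝ}
    (hε : |y.2| = ε * y.2) (hε1 : ε * ε = 1) :
    k ((‖y.1‖ + |y.2|)⁻¹ • y.1, ε * (1 - ‖(‖y.1‖ + |y.2|)⁻¹ • y.1‖)) = k y := by
  have h := ell_pos hy
  rw [← hk _ (inv_pos.2 h) y]
  congr 1
  refine Prod.ext rfl ?_
  simp only [Prod.smul_snd, smul_eq_mul, norm_smul, norm_inv, Real.norm_of_nonneg h.le]
  have e : y.2 = ε * |y.2| := by rw [hε, ← mul_assoc, hε1, one_mul]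
  rw [show (‖y.1‖ + |y.2|)⁻¹ * y.2 = (‖y.1‖ + |y.2|)⁻¹ * (ε * |y.2|) by rw [← e]]
  field_simp
  ring

omit [NormedAddCommGroup W] [NormedSpace ℝ W] in
theorem hemi_cases (y : W × ℝ) :
    (0 ≤ y.2 ∧ |y.2| = 1 * y.2) ∨ (¬ 0 ≤ y.2 ∧ |y.2| = -1 * y.2) := by
  by_cases h : 0 ≤ y.2
  · exact Or.inl ⟨h, by rw [abs_of_nonneg h, one_mul]⟩
  · exact Or.inr ⟨h, by rw [abs_of_neg (not_le.1 h), neg_one_mul]⟩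

/-- Nowhere vanishing functions on spheres of dimension at least two have logarithms. -/
theorem exists_log_sphere (hW : 1 < Module.rank ℝ W) {k : W × ℝ → ℂ}
    (hkc : ContinuousOn k {0}ᶜ) (hk0 : ∀ y, y ≠ 0 → k y ≠ 0)
    (hk : ∀ r : ℝ, 0 < r → ∀ y, k (r • y) = k y) :
    ∃ K : W × ℝ → ℂ, ContinuousOn K {0}ᶜ ∧ ∀ y, y ≠ 0 → Complex.exp (K y) = k y := by
  -- A logarithm over each hemisphere, seen as a graph over the ball; `ballRetract` extends the
  -- function to all of `W`.
  have hc : ∀ ε : ℝ, ε ≠ 0 → ∃ h : W → ℂ, Continuous h ∧ ∀ x ∈ Metric.closedBall (0 : W) 1,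
      Complex.exp (h x) = k (x, ε * (1 - ‖x‖)) := by
    intro ε hε
    obtain ⟨h, hh, he⟩ := exists_continuous_exp_eq
      (f := fun x => k (ballRetract x, ε * (1 - ‖ballRetract x‖)))
      (hkc.comp_continuous (by have := continuous_ballRetract (W := W); fun_prop)
        (fun x => hemi_ne_zero _ hε)) (fun x => hk0 _ (hemi_ne_zero _ hε))
    exact ⟨h, hh, fun x hx => by rw [he, ballRetract_of_mem hx]⟩
  obtain ⟨f, hf, hfe⟩ := hc 1 one_ne_zero
  obtain ⟨g, hg, hge⟩ := hc (-1) (by norm_num)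
  -- The equator is connected because `dim W > 1`, so the two logarithms differ there by a constant,
  -- which is absorbed into `g`.
  obtain ⟨n, hn⟩ := exists_eq_two_pi_of_exp_eq_one (isPathConnected_sphere hW 0
    zero_le_one).isConnected.isPreconnected (d := fun x => f x - g x) (by fun_prop) (fun x hx => by
      have hx' := Metric.sphere_subset_closedBall hx
      rw [Complex.exp_sub, hfe x hx', hge x hx', mem_sphere_zero_iff_norm.1 hx]
      simp only [sub_self, mul_zero]
      apply div_self
      apply hk0
      intro h
      have : x = 0 := congrArg Prod.fst h
      simp [this] at hx)
  refine ⟨glueBalls f (fun x => g x + n * (2 * Real.pi * Complex.I)), ?_, fun y hy => ?_⟩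
  · exact continuousOn_glueBalls hf.continuousOn (by fun_prop)
      (fun x hx => by linear_combination hn x hx)
  · rcases hemi_cases y with ⟨h, he⟩ | ⟨h, he⟩
    · rw [glueBalls, if_pos h, hfe _ (ell_smul_mem hy), eq_of_homogeneous hk hy he (by norm_num)]
    · rw [glueBalls, if_neg h, Complex.exp_add, Complex.exp_int_mul_two_pi_mul_I, mul_one,
        hge _ (ell_smul_mem hy), eq_of_homogeneous hk hy he (by norm_num)]

/-- A family of lines over a sphere of dimension at least four is trivial. -/
theorem exists_section_sphere {V : Type*} [NormedAddCommGroup V] [InnerProductSpace ℂ V]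
    [FiniteDimensional ℝ W] (hW : 1 < Module.rank ℝ W) {Q : (W × ℝ) × ℝ → V →L[ℂ] V}
    (hQc : ContinuousOn Q {0}ᶜ) (hl : ∀ y, y ≠ 0 → IsLineProj (Q y))
    (hQ : ∀ r : ℝ, 0 < r → ∀ y, Q (r • y) = Q y) :
    ∃ v : (W × ℝ) × ℝ → V, ContinuousOn v {0}ᶜ ∧ (∀ y, y ≠ 0 → v y ≠ 0 ∧ Q y (v y) = v y) ∧
      ∀ r : ℝ, 0 < r → ∀ y, v (r • y) = v y := by
  have : ProperSpace W := FiniteDimensional.proper ℝ W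
  have hc : ∀ ε : ℝ, ε ≠ 0 → ∃ v : W × ℝ → V, ContinuousOn v (Metric.closedBall 0 1) ∧
      ∀ x ∈ Metric.closedBall (0 : W × ℝ) 1, v x ≠ 0 ∧ Q (x, ε * (1 - ‖x‖)) (v x) = v x :=
    fun ε hε => exists_section_closedBall (Q := fun x => Q (x, ε * (1 - ‖x‖)))
      (hQc.comp (by fun_prop) fun x _ => hemi_ne_zero x hε)
      (fun x _ => hl _ (hemi_ne_zero x hε))
  obtain ⟨f, hf, hfe⟩ := hc 1 one_ne_zero
  obtain ⟨g, hg, hge⟩ := hc (-1) (by norm_num)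
  have hsph : ∀ y : W × ℝ, y ≠ 0 → ‖y‖⁻¹ • y ∈ Metric.sphere (0 : W × ℝ) 1 := fun y hy => by
    rw [mem_sphere_zero_iff_norm, norm_smul, norm_inv, norm_norm,
      inv_mul_cancel₀ (norm_ne_zero_iff.2 hy)]
  have hfix : ∀ x ∈ Metric.sphere (0 : W × ℝ) 1, ((x, 0) : (W × ℝ) × ℝ) ≠ 0 ∧ f x ≠ 0 ∧
      g x ≠ 0 ∧ Q (x, 0) (f x) = f x ∧ Q (x, 0) (g x) = g x := by
    intro x hx
    have hx' := Metric.sphere_subset_closedBall hx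
    have h1 := hfe x hx'
    have h2 := hge x hx'
    rw [mem_sphere_zero_iff_norm.1 hx] at h1 h2
    simp only [sub_self, mul_zero] at h1 h2
    refine ⟨fun h => ?_, h1.1, h2.1, h1.2, h2.2⟩
    have : x = 0 := congrArg Prod.fst h
    simp [this] at hx
  have hnc : ContinuousOn (fun y : W × ℝ => ‖y‖⁻¹ • y) {0}ᶜ :=
    ContinuousOn.smul (ContinuousOn.inv₀ (by fun_prop) fun y hy => norm_ne_zero_iff.2 hy)
      continuousOn_id
  -- The clutching function `f / g` on the equator has a logarithm, so it can be made to extend over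
  -- a hemisphere.
  obtain ⟨K, hK, hKe⟩ := exists_log_sphere hW
    (k := fun y => lineRatio (g (‖y‖⁻¹ • y)) (f (‖y‖⁻¹ • y)))
    (ContinuousOn.lineRatio
      (hg.comp hnc fun y hy => Metric.sphere_subset_closedBall (hsph y hy))
      (hf.comp hnc fun y hy => Metric.sphere_subset_closedBall (hsph y hy))
      (fun y hy => (hfix _ (hsph y hy)).2.2.1))
    (fun y hy => by
      obtain ⟨h0, hf0, hg0, hQf, hQg⟩ := hfix _ (hsph y hy)
      exact (hl _ h0).lineRatio_ne_zero hg0 hf0 hQg hQf)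
    (fun r hr y => by
      have : ‖r • y‖⁻¹ • r • y = ‖y‖⁻¹ • y := by
        rw [norm_smul, Real.norm_of_nonneg hr.le, mul_inv, smul_smul]
        congr 1
        field_simp
      simp only [this])
  -- Tietze extension of the logarithm; rescaling `g` by its exponential makes it agree with `f` on
  -- the equator without creating zeros.
  obtain ⟨Kx, hKx⟩ := ContinuousMap.exists_restrict_eq (Metric.isClosed_sphere (x := (0 : W × ℝ)) (ε := 1))
    ⟨_, continuousOn_iff_continuous_domRestrict.1
      (hK.mono (s := {0}ᶜ) (t := Metric.sphere (0 : W × ℝ) 1) (fun x hx h => by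
        rw [Set.mem_singleton_iff] at h; simp [h] at hx))⟩
  have hKx' : ∀ x ∈ Metric.sphere (0 : W × ℝ) 1, Kx x = K x := fun x hx =>
    congrArg (fun F : C(Metric.sphere (0 : W × ℝ) 1, ℂ) => F ⟨x, hx⟩) hKx
  refine ⟨glueBalls f (fun x => Complex.exp (Kx x) • g x), ?_, fun y hy => ?_, fun r hr y =>
    glueBalls_smul _ _ hr y⟩
  · refine continuousOn_glueBalls hf (ContinuousOn.smul ?_ hg) fun x hx => ?_
    · exact (Complex.continuous_exp.comp Kx.continuous).continuousOn
    · obtain ⟨h0, hf0, hg0, hQf, hQg⟩ := hfix x hx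
      have hx0 : x ≠ 0 := fun h => by simp [h] at hx
      rw [hKx' x hx, hKe x hx0, mem_sphere_zero_iff_norm.1 hx, inv_one, one_smul]
      exact (hl _ h0).eq_lineRatio_smul hg0 hQg hQf
  · rcases hemi_cases y with ⟨h, he⟩ | ⟨h, he⟩
    · rw [glueBalls, if_pos h]
      have := hfe _ (ell_smul_mem hy)
      rwa [eq_of_homogeneous hQ hy he (by norm_num)] at this
    · rw [glueBalls, if_neg h]
      have := hge _ (ell_smul_mem hy)
      rw [eq_of_homogeneous hQ hy he (by norm_num)] at this
      exact ⟨smul_ne_zero (Complex.exp_ne_zero _) this.1, by rw [map_smul, this.2]⟩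

end Spheres

/-! ### Characters, one-parameter subgroups and automorphisms of the torus. -/

section TorusCharacters

/-- The exponent is the winding number of the power map. -/
theorem Circle.zpow_eq_one_iff_forall {n : ℤ} : (∀ z : Circle, z ^ n = 1) ↔ n = 0 := by
  refine ⟨fun h => ?_, fun h z => by simp [h]⟩
  have h1 : HasDeg (fun z => (z : ℂ) ^ n) 0 :=
    (hasDeg_const (a := 1) one_ne_zero).congr fun z => by
      have := congrArg (fun w : Circle => (w : ℂ)) (h z)
      simpa using this
  exact (hasDeg_zpow n).unique h1

theorem Circle.zpow_injective {n m : ℤ} (h : ∀ z : Circle, z ^ n = z ^ m) : n = m := by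
  rw [← sub_eq_zero]
  refine Circle.zpow_eq_one_iff_forall.1 fun z => ?_
  rw [zpow_sub, h z, mul_inv_cancel]

/-- Every continuous endomorphism of the circle is a power map. -/
theorem Circle.exists_eq_zpow (f : Circle →* Circle) (hf : Continuous f) :
    ∃ n : ℤ, ∀ z, f z = z ^ n := by
  obtain ⟨n, h, hh, he⟩ := exists_hasDeg (c := fun z => (f z : ℂ)) (by fun_prop)
    (fun z => (f z).coe_ne_zero)
  have hexp : ∀ z, Complex.exp (h z) = (f z : ℂ) / (z : ℂ) ^ n := fun z => by
    rw [eq_div_iff (zpow_ne_zero n z.coe_ne_zero), mul_comm]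
    exact (he z).symm
  have hconn : IsPreconnected (Set.univ : Set (Circle × Circle)) := isPreconnected_univ
  -- The logarithm of `f z / z ^ n` is additive up to a constant. Once shifted to be additive it is
  -- bounded on the compact circle, hence zero since `g (z ^ j) = j * g z`.
  obtain ⟨k, hk⟩ := exists_eq_two_pi_of_exp_eq_one hconn
    (d := fun p : Circle × Circle => h (p.1 * p.2) - h p.1 - h p.2) (by fun_prop) (fun p _ => by
      have h1 := p.1.coe_ne_zero
      have h2 := p.2.coe_ne_zero
      have h3 := (f p.1).coe_ne_zero
      have h4 := (f p.2).coe_ne_zero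
      rw [Complex.exp_sub, Complex.exp_sub, hexp, hexp, hexp, map_mul, Circle.coe_mul,
        Circle.coe_mul, mul_zpow]
      field_simp)
  let g : Circle → ℂ := fun z => h z + k * (2 * Real.pi * Complex.I)
  have hadd : ∀ z w, g (z * w) = g z + g w := fun z w => by
    have := hk (z, w) trivial
    simp only [g]
    linear_combination this
  have hg1 : g 1 = 0 := by have := hadd 1 1; rw [mul_one] at this; simpa using this
  have hpow : ∀ z (j : ℕ), g (z ^ j) = j * g z := fun z j => by
    induction j with
    | zero => simp [hg1]
    | succ j ih => rw [pow_succ, hadd, ih]; push_cast; ring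
  have hgc : Continuous g := by fun_prop
  obtain ⟨C, hC⟩ := isCompact_univ.exists_bound_of_continuousOn hgc.continuousOn
  have hg0 : ∀ z, g z = 0 := fun z => by
    by_contra hne
    have hpos : 0 < ‖g z‖ := norm_pos_iff.2 hne
    obtain ⟨j, hj⟩ := exists_nat_gt (C / ‖g z‖)
    rw [div_lt_iff₀ hpos] at hj
    have := hC (z ^ j) trivial
    rw [hpow, norm_mul, Complex.norm_natCast] at this
    linarith
  refine ⟨n, fun z => ?_⟩
  have h1 : Complex.exp (h z) = 1 := by
    have : h z = -(k * (2 * Real.pi * Complex.I)) := by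
      have := hg0 z
      simp only [g] at this
      linear_combination this
    rw [this, Complex.exp_neg, Complex.exp_int_mul_two_pi_mul_I, inv_one]
  ext
  have := he z
  rw [h1, mul_one] at this
  simpa using this

variable {n : ℕ}

theorem oneParam_apply (v : Fin n → ℤ) (z : Circle) (i : Fin n) : oneParam v z i = z ^ v i := rfl

theorem continuous_oneParam (v : Fin n → ℤ) : Continuous (oneParam v) :=
  continuous_pi fun i => continuous_zpow (v i)

/-- The character of the torus with exponents `χ`. -/
noncomputable def torusChar (χ : Fin n → ℤ) : Torus n →* Circle where
  toFun t := ∏ i, t i ^ χ i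
  map_one' := by simp
  map_mul' a b := by simp [mul_zpow, Finset.prod_mul_distrib]

theorem torusChar_apply (χ : Fin n → ℤ) (t : Torus n) : torusChar χ t = ∏ i, t i ^ χ i := rfl

theorem continuous_torusChar (χ : Fin n → ℤ) : Continuous (torusChar χ) :=
  continuous_finsetProd (M := Circle) Finset.univ (f := fun i (t : Torus n) => t i ^ χ i)
    fun i _ => (continuous_apply i).zpow (χ i)

theorem torusChar_oneParam (χ v : Fin n → ℤ) (z : Circle) :
    torusChar χ (oneParam v z) = z ^ (v ⬝ᵥ χ) := by
  have hs : ∀ s : Finset (Fin n), z ^ (∑ i ∈ s, v i * χ i) = ∏ i ∈ s, z ^ (v i * χ i) := by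
    intro s
    induction s using Finset.induction_on with
    | empty => simp
    | insert a s ha ih => rw [Finset.sum_insert ha, Finset.prod_insert ha, zpow_add, ih]
  rw [torusChar_apply, dotProduct, hs]
  exact Finset.prod_congr rfl fun i _ => by rw [oneParam_apply, zpow_mul]

/-- The integer vector `v` is primitive. -/
def IsPrimitiveVec (v : Fin n → ℤ) : Prop := ∃ χ : Fin n → ℤ, v ⬝ᵥ χ = 1

/-- The character `χ` recovers the parameter `y` of a point of the circle of `v`, so on the circle
of `w` it gives `y = z ^ (w ⬝ᵥ χ)`. -/
theorem eq_smul_of_range_le {v w : Fin n → ℤ} {χ : Fin n → ℤ} (hχ : v ⬝ᵥ χ = 1)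
    (h : (oneParam w).range ≤ (oneParam v).range) : w = (w ⬝ᵥ χ) • v := by
  funext i
  refine Circle.zpow_injective fun z => ?_
  obtain ⟨y, hy⟩ := h ⟨z, rfl⟩
  have h1 : y = z ^ (w ⬝ᵥ χ) := by
    have := congrArg (torusChar χ) hy
    rwa [torusChar_oneParam, torusChar_oneParam, hχ, zpow_one] at this
  have h2 := congrFun hy i
  rw [oneParam_apply, oneParam_apply] at h2
  rw [← h2, h1, Pi.smul_apply, smul_eq_mul, zpow_mul]

/-- Each vector is an integer multiple of the other, and the two factors have product one. -/
theorem eq_or_eq_neg_of_range_eq {v w : Fin n → ℤ} (hv : IsPrimitiveVec v) (hw : IsPrimitiveVec w)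
    (h : (oneParam v).range = (oneParam w).range) : w = v ∨ w = -v := by
  obtain ⟨χ, hχ⟩ := hv
  obtain ⟨ψ, hψ⟩ := hw
  have h1 := eq_smul_of_range_le hχ h.ge
  have h2 := eq_smul_of_range_le hψ h.le
  have h3 : (w ⬝ᵥ χ) * (v ⬝ᵥ ψ) = 1 := by
    have : w ⬝ᵥ ψ = ((w ⬝ᵥ χ) • v) ⬝ᵥ ψ := congrArg (· ⬝ᵥ ψ) h1
    rw [hψ, smul_dotProduct, smul_eq_mul] at this
    exact this.symm
  rcases Int.eq_one_or_neg_one_of_mul_eq_one h3 with h4 | h4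
  · left; rw [h1, h4, one_smul]
  · right; rw [h1, h4, neg_one_smul]

theorem torus_eq_prod_mulSingle (t : Torus n) : t = ∏ i, Pi.mulSingle i (t i) :=
  (Finset.univ_prod_mulSingle t).symm

/-- A continuous automorphism of the torus is given by an invertible integer matrix. -/
theorem exists_matrix_of_torusAut (δ : Torus n ≃ₜ* Torus n) :
    ∃ A B : Matrix (Fin n) (Fin n) ℤ, A * B = 1 ∧
      (∀ j z, δ.symm (Pi.mulSingle j z) = oneParam (A j) z) := by
  have key : ∀ e : Torus n ≃ₜ* Torus n, ∃ A : Matrix (Fin n) (Fin n) ℤ,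
      ∀ j z, e (Pi.mulSingle j z) = oneParam (A j) z := by
    intro e
    have : ∀ j i, ∃ a : ℤ, ∀ z : Circle, e (Pi.mulSingle j z) i = z ^ a := by
      intro j i
      refine Circle.exists_eq_zpow
        ((Pi.evalMonoidHom (fun _ : Fin n => Circle) i).comp
          (e.toMulEquiv.toMonoidHom.comp (MonoidHom.mulSingle (fun _ : Fin n => Circle) j))) ?_
      exact (continuous_apply i).comp (e.continuous.comp
        (continuous_mulSingle (A := fun _ : Fin n => Circle) j))
    choose A hA using this
    exact ⟨A, fun j z => funext fun i => hA j i z⟩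
  obtain ⟨A, hA⟩ := key δ.symm
  obtain ⟨B, hB⟩ := key δ
  refine ⟨A, B, ?_, hA⟩
  ext j i
  refine Circle.zpow_injective fun z => ?_
  have h1 : δ (oneParam (A j) z) = Pi.mulSingle j z := by
    rw [← hA, ContinuousMulEquiv.apply_symm_apply]
  have h2 : δ (oneParam (A j) z) i = z ^ (A * B) j i := by
    conv_lhs => rw [torus_eq_prod_mulSingle (oneParam (A j) z), map_prod, Finset.prod_apply]
    have := torusChar_oneParam (fun k => B k i) (A j) z
    rw [Matrix.mul_apply']
    refine Eq.trans ?_ this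
    rw [torusChar_apply]
    exact Finset.prod_congr rfl fun k _ => by rw [hB, oneParam_apply]
  rw [← h2, h1]
  by_cases hij : i = j
  · subst hij; simp
  · rw [Pi.mulSingle_eq_of_ne hij, Matrix.one_apply_ne (Ne.symm hij), zpow_zero]

/-- Two circles whose directions form a lattice basis generate the torus. -/
theorem sup_range_oneParam_eq_top {v w : Fin 2 → ℤ} {d : ℤ} (hd : d * d = 1)
    (h : v 0 * w 1 - v 1 * w 0 = d) : (oneParam v).range ⊔ (oneParam w).range = ⊤ := by
  rw [eq_top_iff]
  intro t _
  rw [Subgroup.mem_sup]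
  -- The exponents are the entries of the inverse of the matrix with rows `v, w`; since `d = ±1`,
  -- multiplying by `d` is dividing by it.
  refine ⟨_, ⟨t 0 ^ (d * w 1) * t 1 ^ (-(d * w 0)), rfl⟩,
    _, ⟨t 0 ^ (-(d * v 1)) * t 1 ^ (d * v 0), rfl⟩, ?_⟩
  funext i
  rw [Pi.mul_apply, oneParam_apply, oneParam_apply, mul_zpow, mul_zpow, ← zpow_mul, ← zpow_mul,
    ← zpow_mul, ← zpow_mul, mul_mul_mul_comm, ← zpow_add, ← zpow_add]
  fin_cases i
  · simp only [Fin.zero_eta]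
    rw [show d * w 1 * v 0 + -(d * v 1) * w 0 = 1 by linear_combination d * h + hd,
      show -(d * w 0) * v 0 + d * v 0 * w 0 = 0 by ring]
    simp
  · simp only [Fin.mk_one]
    rw [show d * w 1 * v 1 + -(d * v 1) * w 1 = 0 by ring,
      show -(d * w 0) * v 1 + d * v 0 * w 1 = 1 by linear_combination d * h + hd]
    simp

end TorusCharacters

/-! ### Faces of polytopes: supporting functionals, interiors and vertices. -/

section Polygons

variable {n : ℕ} {P : Set (EuclideanSpace ℝ (Fin n))}

theorem IsSimplePolytope.isCompact (hP : IsSimplePolytope P) : IsCompact P := by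
  obtain ⟨S, hS, rfl⟩ := hP.exists_finite
  exact hS.isCompact_convexHull ℝ

theorem IsSimplePolytope.convex (hP : IsSimplePolytope P) : Convex ℝ P := by
  obtain ⟨S, hS, rfl⟩ := hP.exists_finite
  exact convex_convexHull ℝ S

theorem IsSimplePolytope.finite_extremePoints (hP : IsSimplePolytope P) :
    (P.extremePoints ℝ).Finite := by
  obtain ⟨S, hS, rfl⟩ := hP.exists_finite
  exact hS.subset extremePoints_convexHull_subset

theorem vectorSpan_eq_top_of_interior_nonempty {G : Set (EuclideanSpace ℝ (Fin n))}
    (h : (interior G).Nonempty) : vectorSpan ℝ G = ⊤ := by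
  have h1 : affineSpan ℝ G = ⊤ := by
    rw [eq_top_iff, ← isOpen_interior.affineSpan_eq_top h]
    exact affineSpan_mono ℝ interior_subset
  rw [← direction_affineSpan, h1, AffineSubspace.direction_top]

theorem Facet.subset (G : Facet P) : G.1 ⊆ P := G.2.1.2.subset

theorem Facet.isExtreme (G : Facet P) : IsExtreme ℝ P G.1 := G.2.1.2.isExtreme

theorem Facet.isCompact (hP : IsSimplePolytope P) (G : Facet P) : IsCompact G.1 :=
  G.2.1.2.isCompact hP.isCompact

/-- A facet is cut out by a supporting half-space. -/
theorem Facet.exists_functional (hP : IsSimplePolytope P) (G : Facet P) :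
    ∃ (l : EuclideanSpace ℝ (Fin n) →L[ℝ] ℝ) (m : ℝ), (∀ x ∈ P, l x ≤ m) ∧
      (∀ x ∈ P, (x ∈ G.1 ↔ l x = m)) ∧ ∃ x ∈ P, l x < m := by
  obtain ⟨l, hl⟩ := G.2.1.2 G.2.1.1
  obtain ⟨g, hg⟩ := G.2.1.1
  have hg' := hg
  rw [hl] at hg'
  have hiff : ∀ x ∈ P, (x ∈ G.1 ↔ l x = l g) := fun x hx => by
    rw [hl]
    refine ⟨fun h => le_antisymm (hg'.2 x hx) (h.2 g hg'.1), fun h => ⟨hx, fun y hy => ?_⟩⟩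
    rw [h]; exact hg'.2 y hy
  refine ⟨l, l g, hg'.2, hiff, ?_⟩
  by_contra hne
  push Not at hne
  have hGP : G.1 = P := by
    refine Set.Subset.antisymm G.subset fun x hx => ?_
    rw [hiff x hx]
    exact le_antisymm (hg'.2 x hx) (hne x hx)
  have := G.2.2
  rw [faceDim, hGP, vectorSpan_eq_top_of_interior_nonempty hP.interior_nonempty, finrank_top,
    finrank_euclideanSpace_fin] at this
  omega

/-- From an interior point one could move slightly away from a point `x` where `l` is smaller, and
exceed the maximum of `l`. -/
theorem Facet.notMem_interior (hP : IsSimplePolytope P) (G : Facet P)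
    {p : EuclideanSpace ℝ (Fin n)} (hp : p ∈ G.1) : p ∉ interior P := by
  intro hi
  obtain ⟨l, m, hle, hiff, x, hx, hlt⟩ := G.exists_functional hP
  have hpm : l p = m := (hiff p (G.subset hp)).1 hp
  have hc : Filter.Tendsto (fun t : ℝ => p + t • (p - x)) (nhdsWithin 0 (Set.Ioi 0)) (nhds p) := by
    have : Continuous fun t : ℝ => p + t • (p - x) := by fun_prop
    have h := this.tendsto 0
    simp only [zero_smul, add_zero] at h
    exact h.mono_left nhdsWithin_le_nhds
  obtain ⟨t, ht, ht0⟩ := ((hc.eventually (mem_interior_iff_mem_nhds.1 hi)).and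
    self_mem_nhdsWithin).exists
  have := hle _ ht
  rw [map_add, map_smul, map_sub, hpm, smul_eq_mul] at this
  have ht0' : 0 < t := ht0
  nlinarith [mul_pos ht0' (sub_pos.2 hlt)]

/-- The segment from `b` to `p` can be prolonged a little beyond `p` inside `G`, so `p` lies in an
open segment of `P`. -/
theorem notMem_extremePoints_of_mem_intrinsicInterior {G : Set (EuclideanSpace ℝ (Fin n))}
    (hG : G ⊆ P) {p b : EuclideanSpace ℝ (Fin n)} (hp : p ∈ intrinsicInterior ℝ G) (hb : b ∈ G)
    (hbp : b ≠ p) : p ∉ P.extremePoints ℝ := by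
  intro hext
  obtain ⟨y, hy, hyp⟩ := mem_intrinsicInterior.1 hp
  subst hyp
  have : Nonempty (affineSpan ℝ G) := ⟨y⟩
  let b' : affineSpan ℝ G := ⟨b, subset_affineSpan ℝ G hb⟩
  have hc : Filter.Tendsto (fun t : ℝ => AffineMap.lineMap (k := ℝ) y b' (-t))
      (nhdsWithin 0 (Set.Ioi 0)) (nhds y) := by
    have : Continuous fun t : ℝ => AffineMap.lineMap (k := ℝ) y b' (-t) :=
      AffineMap.lineMap_continuous.comp continuous_neg
    have h := this.tendsto 0
    simp only [neg_zero, AffineMap.lineMap_apply_zero] at h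
    exact h.mono_left nhdsWithin_le_nhds
  obtain ⟨t, ht, ht0⟩ := ((hc.eventually (mem_interior_iff_mem_nhds.1 hy)).and
    self_mem_nhdsWithin).exists
  have ht0' : 0 < t := ht0
  have hcoe : ((AffineMap.lineMap (k := ℝ) y b' (-t) : affineSpan ℝ G) :
      EuclideanSpace ℝ (Fin n)) = (y : EuclideanSpace ℝ (Fin n)) + (-t) • (b - y) := by
    rw [AffineMap.lineMap_apply]
    simp [b', add_comm]
  have hz : (y : EuclideanSpace ℝ (Fin n)) + (-t) • (b - y) ∈ G := by
    rw [← hcoe]; exact ht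
  have hos : (y : EuclideanSpace ℝ (Fin n)) ∈ openSegment ℝ
      ((y : EuclideanSpace ℝ (Fin n)) + (-t) • (b - y)) b := by
    refine ⟨1 / (1 + t), t / (1 + t), by positivity, by positivity, by field_simp, ?_⟩
    ext i
    simp only [PiLp.add_apply, PiLp.smul_apply, PiLp.sub_apply, smul_eq_mul]
    field_simp
    ring
  have := hext.2 (hG hz) (hG hb) hos
  have h2 : (-t) • (b - (y : EuclideanSpace ℝ (Fin n))) = 0 := by simpa using this
  rcases smul_eq_zero.1 h2 with h3 | h3
  · linarith
  · exact hbp (sub_eq_zero.1 h3)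

theorem mem_extremePoints_of_faceDim_eq_zero {G : Set (EuclideanSpace ℝ (Fin n))}
    (hG : IsFace P G) (hd : faceDim G = 0) {p : EuclideanSpace ℝ (Fin n)} (hp : p ∈ G) :
    p ∈ P.extremePoints ℝ := by
  have h : vectorSpan ℝ G = ⊥ := Submodule.finrank_eq_zero.1 hd
  rw [vectorSpan_eq_bot_iff_subsingleton ℝ] at h
  have : G = {p} := h.eq_singleton_of_mem hp
  have hE := hG.2.isExtreme
  rw [this] at hE
  exact isExtreme_singleton.1 hE

theorem mem_interior_of_faceDim_eq {G : Set (EuclideanSpace ℝ (Fin n))}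
    (hG : G ⊆ P) (hd : faceDim G = n) {p : EuclideanSpace ℝ (Fin n)}
    (hp : p ∈ intrinsicInterior ℝ G) : p ∈ interior P := by
  have hpG := intrinsicInterior_subset hp
  have h1 : vectorSpan ℝ G = ⊤ := by
    apply Submodule.eq_top_of_finrank_eq
    rw [finrank_euclideanSpace_fin]; exact hd
  have h2 : affineSpan ℝ G = ⊤ := by
    rw [← AffineSubspace.direction_eq_top_iff_of_nonempty
      ((affineSpan_nonempty ℝ).2 ⟨p, hpG⟩), direction_affineSpan, h1]
  obtain ⟨y, hy, hyp⟩ := mem_intrinsicInterior.1 hp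
  have hopen : IsOpen (Subtype.val '' interior ((↑) ⁻¹' G : Set (affineSpan ℝ G))) := by
    refine IsOpen.isOpenMap_subtype_val ?_ _ isOpen_interior
    rw [h2]; exact isOpen_univ
  refine mem_interior.2 ⟨_, ?_, hopen, ⟨y, hy, hyp⟩⟩
  rintro _ ⟨z, hz, rfl⟩
  exact hG (interior_subset (s := Subtype.val ⁻¹' G) hz)

end Polygons

/-! ### Combinatorics of edges and vertices of polygons. -/

section PlanarPolygons

variable {P : Set (EuclideanSpace ℝ (Fin 2))}

/-- A facet of a polygon is a segment between two vertices. -/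
theorem Facet.exists_eq_segment (hP : IsSimplePolytope P) (G : Facet P) :
    ∃ a b, a ≠ b ∧ G.1 = segment ℝ a b ∧ a ∈ P.extremePoints ℝ ∧ b ∈ P.extremePoints ℝ := by
  have hd : Module.finrank ℝ (vectorSpan ℝ G.1) = 1 := by
    have := G.2.2; rw [faceDim] at this; omega
  obtain ⟨v, hv0, hv⟩ := finrank_eq_one_iff'.1 hd
  have hv0' : (v : EuclideanSpace ℝ (Fin 2)) ≠ 0 := fun h => hv0 (Subtype.ext h)
  have hspan : ∀ x ∈ G.1, ∀ y ∈ G.1, ∃ c : ℝ, y = x + c • (v : EuclideanSpace ℝ (Fin 2)) := by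
    intro x hx y hy
    obtain ⟨c, hc⟩ := hv ⟨y - x, vsub_mem_vectorSpan ℝ hy hx⟩
    refine ⟨c, ?_⟩
    have := congrArg Subtype.val hc
    simp only [Submodule.coe_smul] at this
    rw [this]; abel
  -- A linear coordinate along the edge, injective on `G`. Its minimum and maximum points are the
  -- endpoints, and they are vertices because `G` is an extreme subset.
  let f : EuclideanSpace ℝ (Fin 2) → ℝ := fun x => inner ℝ (v : EuclideanSpace ℝ (Fin 2)) x
  have hfc : Continuous f := by fun_prop
  have hvv : 0 < inner ℝ (v : EuclideanSpace ℝ (Fin 2)) v := real_inner_self_pos.2 hv0'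
  have hf : ∀ (x : EuclideanSpace ℝ (Fin 2)) (c : ℝ), f (x + c • (v : EuclideanSpace ℝ (Fin 2)))
      = f x + c * inner ℝ (v : EuclideanSpace ℝ (Fin 2)) v := fun x c => by
    simp only [f, inner_add_right, inner_smul_right]
  obtain ⟨a, haG, ha⟩ := (G.isCompact hP).exists_isMinOn G.2.1.1 hfc.continuousOn
  obtain ⟨b, hbG, hb⟩ := (G.isCompact hP).exists_isMaxOn G.2.1.1 hfc.continuousOn
  have ha' : ∀ x ∈ G.1, f a ≤ f x := fun x hx => ha hx
  have hb' : ∀ x ∈ G.1, f x ≤ f b := fun x hx => hb hx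
  have hinj : ∀ x ∈ G.1, ∀ y ∈ G.1, f x = f y → x = y := by
    intro x hx y hy h
    obtain ⟨c, rfl⟩ := hspan x hx y hy
    rw [hf] at h
    have : c = 0 := by
      by_contra hc
      exact mul_ne_zero hc hvv.ne' (by linarith)
    simp [this]
  have hab : a ≠ b := by
    rintro rfl
    have hs : G.1.Subsingleton := fun x hx y hy =>
      hinj x hx y hy (le_antisymm ((hb' x hx).trans (ha' y hy)) ((hb' y hy).trans (ha' x hx)))
    rw [(vectorSpan_eq_bot_iff_subsingleton ℝ).2 hs, finrank_bot] at hd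
    exact zero_ne_one hd
  have hext : ∀ p ∈ G.1, ∀ s : ℝ, s ≠ 0 → (∀ x ∈ G.1, s * f p ≤ s * f x) →
      p ∈ P.extremePoints ℝ := by
    intro p hp s hs hmin
    refine ⟨G.subset hp, fun x hx y hy hxy => ?_⟩
    have hxG := G.isExtreme.2 hx hy hp hxy
    have hyG := G.isExtreme.right_mem_of_mem_openSegment hx hy hp hxy
    obtain ⟨r, t, hr, ht, hrt, hpe⟩ := hxy
    have h1 := hmin x hxG
    have h2 := hmin y hyG
    have h3 : f p = r * f x + t * f y := by
      rw [← hpe]; simp only [f, inner_add_right, inner_smul_right]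
    have h4 : s * f x = s * f p := by
      have e : s * f p = r * (s * f x) + t * (s * f y) := by rw [h3]; ring
      have : t = 1 - r := by linarith
      subst this
      nlinarith
    exact hinj x hxG p hp (mul_left_cancel₀ hs h4)
  refine ⟨a, b, hab, ?_, hext a haG 1 one_ne_zero (fun x hx => by simpa using ha' x hx),
    hext b hbG (-1) (by norm_num) (fun x hx => by simpa using hb' x hx)⟩
  refine Set.Subset.antisymm (fun x hx => ?_)
    ((G.2.1.2.convex hP.convex).segment_subset haG hbG)
  obtain ⟨c, hc⟩ := hspan a haG x hx
  obtain ⟨d, hd'⟩ := hspan a haG b hbG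
  have hc0 : 0 ≤ c := by
    have := ha' x hx
    rw [hc, hf] at this
    by_contra h
    nlinarith [mul_pos (neg_pos.2 (not_le.1 h)) hvv]
  have hcd : c ≤ d := by
    have := hb' x hx
    rw [hc, hd', hf, hf] at this
    by_contra h
    nlinarith [mul_pos (sub_pos.2 (not_le.1 h)) hvv]
  have hd0 : 0 < d := by
    rcases (hc0.trans hcd).lt_or_eq with h | h
    · exact h
    · exact absurd (by rw [hd', ← h, zero_smul, add_zero]) hab.symm
  rw [segment_eq_image']
  refine ⟨c / d, ⟨by positivity, (div_le_one hd0).2 hcd⟩, ?_⟩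
  have : b - a = d • (v : EuclideanSpace ℝ (Fin 2)) := by
    conv_lhs => rw [hd']
    abel
  beta_reduce
  rw [this, smul_smul, div_mul_cancel₀ _ hd0.ne', hc]

theorem eq_or_eq_of_mem_segment_of_mem_extremePoints {a b e : EuclideanSpace ℝ (Fin 2)}
    (ha : a ∈ P) (hb : b ∈ P) (he : e ∈ P.extremePoints ℝ) (h : e ∈ segment ℝ a b) :
    e = a ∨ e = b := by
  rcases (mem_extremePoints_iff_forall_segment.1 he).2 a ha b hb h with h | h
  · exact Or.inl h.symm
  · exact Or.inr h.symm

/-- A facet of a polygon is determined by two of its vertices. -/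
theorem Facet.eq_segment_of_mem (hP : IsSimplePolytope P) (G : Facet P)
    {a b : EuclideanSpace ℝ (Fin 2)} (ha : a ∈ P.extremePoints ℝ) (hb : b ∈ P.extremePoints ℝ)
    (haG : a ∈ G.1) (hbG : b ∈ G.1) (hab : a ≠ b) : G.1 = segment ℝ a b := by
  obtain ⟨c, d, hcd, hG, hc, hd⟩ := G.exists_eq_segment hP
  rw [hG] at haG hbG ⊢
  rcases eq_or_eq_of_mem_segment_of_mem_extremePoints hc.1 hd.1 ha haG with rfl | rfl <;>
  rcases eq_or_eq_of_mem_segment_of_mem_extremePoints hc.1 hd.1 hb hbG with rfl | rfl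
  · exact absurd rfl hab
  · rfl
  · exact segment_symm ℝ _ _
  · exact absurd rfl hab

theorem Facet.eq_of_mem_mem (hP : IsSimplePolytope P) {G H : Facet P}
    {a b : EuclideanSpace ℝ (Fin 2)} (ha : a ∈ P.extremePoints ℝ) (hb : b ∈ P.extremePoints ℝ)
    (hab : a ≠ b) (haG : a ∈ G.1) (hbG : b ∈ G.1) (haH : a ∈ H.1) (hbH : b ∈ H.1) : G = H :=
  Subtype.ext (by rw [G.eq_segment_of_mem hP ha hb haG hbG hab,
    H.eq_segment_of_mem hP ha hb haH hbH hab])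

/-- A point common to two facets of a polygon is a vertex. -/
theorem Facet.eq_of_mem_of_notMem_extremePoints (hP : IsSimplePolytope P) {G H : Facet P}
    {p : EuclideanSpace ℝ (Fin 2)} (hp : p ∉ P.extremePoints ℝ) (hG : p ∈ G.1) (hH : p ∈ H.1) :
    G = H := by
  obtain ⟨a, b, hab, hGs, ha, hb⟩ := G.exists_eq_segment hP
  have hpo : p ∈ openSegment ℝ a b := by
    rw [hGs] at hG
    rw [← insert_endpoints_openSegment] at hG
    rcases hG with rfl | rfl | h
    · exact absurd ha hp
    · exact absurd hb hp
    · exact h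
  exact Facet.eq_of_mem_mem hP ha hb hab (hGs ▸ left_mem_segment ℝ a b)
    (hGs ▸ right_mem_segment ℝ a b) (H.isExtreme.2 ha.1 hb.1 hH hpo)
    (H.isExtreme.right_mem_of_mem_openSegment ha.1 hb.1 hH hpo)

/-- An edge is determined by its two end vertices, and there are finitely many vertices. -/
theorem finite_facet (hP : IsSimplePolytope P) : Finite (Facet P) := by
  choose a b hab hG ha hb using fun G : Facet P => G.exists_eq_segment hP
  have : Finite (P.extremePoints ℝ) := hP.finite_extremePoints
  refine Finite.of_injective (β := P.extremePoints ℝ × P.extremePoints ℝ)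
    (fun G => (⟨a G, ha G⟩, ⟨b G, hb G⟩)) fun G H h => ?_
  have h1 : a G = a H := congrArg (fun x => (x.1 : EuclideanSpace ℝ (Fin 2))) h
  have h2 : b G = b H := congrArg (fun x => (x.2 : EuclideanSpace ℝ (Fin 2))) h
  exact Subtype.ext (by rw [hG, hG, h1, h2])

/-- Through each vertex of a facet passes exactly one other facet. -/
theorem Facet.exists_neighbor (hP : IsSimplePolytope P) {G : Facet P}
    {v : EuclideanSpace ℝ (Fin 2)} (hv : v ∈ P.extremePoints ℝ) (hvG : v ∈ G.1) :
    ∃ H : Facet P, H ≠ G ∧ v ∈ H.1 ∧ ∀ K : Facet P, v ∈ K.1 → K = G ∨ K = H := by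
  obtain ⟨x, y, hxy, hu⟩ := Nat.card_eq_two_iff.1 (hP.simple v hv)
  have hall : ∀ K : Facet P, v ∈ K.1 → K = x.1 ∨ K = y.1 := by
    intro K hK
    have : (⟨K, hK⟩ : {G : Facet P // v ∈ G.1}) ∈ ({x, y} : Set _) := hu ▸ Set.mem_univ _
    rcases this with h | h
    · exact Or.inl (congrArg Subtype.val h)
    · exact Or.inr (congrArg Subtype.val h)
  have hne : x.1 ≠ y.1 := fun h => hxy (Subtype.ext h)
  rcases hall G hvG with rfl | rfl
  · exact ⟨y.1, hne.symm, y.2, hall⟩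
  · exact ⟨x.1, hne, x.2, fun K hK => (hall K hK).symm⟩

theorem exists_facet_of_mem_extremePoints (hP : IsSimplePolytope P)
    {v : EuclideanSpace ℝ (Fin 2)} (hv : v ∈ P.extremePoints ℝ) : ∃ G : Facet P, v ∈ G.1 := by
  obtain ⟨x, y, hxy, hu⟩ := Nat.card_eq_two_iff.1 (hP.simple v hv)
  exact ⟨x.1, x.2⟩

/-- In the coordinates `e = v + s (w - v) + t (x - v)` the supporting inequalities of the three
edges read `s ≥ 0`, `t ≥ 0` and `s + t ≤ 1`. So the three edge lines already confine `P` to the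
triangle `v w x`. -/
theorem mem_triangle_of_facets (hP : IsSimplePolytope P) {F₁ F₂ F₃ : Facet P}
    {v w x e : EuclideanSpace ℝ (Fin 2)} (hv : v ∈ P) (hw : w ∈ P) (hx : x ∈ P)
    (hv1 : v ∈ F₁.1) (hx1 : x ∈ F₁.1) (hw1 : w ∉ F₁.1) (hv2 : v ∈ F₂.1) (hw2 : w ∈ F₂.1)
    (hx2 : x ∉ F₂.1) (hw3 : w ∈ F₃.1) (hx3 : x ∈ F₃.1) (hv3 : v ∉ F₃.1)
    (he : e ∈ P.extremePoints ℝ) : e = v ∨ e = w ∨ e = x := by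
  obtain ⟨l₁, m₁, hle₁, hiff₁, -⟩ := F₁.exists_functional hP
  obtain ⟨l₂, m₂, hle₂, hiff₂, -⟩ := F₂.exists_functional hP
  obtain ⟨l₃, m₃, hle₃, hiff₃, -⟩ := F₃.exists_functional hP
  rw [hiff₁ v hv] at hv1
  rw [hiff₁ x hx] at hx1
  rw [hiff₁ w hw] at hw1
  rw [hiff₂ v hv] at hv2
  rw [hiff₂ w hw] at hw2
  rw [hiff₂ x hx] at hx2
  rw [hiff₃ w hw] at hw3
  rw [hiff₃ x hx] at hx3
  rw [hiff₃ v hv] at hv3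
  have hw1' : l₁ w < m₁ := lt_of_le_of_ne (hle₁ w hw) hw1
  have hx2' : l₂ x < m₂ := lt_of_le_of_ne (hle₂ x hx) hx2
  have hv3' : l₃ v < m₃ := lt_of_le_of_ne (hle₃ v hv) hv3
  have hli : LinearIndependent ℝ ![w - v, x - v] := by
    rw [LinearIndependent.pair_iff]
    intro s t hst
    have h1 := congrArg l₁ hst
    have h2 := congrArg l₂ hst
    simp only [map_add, map_smul, map_sub, map_zero, smul_eq_mul, hv1, hx1, hv2, hw2, sub_self,
      mul_zero, add_zero, zero_add] at h1 h2
    exact ⟨(mul_eq_zero.1 h1).resolve_right (by linarith),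
      (mul_eq_zero.1 h2).resolve_right (by linarith)⟩
  have hsp := hli.span_eq_top_of_card_eq_finrank' (by simp)
  have hmem : e - v ∈ Submodule.span ℝ (Set.range ![w - v, x - v]) := hsp ▸ Submodule.mem_top
  rw [Matrix.range_cons, Matrix.range_cons, Matrix.range_empty, Set.union_empty,
    Set.singleton_union, Submodule.mem_span_pair] at hmem
  obtain ⟨s, t, hst⟩ := hmem
  have hee : e = v + (s • (w - v) + t • (x - v)) := by rw [hst]; abel
  have hs : 0 ≤ s := by
    have := hle₁ e he.1
    rw [hee] at this
    simp only [map_add, map_smul, map_sub, smul_eq_mul, hv1, hx1, sub_self, mul_zero] at this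
    by_contra h
    nlinarith [mul_pos (neg_pos.2 (not_le.1 h)) (sub_pos.2 hw1')]
  have ht : 0 ≤ t := by
    have := hle₂ e he.1
    rw [hee] at this
    simp only [map_add, map_smul, map_sub, smul_eq_mul, hv2, hw2, sub_self, mul_zero] at this
    by_contra h
    nlinarith [mul_pos (neg_pos.2 (not_le.1 h)) (sub_pos.2 hx2')]
  have hst1 : s + t ≤ 1 := by
    have := hle₃ e he.1
    rw [hee] at this
    simp only [map_add, map_smul, map_sub, smul_eq_mul, hw3, hx3] at this
    by_contra h
    nlinarith [mul_pos (sub_pos.2 (not_le.1 h)) (sub_pos.2 hv3')]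
  have hsub : convexHull ℝ {v, w, x} ⊆ P := by
    refine convexHull_min ?_ hP.convex
    rintro y (rfl | rfl | rfl) <;> assumption
  have hmem : e ∈ convexHull ℝ ({v, w, x} : Set (EuclideanSpace ℝ (Fin 2))) := by
    have hc := convex_convexHull ℝ ({v, w, x} : Set (EuclideanSpace ℝ (Fin 2)))
    have h := hc.sum_mem (t := Finset.univ) (w := ![1 - s - t, s, t]) (z := ![v, w, x])
      (by intro i _; fin_cases i <;> simp <;> linarith)
      (by simp [Fin.sum_univ_three]; ring)
      (by intro i _; apply subset_convexHull; fin_cases i <;> simp)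
    have e' : ∑ i, (![1 - s - t, s, t] i) • (![v, w, x] i) = e := by
      rw [hee]
      simp only [Fin.sum_univ_three, Matrix.cons_val_zero, Matrix.cons_val_one, Matrix.cons_val]
      module
    rwa [e'] at h
  have := extremePoints_convexHull_subset
    (inter_extremePoints_subset_extremePoints_of_subset hsub ⟨hmem, he⟩)
  simpa using this

/-- A polygon that is not a triangle has three consecutive edges the outer two of which are
disjoint. -/
theorem card_facet_eq_three_or (hP : IsSimplePolytope P) :
    Nat.card (Facet P) = 3 ∨ ∃ (F₁ F₂ F₃ : Facet P) (v w : EuclideanSpace ℝ (Fin 2)),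
      v ∈ P.extremePoints ℝ ∧ w ∈ P.extremePoints ℝ ∧ v ∈ F₁.1 ∧ v ∈ F₂.1 ∧ w ∈ F₂.1 ∧ w ∈ F₃.1 ∧
      F₁ ≠ F₂ ∧ F₂ ≠ F₃ ∧ Disjoint F₁.1 F₃.1 := by
  have hne : P.Nonempty := hP.interior_nonempty.mono interior_subset
  obtain ⟨v0, hv0⟩ := hP.isCompact.extremePoints_nonempty hne
  obtain ⟨F₂, -⟩ := exists_facet_of_mem_extremePoints hP hv0
  obtain ⟨v, w, hvw, hF₂, hv, hw⟩ := F₂.exists_eq_segment hP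
  have hv2 : v ∈ F₂.1 := hF₂ ▸ left_mem_segment ℝ v w
  have hw2 : w ∈ F₂.1 := hF₂ ▸ right_mem_segment ℝ v w
  obtain ⟨F₁, h12, hv1, hvK⟩ := Facet.exists_neighbor hP hv hv2
  obtain ⟨F₃, h32, hw3, hwK⟩ := Facet.exists_neighbor hP hw hw2
  have hw1 : w ∉ F₁.1 := fun h => h12 (Facet.eq_of_mem_mem hP hv hw hvw hv1 h hv2 hw2)
  have hv3 : v ∉ F₃.1 := fun h => h32 (Facet.eq_of_mem_mem hP hv hw hvw h hw3 hv2 hw2)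
  -- If the two neighbours of `F₂` meet, they meet in a vertex `x`. Then `v, w, x` are all the
  -- vertices and the edges through them are exhausted by `F₁, F₂, F₃`.
  by_cases hd : Disjoint F₁.1 F₃.1
  · exact Or.inr ⟨F₁, F₂, F₃, v, w, hv, hw, hv1, hv2, hw2, hw3, h12, h32.symm, hd⟩
  left
  obtain ⟨x, hx1, hx3⟩ := Set.not_disjoint_iff.1 hd
  have h13 : F₁ ≠ F₃ := fun h => hv3 (h ▸ hv1)
  have hx : x ∈ P.extremePoints ℝ := by
    by_contra h
    exact h13 (Facet.eq_of_mem_of_notMem_extremePoints hP h hx1 hx3)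
  have hxv : x ≠ v := by rintro rfl; exact hv3 hx3
  have hxw : x ≠ w := by rintro rfl; exact hw1 hx1
  have hx2 : x ∉ F₂.1 := fun h => h12 (Facet.eq_of_mem_mem hP hv hx hxv.symm hv1 hx1 hv2 h)
  obtain ⟨F₄, h41, hx4, hxK⟩ := Facet.exists_neighbor hP hx hx1
  have hall : ∀ K : Facet P, K = F₁ ∨ K = F₂ ∨ K = F₃ := by
    intro K
    obtain ⟨e, b, -, hK, he, -⟩ := K.exists_eq_segment hP
    have heK : e ∈ K.1 := hK ▸ left_mem_segment ℝ e b
    rcases mem_triangle_of_facets hP hv.1 hw.1 hx.1 hv1 hx1 hw1 hv2 hw2 hx2 hw3 hx3 hv3 he with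
      rfl | rfl | rfl
    · rcases hvK K heK with h | h <;> simp [h]
    · rcases hwK K heK with h | h <;> simp [h]
    · have h34 : F₃ = F₄ := (hxK F₃ hx3).resolve_left h13.symm
      rcases hxK K heK with h | h
      · simp [h]
      · simp [h, h34]
  rw [← Set.ncard_univ, Set.ncard_eq_three]
  refine ⟨F₁, F₂, F₃, h12, h13, h32.symm, ?_⟩
  ext K
  simpa using hall K

/-- Any two edges of a triangle share a vertex. -/
theorem exists_common_vertex (hP : IsSimplePolytope P) (hcard : Nat.card (Facet P) = 3)
    {G H : Facet P} (hGH : G ≠ H) : ∃ v ∈ P.extremePoints ℝ, v ∈ G.1 ∧ v ∈ H.1 := by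
  obtain ⟨v, w, hvw, hG, hv, hw⟩ := G.exists_eq_segment hP
  have hvG : v ∈ G.1 := hG ▸ left_mem_segment ℝ v w
  have hwG : w ∈ G.1 := hG ▸ right_mem_segment ℝ v w
  obtain ⟨A, hAG, hvA, -⟩ := Facet.exists_neighbor hP hv hvG
  obtain ⟨B, hBG, hwB, -⟩ := Facet.exists_neighbor hP hw hwG
  have hAB : A ≠ B := by
    rintro rfl
    exact hAG (Facet.eq_of_mem_mem hP hv hw hvw hvA hwB hvG hwG)
  -- If `H` missed both ends of `G`, then `G`, its neighbours `A`, `B` and `H` would be four facets.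
  by_contra hne
  push Not at hne
  have hHA : H ≠ A := by rintro rfl; exact hne v hv hvG hvA
  have hHB : H ≠ B := by rintro rfl; exact hne w hw hwG hwB
  have := finite_facet hP
  have hle : ({G, A, B, H} : Set (Facet P)).ncard ≤ 3 := by
    rw [← hcard, ← Set.ncard_univ]
    exact Set.ncard_le_ncard (Set.subset_univ _)
  rw [Set.ncard_insert_of_notMem, Set.ncard_insert_of_notMem, Set.ncard_pair hHB.symm] at hle
  · omega
  · rintro (h | h)
    · exact hAB h
    · exact hHA h.symm
  · rintro (h | h | h)
    · exact hAG h.symm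
    · exact hBG h.symm
    · exact hGH h

end PlanarPolygons

/-! ### Topology of `ℂPⁿ` through its tautological family of projections. -/

section ComplexProjectivePlane

/-- The quotient map `ℂⁿ⁺¹ ∖ {0} → ℂPⁿ`. -/
noncomputable def ComplexProjectiveSpace.mk {n : ℕ} (v : {v : Fin (n + 1) → ℂ // v ≠ 0}) :
    ComplexProjectiveSpace n := Projectivization.mk' ℂ v

theorem ComplexProjectiveSpace.continuous_mk {n : ℕ} :
    Continuous (ComplexProjectiveSpace.mk (n := n)) := continuous_coinduced_rng

theorem ComplexProjectiveSpace.mk_surjective {n : ℕ} :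
    Function.Surjective (ComplexProjectiveSpace.mk (n := n)) := fun x => by
  induction x using Projectivization.ind with
  | h v hv => exact ⟨⟨v, hv⟩, rfl⟩

theorem ComplexProjectiveSpace.mk_eq_mk_iff {n : ℕ} {v w : {v : Fin (n + 1) → ℂ // v ≠ 0}} :
    ComplexProjectiveSpace.mk v = ComplexProjectiveSpace.mk w ↔ ∃ a : ℂ, a • w.1 = v.1 :=
  Projectivization.mk_eq_mk_iff' ℂ v.1 w.1 v.2 w.2

/-- The line in `ℂⁿ⁺¹` belonging to a point of `ℂPⁿ`, as an orthogonal projection. -/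
noncomputable def ComplexProjectiveSpace.proj {n : ℕ} (x : ComplexProjectiveSpace n) :
    EuclideanSpace ℂ (Fin (n + 1)) →L[ℂ] EuclideanSpace ℂ (Fin (n + 1)) :=
  Projectivization.lift (K := ℂ) (V := Fin (n + 1) → ℂ)
    (fun v => lineProj (WithLp.toLp 2 v.1 : EuclideanSpace ℂ (Fin (n + 1)))) (by
      rintro ⟨v, hv⟩ ⟨w, hw⟩ t h
      have h' : v = t • w := h
      have ht : t ≠ 0 := by rintro rfl; exact hv (by rw [h', zero_smul])
      change lineProj (WithLp.toLp 2 v) = lineProj (WithLp.toLp 2 w)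
      rw [h', WithLp.toLp_smul, lineProj_smul ht]) x

theorem ComplexProjectiveSpace.proj_mk {n : ℕ} (v : {v : Fin (n + 1) → ℂ // v ≠ 0}) :
    (ComplexProjectiveSpace.mk v).proj =
      lineProj (WithLp.toLp 2 v.1 : EuclideanSpace ℂ (Fin (n + 1))) := rfl

theorem ComplexProjectiveSpace.isLineProj_proj {n : ℕ} (x : ComplexProjectiveSpace n) :
    IsLineProj x.proj := by
  obtain ⟨v, rfl⟩ := ComplexProjectiveSpace.mk_surjective x
  exact ⟨_, by simpa using v.2, ComplexProjectiveSpace.proj_mk v⟩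

theorem ComplexProjectiveSpace.continuous_proj {n : ℕ} :
    Continuous (ComplexProjectiveSpace.proj (n := n)) := by
  refine continuous_coinduced_dom.2 ?_
  refine continuousOn_lineProj.comp_continuous
    (f := fun v : {v : Fin (n + 1) → ℂ // v ≠ 0} =>
      (WithLp.toLp 2 v.1 : EuclideanSpace ℂ (Fin (n + 1)))) ?_ ?_
  · exact (PiLp.continuous_toLp 2 _).comp continuous_subtype_val
  · intro v
    simpa using v.2

theorem ComplexProjectiveSpace.proj_injective {n : ℕ} :
    Function.Injective (ComplexProjectiveSpace.proj (n := n)) := by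
  intro x y h
  obtain ⟨v, rfl⟩ := ComplexProjectiveSpace.mk_surjective x
  obtain ⟨w, rfl⟩ := ComplexProjectiveSpace.mk_surjective y
  rw [ComplexProjectiveSpace.proj_mk, ComplexProjectiveSpace.proj_mk] at h
  have h0 : (WithLp.toLp 2 v.1 : EuclideanSpace ℂ (Fin (n + 1))) ≠ 0 := by simpa using v.2
  have h1 := lineProj_self h0
  rw [h] at h1
  obtain ⟨c, hc⟩ := eq_smul_of_lineProj_eq h1
  rw [ComplexProjectiveSpace.mk_eq_mk_iff]
  refine ⟨c, ?_⟩
  have := congrArg WithLp.ofLp hc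
  exact this.symm

instance {n : ℕ} : T2Space (ComplexProjectiveSpace n) :=
  T2Space.of_injective_continuous ComplexProjectiveSpace.proj_injective
    ComplexProjectiveSpace.continuous_proj

end ComplexProjectivePlane

/-! ### Orbits and stabilisers read off in an equivariant chart. -/

section Charts

variable {n : ℕ} {M : Type*} [TopologicalSpace M] [MulAction (Torus n) M]

/-- `ψ` is a chart that is equivariant up to the automorphism `δ` of the torus. -/
def IsTorusChart (ψ : OpenPartialHomeomorph M (Fin n → ℂ)) (δ : Torus n ≃ₜ* Torus n) : Prop :=
  ∀ (t : Torus n), ∀ x ∈ ψ.source,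
    t • x ∈ ψ.source ∧ ψ (t • x) = fun i => (δ t i : ℂ) * ψ x i

variable {ψ : OpenPartialHomeomorph M (Fin n → ℂ)} {δ : Torus n ≃ₜ* Torus n}

theorem IsTorusChart.smul_eq_smul_iff (h : IsTorusChart ψ δ) {x : M} (hx : x ∈ ψ.source)
    (t u : Torus n) : t • x = u • x ↔ ∀ i, ψ x i ≠ 0 → δ t i = δ u i := by
  rw [← ψ.injOn.eq_iff (h t x hx).1 (h u x hx).1, (h t x hx).2, (h u x hx).2, funext_iff]
  refine forall_congr' fun i => ?_
  rw [mul_eq_mul_right_iff, Circle.coe_inj]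
  tauto

theorem IsTorusChart.smul_eq_iff (h : IsTorusChart ψ δ) {x : M} (hx : x ∈ ψ.source)
    (t : Torus n) : t • x = x ↔ ∀ i, ψ x i ≠ 0 → δ t i = 1 := by
  have := h.smul_eq_smul_iff hx t 1
  rwa [one_smul, map_one] at this

theorem IsTorusChart.smul_mem_target (h : IsTorusChart ψ δ) {w : Fin n → ℂ} (hw : w ∈ ψ.target)
    (t : Torus n) : (fun i => (t i : ℂ) * w i) ∈ ψ.target ∧
      ψ.symm (fun i => (t i : ℂ) * w i) = δ.symm t • ψ.symm w := by
  have hs := ψ.map_target hw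
  obtain ⟨h1, h2⟩ := h (δ.symm t) _ hs
  rw [ContinuousMulEquiv.apply_symm_apply, ψ.right_inv hw] at h2
  rw [← h2]
  exact ⟨ψ.map_source h1, ψ.left_inv h1⟩

/-- The orbit of a point with exactly `l` nonzero coordinates in a chart is an `l`-torus. -/
theorem IsTorusChart.hasOrbitDim [T2Space M] [ContinuousSMul (Torus n) M] (h : IsTorusChart ψ δ)
    {x : M} (hx : x ∈ ψ.source) {l : ℕ} (e : {i // ψ x i ≠ 0} ≃ Fin l) : HasOrbitDim n x l := by
  classical
  -- Only the nonvanishing coordinates of `x` see the torus; the others receive the value `1`.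
  let ext : Torus l → Torus n := fun s i => if h : ψ x i ≠ 0 then s (e ⟨i, h⟩) else 1
  have hext : Continuous ext := by
    refine continuous_pi fun i => ?_
    by_cases hi : ψ x i ≠ 0
    · simp only [ext, dif_pos hi]; fun_prop
    · simp only [ext, dif_neg hi]; fun_prop
  let f : Torus l → MulAction.orbit (Torus n) x := fun s =>
    ⟨δ.symm (ext s) • x, MulAction.mem_orbit x _⟩
  have hf : Continuous f := by
    refine Continuous.subtype_mk ?_ _
    exact (δ.symm.continuous.comp hext).smul continuous_const
  have hb : Function.Bijective f := by
    constructor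
    · intro s s' hss
      have h1 := congrArg Subtype.val hss
      simp only [f] at h1
      rw [h.smul_eq_smul_iff hx] at h1
      funext j
      have h2 := h1 (e.symm j).1 (e.symm j).2
      rw [ContinuousMulEquiv.apply_symm_apply, ContinuousMulEquiv.apply_symm_apply] at h2
      simp only [ext, dif_pos (e.symm j).2] at h2
      simpa using h2
    · rintro ⟨_, t, rfl⟩
      refine ⟨fun j => δ t (e.symm j).1, Subtype.ext ?_⟩
      change δ.symm _ • x = t • x
      rw [h.smul_eq_smul_iff hx]
      intro i hi
      rw [ContinuousMulEquiv.apply_symm_apply]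
      simp [ext, hi]
  exact ⟨(Continuous.homeoOfEquivCompactToT2 (f := Equiv.ofBijective f hb) hf).symm⟩

theorem Complex.exists_circle_mul_eq_norm (z : ℂ) : ∃ c : Circle, (c : ℂ) * z = (‖z‖ : ℂ) := by
  refine ⟨Circle.exp (-z.arg), ?_⟩
  conv_lhs => rw [← Complex.norm_mul_exp_arg_mul_I z]
  rw [Circle.coe_exp, mul_left_comm, ← Complex.exp_add]
  push_cast
  simp

/-- Moduli of the coordinates in a chart give a point in the same orbit. -/
theorem IsTorusChart.norm_mem (h : IsTorusChart ψ δ) {x : M} (hx : x ∈ ψ.source) :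
    (fun i => (‖ψ x i‖ : ℂ)) ∈ ψ.target ∧
      ψ.symm (fun i => (‖ψ x i‖ : ℂ)) ∈ MulAction.orbit (Torus n) x := by
  choose c hc using fun i => Complex.exists_circle_mul_eq_norm (ψ x i)
  have := h.smul_mem_target (ψ.map_source hx) c
  simp only [hc] at this
  refine ⟨this.1, ?_⟩
  rw [this.2, ψ.left_inv hx]
  exact MulAction.mem_orbit _ _

end Charts

/-! ### The orbit map is open and has local sections. -/

section OrbitProjection

variable {n : ℕ} {M : Type*} [TopologicalSpace M] [MulAction (Torus n) M]
  {P : Set (EuclideanSpace ℝ (Fin n))} {q : M → P}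

theorem IsQuasitoric.smul_eq (hq : IsQuasitoric P q) (t : Torus n) (x : M) : q (t • x) = q x :=
  (hq.eq_iff _ _).2 (MulAction.mem_orbit x t)

theorem IsQuasitoric.exists_chart (hq : IsQuasitoric P q) (y : M) :
    ∃ (ψ : OpenPartialHomeomorph M (Fin n → ℂ)) (δ : Torus n ≃ₜ* Torus n),
      y ∈ ψ.source ∧ IsTorusChart ψ δ := hq.locallyStandard y

theorem IsQuasitoric.isOpenMap [ContinuousSMul (Torus n) M] (hq : IsQuasitoric P q) :
    IsOpenMap q := by
  intro U hU
  rw [← hq.isQuotientMap.isOpen_preimage]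
  have : q ⁻¹' (q '' U) = ⋃ t : Torus n, (fun x : M => t • x) ⁻¹' U := by
    ext x
    simp only [Set.mem_preimage, Set.mem_image, Set.mem_iUnion]
    constructor
    · rintro ⟨y, hy, hyx⟩
      obtain ⟨t, rfl⟩ := (hq.eq_iff _ _).1 hyx
      exact ⟨t, hy⟩
    · rintro ⟨t, ht⟩
      exact ⟨t • x, ht, hq.smul_eq t x⟩
  rw [this]
  exact isOpen_iUnion fun t => hU.preimage (continuous_const_smul t)

/-- Since `q` is open and continuous, limits within `P` can be computed upstairs; this is how
continuity of sections is tested. -/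
theorem IsQuasitoric.nhdsWithin_eq [ContinuousSMul (Torus n) M] (hq : IsQuasitoric P q) (x : M) :
    nhdsWithin (q x : EuclideanSpace ℝ (Fin n)) P =
      Filter.map (fun y => (q y : EuclideanSpace ℝ (Fin n))) (nhds x) := by
  rw [nhdsWithin_eq_map_subtype_coe (q x).2, Subtype.coe_eta,
    ← hq.isOpenMap.map_nhds_eq hq.isQuotientMap.continuous.continuousAt, Filter.map_map]
  rfl

/-- `σ` is a continuous section of the orbit map over `K`. -/
def IsSectionOn (q : M → P) (σ : EuclideanSpace ℝ (Fin n) → M)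
    (K : Set (EuclideanSpace ℝ (Fin n))) : Prop :=
  ContinuousOn σ K ∧ ∀ x ∈ K, (q (σ x) : EuclideanSpace ℝ (Fin n)) = x

/-- Sections of the orbit map exist locally. -/
theorem IsQuasitoric.exists_local_section [ContinuousSMul (Torus n) M] (hq : IsQuasitoric P q)
    {p : EuclideanSpace ℝ (Fin n)} (hp : p ∈ P) :
    ∃ U ∈ nhds p, ∃ σ, IsSectionOn q σ (U ∩ P) := by
  obtain ⟨g, hg⟩ := hq.isQuotientMap.surjective.hasRightInverse
  obtain ⟨ψ, δ, hy, hψ⟩ := hq.exists_chart (g ⟨p, hp⟩)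
  -- Replacing coordinates by their moduli is continuous and constant on orbits, and picks a point
  -- of the same orbit. So it factors through `q` as a section.
  let r : M → M := fun x => ψ.symm (fun i => (‖ψ x i‖ : ℂ))
  have hrc : ContinuousOn r ψ.source := by
    refine ψ.continuousOn_symm.comp ?_ fun x hx => (hψ.norm_mem hx).1
    exact continuousOn_pi.2 fun i => Complex.continuous_ofReal.comp_continuousOn
      (((continuous_apply i).comp_continuousOn ψ.continuousOn).norm)
  have hri : ∀ x ∈ ψ.source, ∀ t : Torus n, r (t • x) = r x := fun x hx t => by
    simp only [r, (hψ t x hx).2, norm_mul, Circle.norm_coe, one_mul]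
  classical
  let σ : EuclideanSpace ℝ (Fin n) → M := fun e => if h : e ∈ P then r (g ⟨e, h⟩) else g ⟨p, hp⟩
  have hσ : ∀ x ∈ ψ.source, σ (q x) = r x := fun x hx => by
    simp only [σ, dif_pos (q x).2, Subtype.coe_eta]
    obtain ⟨t, ht⟩ := (hq.eq_iff _ _).1 (hg (q x))
    have ht' : g (q x) = t • x := ht.symm
    rw [ht', hri x hx]
  have hmem : (fun y => (q y : EuclideanSpace ℝ (Fin n))) '' ψ.source ∈ nhdsWithin p P := by
    have := hq.nhdsWithin_eq (g ⟨p, hp⟩)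
    rw [hg] at this
    rw [this]
    exact Filter.image_mem_map (ψ.open_source.mem_nhds hy)
  obtain ⟨U, hU, hUs⟩ := mem_nhdsWithin_iff_exists_mem_nhds_inter.1 hmem
  refine ⟨U, hU, σ, fun e he => ?_, fun e he => ?_⟩
  · obtain ⟨x, hx, rfl⟩ := hUs he
    refine ContinuousWithinAt.mono ?_ Set.inter_subset_right
    rw [ContinuousWithinAt, hq.nhdsWithin_eq, Filter.tendsto_map'_iff]
    have hev : r =ᶠ[nhds x] σ ∘ fun y => (q y : EuclideanSpace ℝ (Fin n)) := by
      filter_upwards [ψ.open_source.mem_nhds hx] with z hz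
      exact (hσ z hz).symm
    refine Filter.Tendsto.congr' hev ?_
    rw [hσ x hx]
    exact hrc.continuousAt (ψ.open_source.mem_nhds hx)
  · obtain ⟨x, hx, rfl⟩ := hUs he
    beta_reduce
    rw [hσ x hx]
    obtain ⟨t, ht⟩ := (hψ.norm_mem hx).2
    have : r x = t • x := ht.symm
    rw [this, hq.smul_eq]

end OrbitProjection

/-! ### Faces of the polygon versus vanishing coordinates in charts. -/

section Strata

variable {M : Type*} [TopologicalSpace M] [T2Space M] [MulAction (Torus 2) M]
  [ContinuousSMul (Torus 2) M] {P : Set (EuclideanSpace ℝ (Fin 2))} {q : M → P}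
  {ψ : OpenPartialHomeomorph M (Fin 2 → ℂ)} {δ : Torus 2 ≃ₜ* Torus 2}

/-- The number of nonzero coordinates is the dimension of the orbit, and `orbit_dim` turns it into
the dimension of the face containing `q x` in its relative interior. -/
theorem IsQuasitoric.chart_cases (hq : IsQuasitoric P q) (hψ : IsTorusChart ψ δ) {x : M}
    (hx : x ∈ ψ.source) :
    ((∀ i, ψ x i ≠ 0) ∧ (q x : EuclideanSpace ℝ (Fin 2)) ∈ interior P) ∨
    ((∃ i j, i ≠ j ∧ ψ x i = 0 ∧ ψ x j ≠ 0) ∧ (q x : EuclideanSpace ℝ (Fin 2)) ∉ P.extremePoints ℝ ∧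
      ∃ G : Facet P, (q x : EuclideanSpace ℝ (Fin 2)) ∈ G.1) ∨
    ((∀ i, ψ x i = 0) ∧ (q x : EuclideanSpace ℝ (Fin 2)) ∈ P.extremePoints ℝ) := by
  classical
  have hdim : ∀ l, Fintype.card {i // ψ x i ≠ 0} = l → ∃ G, IsFace P G ∧ faceDim G = l ∧
      (q x : EuclideanSpace ℝ (Fin 2)) ∈ intrinsicInterior ℝ G := fun l hl =>
    hq.orbit_dim x l (hψ.hasOrbitDim hx (Fintype.equivFinOfCardEq hl))
  have hone : ∀ i j : Fin 2, i ≠ j → ψ x i = 0 → ψ x j ≠ 0 →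
      (q x : EuclideanSpace ℝ (Fin 2)) ∉ P.extremePoints ℝ ∧
      ∃ G : Facet P, (q x : EuclideanSpace ℝ (Fin 2)) ∈ G.1 := by
    intro i j hij hi hj
    have hc : Fintype.card {k // ψ x k ≠ 0} = 1 := by
      rw [Fintype.card_eq_one_iff]
      refine ⟨⟨j, hj⟩, fun k => Subtype.ext ?_⟩
      have hk : k.1 ≠ i := fun h => k.2 (h ▸ hi)
      have := k.1.2; have := i.2; have := j.2
      apply Fin.ext
      have h1 : (k.1 : ℕ) ≠ i := fun h => hk (Fin.ext h)
      have h2 : (i : ℕ) ≠ j := fun h => hij (Fin.ext h)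
      change (k.1 : ℕ) = j
      omega
    obtain ⟨G, hG, hd, hp⟩ := hdim 1 hc
    let G' : Facet P := ⟨G, hG, by rw [hd]⟩
    obtain ⟨a, b, hab, hGs, ha, hb⟩ := G'.exists_eq_segment hq.simplePolytope
    have haG : a ∈ G := by change a ∈ G'.1; rw [hGs]; exact left_mem_segment ℝ a b
    have hbG : b ∈ G := by change b ∈ G'.1; rw [hGs]; exact right_mem_segment ℝ a b
    refine ⟨?_, G', intrinsicInterior_subset hp⟩
    by_cases h : a = (q x : EuclideanSpace ℝ (Fin 2))
    · exact notMem_extremePoints_of_mem_intrinsicInterior hG.2.subset hp hbG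
        (fun h' => hab (h.trans h'.symm))
    · exact notMem_extremePoints_of_mem_intrinsicInterior hG.2.subset hp haG h
  by_cases h0 : ψ x 0 = 0 <;> by_cases h1 : ψ x 1 = 0
  · right; right
    have hall : ∀ i, ψ x i = 0 := by intro i; fin_cases i <;> assumption
    refine ⟨hall, ?_⟩
    obtain ⟨G, hG, hd, hp⟩ := hdim 0 (by
      rw [Fintype.card_eq_zero_iff]; exact ⟨fun k => k.2 (hall k)⟩)
    exact mem_extremePoints_of_faceDim_eq_zero hG hd (intrinsicInterior_subset hp)
  · exact Or.inr (Or.inl ⟨⟨0, 1, by simp, h0, h1⟩, hone 0 1 (by simp) h0 h1⟩)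
  · exact Or.inr (Or.inl ⟨⟨1, 0, by simp, h1, h0⟩, hone 1 0 (by simp) h1 h0⟩)
  · left
    have hall : ∀ i, ψ x i ≠ 0 := by intro i; fin_cases i <;> assumption
    refine ⟨hall, ?_⟩
    obtain ⟨G, hG, hd, hp⟩ := hdim 2 (by
      rw [Fintype.card_subtype, Finset.filter_true_of_mem (fun i _ => hall i)]; rfl)
    exact mem_interior_of_faceDim_eq hG.2.subset hd hp

theorem notMem_interior_of_mem_extremePoints (hP : IsSimplePolytope P)
    {v : EuclideanSpace ℝ (Fin 2)} (hv : v ∈ P.extremePoints ℝ) : v ∉ interior P := by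
  obtain ⟨G, hG⟩ := exists_facet_of_mem_extremePoints hP hv
  exact G.notMem_interior hP hG

theorem IsQuasitoric.chart_of_mem_interior (hq : IsQuasitoric P q) (hψ : IsTorusChart ψ δ) {x : M}
    (hx : x ∈ ψ.source) (h : (q x : EuclideanSpace ℝ (Fin 2)) ∈ interior P) :
    ∀ i, ψ x i ≠ 0 := by
  rcases hq.chart_cases hψ hx with h' | ⟨-, -, G, hG⟩ | h'
  · exact h'.1
  · exact absurd h (G.notMem_interior hq.simplePolytope hG)
  · exact absurd h (notMem_interior_of_mem_extremePoints hq.simplePolytope h'.2)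

theorem IsQuasitoric.chart_of_mem_extremePoints (hq : IsQuasitoric P q) (hψ : IsTorusChart ψ δ)
    {x : M} (hx : x ∈ ψ.source) (h : (q x : EuclideanSpace ℝ (Fin 2)) ∈ P.extremePoints ℝ) :
    ∀ i, ψ x i = 0 := by
  rcases hq.chart_cases hψ hx with h' | ⟨-, h', -⟩ | h'
  · exact absurd h'.2 (notMem_interior_of_mem_extremePoints hq.simplePolytope h)
  · exact absurd h h'
  · exact h'.1

theorem IsQuasitoric.chart_of_mem_facet (hq : IsQuasitoric P q) (hψ : IsTorusChart ψ δ)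
    {x : M} (hx : x ∈ ψ.source) (h : (q x : EuclideanSpace ℝ (Fin 2)) ∉ P.extremePoints ℝ)
    {G : Facet P} (hG : (q x : EuclideanSpace ℝ (Fin 2)) ∈ G.1) :
    ∃ i j, i ≠ j ∧ ψ x i = 0 ∧ ψ x j ≠ 0 := by
  rcases hq.chart_cases hψ hx with h' | h' | h'
  · exact absurd h'.2 (G.notMem_interior hq.simplePolytope hG)
  · exact h'.1
  · exact absurd h'.2 h

/-- Every point of the polygon lies in its interior or on a facet. -/
theorem IsQuasitoric.mem_interior_or_facet (hq : IsQuasitoric P q) {p : EuclideanSpace ℝ (Fin 2)}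
    (hp : p ∈ P) : p ∈ interior P ∨ ∃ G : Facet P, p ∈ G.1 := by
  obtain ⟨x, hx⟩ := hq.isQuotientMap.surjective ⟨p, hp⟩
  obtain ⟨ψ, δ, hy, hψ⟩ := hq.exists_chart x
  have h := hq.chart_cases hψ hy
  rw [hx] at h
  rcases h with h' | ⟨-, -, h'⟩ | h'
  · exact Or.inl h'.2
  · exact Or.inr h'
  · exact Or.inr (exists_facet_of_mem_extremePoints hq.simplePolytope h'.2)

theorem IsQuasitoric.eq_one_of_mem_interior (hq : IsQuasitoric P q) {x : M}
    (h : (q x : EuclideanSpace ℝ (Fin 2)) ∈ interior P) {t : Torus 2} (ht : t • x = x) : t = 1 := by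
  obtain ⟨ψ, δ, hx, hψ⟩ := hq.exists_chart x
  have h0 := hq.chart_of_mem_interior hψ hx h
  have h1 : δ t = 1 := funext fun i => (hψ.smul_eq_iff hx t).1 ht i (h0 i)
  exact (map_eq_one_iff δ δ.injective).1 h1

theorem IsQuasitoric.smul_eq_of_mem_extremePoints (hq : IsQuasitoric P q) {x : M}
    (h : (q x : EuclideanSpace ℝ (Fin 2)) ∈ P.extremePoints ℝ) (t : Torus 2) : t • x = x := by
  obtain ⟨ψ, δ, hx, hψ⟩ := hq.exists_chart x
  have h0 := hq.chart_of_mem_extremePoints hψ hx h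
  exact (hψ.smul_eq_iff hx t).2 fun i hi => absurd (h0 i) hi

omit [T2Space M] [ContinuousSMul (Torus 2) M] in
/-- The stabiliser of a point with a single vanishing coordinate in a chart. -/
theorem IsTorusChart.smul_eq_iff_mem_range (hψ : IsTorusChart ψ δ) {A : Matrix (Fin 2) (Fin 2) ℤ}
    (hA : ∀ j z, δ.symm (Pi.mulSingle j z) = oneParam (A j) z) {x : M} (hx : x ∈ ψ.source)
    {i j : Fin 2} (hij : i ≠ j) (hi : ψ x i = 0) (hj : ψ x j ≠ 0) (t : Torus 2) :
    t • x = x ↔ t ∈ (oneParam (A i)).range := by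
  have hk : ∀ k : Fin 2, k = i ∨ k = j := by
    intro k
    have := k.2; have := i.2; have := j.2
    have h2 : (i : ℕ) ≠ j := fun h => hij (Fin.ext h)
    by_cases h : (k : ℕ) = i
    · exact Or.inl (Fin.ext h)
    · exact Or.inr (Fin.ext (by omega))
  rw [hψ.smul_eq_iff hx]
  constructor
  · intro h
    refine ⟨δ t i, ?_⟩
    rw [← hA, ContinuousMulEquiv.symm_apply_eq]
    funext k
    rcases hk k with rfl | rfl
    · simp
    · rw [Pi.mulSingle_eq_of_ne hij.symm, h _ hj]
  · rintro ⟨z, rfl⟩ k hk'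
    rw [← hA, ContinuousMulEquiv.apply_symm_apply]
    rcases hk k with rfl | rfl
    · exact absurd hi hk'
    · rw [Pi.mulSingle_eq_of_ne hij.symm]

end Strata

/-! ### Limits and transition functions for actions of compact groups. -/

section CompactActions

variable {T M X : Type*} [TopologicalSpace T] [CompactSpace T] [TopologicalSpace M] [T2Space M]
  [SMul T M] [ContinuousSMul T M]

/-- For an action of a compact group, `τ • g` has the same limit as `τ • f` when `f` and `g` have
the same limit. -/
theorem tendsto_smul_of_tendsto_smul {l : Filter X} {τ : X → T} {f g : X → M} {e b : M}
    (hf : Filter.Tendsto f l (nhds e)) (hg : Filter.Tendsto g l (nhds e))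
    (h : Filter.Tendsto (fun x => τ x • f x) l (nhds b)) :
    Filter.Tendsto (fun x => τ x • g x) l (nhds b) := by
  rw [Filter.tendsto_iff_ultrafilter]
  intro F hF
  -- `τ` itself need not converge, but along an ultrafilter it does by compactness, and then `t • e
  -- = b` for the limit `t`.
  obtain ⟨t, -, ht⟩ := isCompact_univ.ultrafilter_le_nhds (F.map τ) (by simp)
  have ht' : Filter.Tendsto τ F (nhds t) := ht
  have h1 := ht'.smul (hf.mono_left hF)
  have h2 := ht'.smul (hg.mono_left hF)
  rwa [tendsto_nhds_unique h1 (h.mono_left hF)] at h2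

/-- Transition functions between sections of a free action of a compact group are continuous. -/
theorem continuousWithinAt_of_free [TopologicalSpace X] {L : Set X} {τ : X → T} {f g : X → M}
    {x : X} (hx : x ∈ L) (hf : ContinuousOn f L) (hg : ContinuousOn g L)
    (h : ∀ y ∈ L, τ y • f y = g y) (hfree : ∀ t u : T, t • f x = u • f x → t = u) :
    ContinuousWithinAt τ L x := by
  rw [ContinuousWithinAt, Filter.tendsto_iff_ultrafilter]
  intro F hF
  obtain ⟨t, -, ht⟩ := isCompact_univ.ultrafilter_le_nhds (F.map τ) (by simp)
  have ht' : Filter.Tendsto τ F (nhds t) := ht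
  have h1 := ht'.smul ((hf x hx).mono_left hF)
  have h2 : Filter.Tendsto (fun y => τ y • f y) F (nhds (g x)) := by
    refine Filter.Tendsto.congr' ?_ ((hg x hx).mono_left hF)
    filter_upwards [hF self_mem_nhdsWithin] with y hy
    exact (h y hy).symm
  have h3 := tendsto_nhds_unique h1 h2
  rw [← h x hx] at h3
  rwa [hfree _ _ h3] at ht'

end CompactActions

/-! ### Gluing two sections of the orbit map along a retract. -/

section GlobalSection

variable {n : ℕ} {M : Type*} [TopologicalSpace M] [MulAction (Torus n) M]
  {P : Set (EuclideanSpace ℝ (Fin n))} {q : M → P} {σ σ₁ σ₂ : EuclideanSpace ℝ (Fin n) → M}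
  {K K₁ K₂ : Set (EuclideanSpace ℝ (Fin n))}

omit [MulAction (Torus n) M] in
theorem IsSectionOn.mono (h : IsSectionOn q σ K) (hK : K₁ ⊆ K) : IsSectionOn q σ K₁ :=
  ⟨h.1.mono hK, fun x hx => h.2 x (hK hx)⟩

omit [MulAction (Torus n) M] in
theorem IsSectionOn.glue (hK₁ : IsClosed K₁) (hK₂ : IsClosed K₂) (h₁ : IsSectionOn q σ₁ K₁)
    (h₂ : IsSectionOn q σ₂ K₂) (he : ∀ x ∈ K₁ ∩ K₂, σ₁ x = σ₂ x) :
    ∃ σ, IsSectionOn q σ (K₁ ∪ K₂) := by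
  classical
  let σ := fun x => if x ∈ K₁ then σ₁ x else σ₂ x
  have e₁ : ∀ x ∈ K₁, σ x = σ₁ x := fun x hx => if_pos hx
  have e₂ : ∀ x ∈ K₂, σ x = σ₂ x := fun x hx => by
    by_cases h : x ∈ K₁
    · rw [e₁ x h, he x ⟨h, hx⟩]
    · exact if_neg h
  refine ⟨σ, (h₁.1.congr e₁).union_of_isClosed (h₂.1.congr e₂) hK₁ hK₂, ?_⟩
  rintro x (hx | hx)
  · rw [e₁ x hx, h₁.2 x hx]
  · rw [e₂ x hx, h₂.2 x hx]

/-- Two sections can be glued along a suitable retract of the second domain. -/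
theorem IsQuasitoric.glue_sections [T2Space M] [ContinuousSMul (Torus n) M]
    (hq : IsQuasitoric P q) (hfree : ∀ x : M, (q x : EuclideanSpace ℝ (Fin n)) ∈ interior P →
      ∀ t : Torus n, t • x = x → t = 1)
    (hK₁ : IsClosed K₁) (hK₂ : IsClosed K₂) (h₁ : IsSectionOn q σ₁ K₁)
    (h₂ : IsSectionOn q σ₂ K₂) {r : EuclideanSpace ℝ (Fin n) → EuclideanSpace ℝ (Fin n)}
    (hr : ContinuousOn r K₂) (hrm : ∀ k ∈ K₂, r k ∈ K₁ ∩ K₂) (hri : ∀ x ∈ K₁ ∩ K₂, r x = x)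
    (hcase : ∀ k ∈ K₂, r k ∈ interior P ∨ r k = k ∨ ∀ k' ∈ K₂, r k' = r k) :
    ∃ σ, IsSectionOn q σ (K₁ ∪ K₂) := by
  have hex : ∀ x ∈ K₁ ∩ K₂, ∃ t : Torus n, t • σ₂ x = σ₁ x := by
    intro x hx
    exact (hq.eq_iff _ _).1 (Subtype.ext ((h₁.2 x hx.1).trans (h₂.2 x hx.2).symm))
  choose! τ hτ using hex
  refine h₁.glue hK₁ hK₂ (σ₂ := fun k => τ (r k) • σ₂ k) ⟨fun k hk => ?_, fun k hk => ?_⟩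
    (fun x hx => ?_)
  -- The corrected section `τ (r k) • σ₂ k` is continuous for three reasons. Over the interior the
  -- action is free, so `τ` is continuous. At a fixed point of `r`, `τ` may jump, but `τ (r x) • σ₂
  -- (r x) = σ₁ (r x)` converges and compactness transfers this to `σ₂ x`. If `r` is constant, a
  -- single torus element is applied.
  · rcases hcase k hk with hc | hc | hc
    · have hτc : ContinuousWithinAt τ (K₁ ∩ K₂) (r k) := by
        refine continuousWithinAt_of_free (hrm k hk) (h₂.1.mono Set.inter_subset_right)
          (h₁.1.mono Set.inter_subset_left) hτ fun t u htu => ?_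
        have h3 : (u⁻¹ * t) • σ₂ (r k) = σ₂ (r k) := by
          rw [mul_smul, htu, inv_smul_smul]
        have := hfree _ (by rw [h₂.2 _ (hrm k hk).2]; exact hc) _ h3
        exact (inv_mul_eq_one.1 this).symm
      exact (hτc.comp (hr k hk) hrm).smul (h₂.1 k hk)
    · have hk1 : k ∈ K₁ ∩ K₂ := hc ▸ hrm k hk
      have ht : Filter.Tendsto (fun x => τ (r x) • σ₂ (r x)) (nhdsWithin k K₂)
          (nhds (τ (r k) • σ₂ k)) := by
        have e : τ (r k) • σ₂ k = σ₁ (r k) := by rw [hc]; exact hτ k hk1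
        rw [e]
        have h4 : ContinuousWithinAt (fun x => σ₁ (r x)) K₂ k :=
          ((h₁.1.mono Set.inter_subset_left) (r k) (hrm k hk)).comp (hr k hk) hrm
        refine Filter.Tendsto.congr' ?_ h4
        filter_upwards [self_mem_nhdsWithin] with y hy
        exact (hτ _ (hrm y hy)).symm
      refine tendsto_smul_of_tendsto_smul (e := σ₂ k) ?_ (h₂.1 k hk) ht
      have h5 : ContinuousWithinAt (fun x => σ₂ (r x)) K₂ k :=
        (h₂.1 (r k) (hrm k hk).2).comp (hr k hk) fun y hy => (hrm y hy).2
      have := h5.tendsto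
      rwa [hc] at this
    · have : ContinuousWithinAt (fun x => τ (r k) • σ₂ x) K₂ k :=
        (h₂.1 k hk).const_smul (τ (r k))
      refine this.congr (fun y hy => ?_) rfl
      rw [hc y hy]
  · rw [hq.smul_eq, h₂.2 k hk]
  · rw [hri x hx, hτ x hx]

end GlobalSection

/-! ### A global section over a polygon by subdivision. -/

section PlanarSections

variable {M : Type*} [TopologicalSpace M] [T2Space M] [MulAction (Torus 2) M]
  [ContinuousSMul (Torus 2) M] {P : Set (EuclideanSpace ℝ (Fin 2))} {q : M → P}

theorem Fin.eq_or_eq_of_ne_two {i j : Fin 2} (hij : i ≠ j) (k : Fin 2) : k = i ∨ k = j := by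
  have := k.2; have := i.2; have := j.2
  have h2 : (i : ℕ) ≠ j := fun h => hij (Fin.ext h)
  by_cases h : (k : ℕ) = i
  · exact Or.inl (Fin.ext h)
  · exact Or.inr (Fin.ext (by omega))

theorem EuclideanSpace.ext_two {i j : Fin 2} (hij : i ≠ j) {x y : EuclideanSpace ℝ (Fin 2)}
    (hi : x i = y i) (hj : x j = y j) : x = y := by
  ext k
  rcases Fin.eq_or_eq_of_ne_two hij k with rfl | rfl <;> assumption

/-- The cut `K ∩ {x i = c}` is empty, a point or a segment `[a, b]`, onto which one retracts. If it
meets the interior of `P`, the retraction is pushed towards an interior point away from the line,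
where freeness gives continuity. Otherwise it lies in an edge, `P` is on one side of the line, and
no gluing is needed. -/
theorem IsQuasitoric.isSectionOn_of_line
    (hq : IsQuasitoric P q) {i j : Fin 2} (hij : i ≠ j)
    {K : Set (EuclideanSpace ℝ (Fin 2))} (hKc : IsCompact K) (hKv : Convex ℝ K) (hKP : K ⊆ P)
    (c : ℝ) (h₁ : ∃ σ, IsSectionOn q σ (K ∩ {x | x i ≤ c}))
    (h₂ : ∃ σ, IsSectionOn q σ (K ∩ {x | c ≤ x i})) : ∃ σ, IsSectionOn q σ K := by
  obtain ⟨σ₁, h₁⟩ := h₁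
  obtain ⟨σ₂, h₂⟩ := h₂
  have hci : Continuous fun x : EuclideanSpace ℝ (Fin 2) => x i := by fun_prop
  have hcj : Continuous fun x : EuclideanSpace ℝ (Fin 2) => x j := by fun_prop
  have hcl₁ : IsClosed (K ∩ {x | x i ≤ c}) :=
    hKc.isClosed.inter (isClosed_le hci continuous_const)
  have hcl₂ : IsClosed (K ∩ {x | c ≤ x i}) :=
    hKc.isClosed.inter (isClosed_le continuous_const hci)
  have hU : K ∩ {x | x i ≤ c} ∪ K ∩ {x | c ≤ x i} = K := by
    ext x
    simp only [Set.mem_union, Set.mem_inter_iff, Set.mem_ofPred_eq]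
    have := le_total (x i) c
    tauto
  have hL : ∀ x, x ∈ K ∩ {x | x i ≤ c} ∩ (K ∩ {x | c ≤ x i}) ↔ x ∈ K ∧ x i = c := by
    intro x
    simp only [Set.mem_inter_iff, Set.mem_ofPred_eq]
    constructor
    · rintro ⟨⟨h, h'⟩, -, h''⟩; exact ⟨h, le_antisymm h' h''⟩
    · rintro ⟨h, h'⟩; exact ⟨⟨h, h'.le⟩, h, h'.ge⟩
  let L : Set (EuclideanSpace ℝ (Fin 2)) := K ∩ {x | x i = c}
  have hLc : IsCompact L := hKc.inter_right (isClosed_eq hci continuous_const)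
  have hLi : ∀ x y : EuclideanSpace ℝ (Fin 2), x i = c → y i = c → ∀ t : ℝ,
      (AffineMap.lineMap (k := ℝ) x y t) i = c := by
    intro x y hx hy t
    rw [AffineMap.lineMap_apply]
    simp [hx, hy]
  have hLj : ∀ x y : EuclideanSpace ℝ (Fin 2), ∀ t : ℝ,
      (AffineMap.lineMap (k := ℝ) x y t) j = x j + t * (y j - x j) := by
    intro x y t
    rw [AffineMap.lineMap_apply]
    simp [add_comm]
  rcases L.eq_empty_or_nonempty with hLe | hLne
  · rw [← hU]
    refine h₁.glue hcl₁ hcl₂ h₂ fun x hx => ?_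
    have : x ∈ L := (hL x).1 hx
    rw [hLe] at this
    exact absurd this (Set.notMem_empty x)
  obtain ⟨a, haL, ha⟩ := hLc.exists_isMinOn hLne hcj.continuousOn
  obtain ⟨b, hbL, hb⟩ := hLc.exists_isMaxOn hLne hcj.continuousOn
  have ha' : ∀ x ∈ L, a j ≤ x j := fun x hx => ha hx
  have hb' : ∀ x ∈ L, x j ≤ b j := fun x hx => hb hx
  -- The position along `[a, b]`, clamped to `[0, 1]`; for `a = b` the division by zero is harmless
  -- because `r` is then constant.
  let s : EuclideanSpace ℝ (Fin 2) → ℝ := fun x =>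
    Set.projIcc (0 : ℝ) 1 zero_le_one ((x j - a j) / (b j - a j))
  have hs : Continuous s := by
    refine continuous_subtype_val.comp (continuous_projIcc.comp ?_)
    fun_prop
  let r : EuclideanSpace ℝ (Fin 2) → EuclideanSpace ℝ (Fin 2) := fun x =>
    AffineMap.lineMap (k := ℝ) a b (s x)
  have hr : Continuous r := AffineMap.lineMap_continuous.comp hs
  have hrL : ∀ x, r x ∈ L := fun x =>
    ⟨hKv.lineMap_mem haL.1 hbL.1 (Set.projIcc (0 : ℝ) 1 zero_le_one _).2, hLi a b haL.2 hbL.2 _⟩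
  have hrid : ∀ x ∈ L, r x = x := by
    intro x hx
    refine EuclideanSpace.ext_two hij ((hrL x).2.trans hx.2.symm) ?_
    simp only [r, hLj]
    have h1 := ha' x hx
    have h2 := hb' x hx
    rcases (h1.trans h2).eq_or_lt with h | h
    · rw [h, sub_self, mul_zero, add_zero]; linarith
    · have hpos : 0 < b j - a j := sub_pos.2 h
      have hm : (x j - a j) / (b j - a j) ∈ Set.Icc (0 : ℝ) 1 :=
        ⟨div_nonneg (by linarith) hpos.le, (div_le_one hpos).2 (by linarith)⟩
      simp only [s, Set.projIcc_of_mem zero_le_one hm]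
      field_simp
      ring
  by_cases hab : a = b
  · rw [← hU]
    refine hq.glue_sections (fun x hx t ht => hq.eq_one_of_mem_interior hx ht) hcl₁ hcl₂ h₁ h₂
      hr.continuousOn (fun k _ => (hL _).2 (hrL k)) (fun x hx => hrid x ((hL x).1 hx))
      (fun k _ => Or.inr (Or.inr fun k' _ => ?_))
    simp only [r, hab, AffineMap.lineMap_same_apply]
  have habj : a j ≠ b j := fun h => hab (EuclideanSpace.ext_two hij (haL.2.trans hbL.2.symm) h)
  by_cases hm : ∃ m ∈ L, m ∈ interior P
  · obtain ⟨m, hmL, hmP⟩ := hm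
    -- `d` vanishes exactly on the line: the modified map is still a retraction onto `L`, but sends
    -- points off the line to interior points of `P`.
    let d : EuclideanSpace ℝ (Fin 2) → ℝ := fun x => min 1 |x i - c|
    have hd : Continuous d := by fun_prop
    have hd0 : ∀ x, 0 ≤ d x := fun x => le_min zero_le_one (abs_nonneg _)
    have hd1 : ∀ x, d x ≤ 1 := fun x => min_le_left _ _
    let r' : EuclideanSpace ℝ (Fin 2) → EuclideanSpace ℝ (Fin 2) := fun x =>
      AffineMap.lineMap (k := ℝ) (r x) m (d x)
    have hr'L : ∀ x, r' x ∈ L := fun x =>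
      ⟨hKv.lineMap_mem (hrL x).1 hmL.1 ⟨hd0 x, hd1 x⟩, hLi _ _ (hrL x).2 hmL.2 _⟩
    have hr'c : Continuous r' := by
      simp only [r', AffineMap.lineMap_apply_module]
      fun_prop
    have hr'id : ∀ x ∈ L, r' x = x := by
      intro x hx
      have : d x = 0 := by
        have : x i = c := hx.2
        simp [d, this]
      simp only [r', this, AffineMap.lineMap_apply_zero, hrid x hx]
    rw [← hU]
    refine hq.glue_sections (fun x hx t ht => hq.eq_one_of_mem_interior hx ht) hcl₁ hcl₂ h₁ h₂
      hr'c.continuousOn (fun k _ => (hL _).2 (hr'L k)) (fun x hx => hr'id x ((hL x).1 hx))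
      (fun k hk => ?_)
    by_cases hkc : k i = c
    · exact Or.inr (Or.inl (hr'id k ⟨hk.1, hkc⟩))
    · left
      have hdpos : 0 < d k := lt_min one_pos (abs_pos.2 (sub_ne_zero.2 hkc))
      have hP := hq.simplePolytope.convex
      simp only [r', AffineMap.lineMap_apply_module]
      exact hP.combo_self_interior_mem_interior (hKP (hrL k).1) hmP (by linarith [hd1 k]) hdpos
        (by ring)
  · push Not at hm
    have hmid : AffineMap.lineMap (k := ℝ) a b (1 / 2 : ℝ) ∈ L :=
      ⟨hKv.lineMap_mem haL.1 hbL.1 ⟨by norm_num, by norm_num⟩, hLi a b haL.2 hbL.2 _⟩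
    have hmo : AffineMap.lineMap (k := ℝ) a b (1 / 2 : ℝ) ∈ openSegment ℝ a b := by
      rw [openSegment_eq_image_lineMap]
      exact ⟨1 / 2, ⟨by norm_num, by norm_num⟩, rfl⟩
    obtain ⟨G, hG⟩ := (hq.mem_interior_or_facet (hKP hmid.1)).resolve_left (hm _ hmid)
    have haG := G.isExtreme.2 (hKP haL.1) (hKP hbL.1) hG hmo
    have hbG := G.isExtreme.right_mem_of_mem_openSegment (hKP haL.1) (hKP hbL.1) hG hmo
    have hGc : ∀ x ∈ G.1, x i = c := by
      obtain ⟨u, v, -, hGs, -, -⟩ := G.exists_eq_segment hq.simplePolytope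
      rw [hGs, segment_eq_image_lineMap] at haG hbG ⊢
      obtain ⟨s', -, hs'⟩ := haG
      obtain ⟨t', -, ht'⟩ := hbG
      have hli : ∀ t : ℝ, (AffineMap.lineMap (k := ℝ) u v t) i = u i + t * (v i - u i) := by
        intro t
        rw [AffineMap.lineMap_apply]
        simp [add_comm]
      have h1 : a i = c := haL.2
      have h2 : b i = c := hbL.2
      rw [← hs', hli] at h1
      rw [← ht', hli] at h2
      have hst : s' ≠ t' := fun h => hab (by rw [← hs', ← ht', h])
      have h3 : v i - u i = 0 := by
        have : (s' - t') * (v i - u i) = 0 := by linear_combination h1 - h2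
        exact (mul_eq_zero.1 this).resolve_left (sub_ne_zero.2 hst)
      rintro _ ⟨w, -, rfl⟩
      rw [hli, h3]
      rw [h3] at h1
      linarith
    obtain ⟨l, m, hle, hiff, -⟩ := G.exists_functional hq.simplePolytope
    -- Points of `P` strictly on both sides would be joined by a segment crossing the line at some
    -- `z`. The functional of `G` is constant on that line, so `z ∈ G`, and extremality puts the
    -- endpoints in `G` as well, contradicting `hGc`.
    have hside : (∀ x ∈ P, x i ≤ c) ∨ ∀ x ∈ P, c ≤ x i := by
      by_contra hne
      push Not at hne
      obtain ⟨⟨y, hyP, hy⟩, x, hxP, hx⟩ := hne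
      let θ : ℝ := (c - x i) / (y i - x i)
      have hyx : 0 < y i - x i := by linarith
      have hθ0 : 0 < θ := div_pos (by linarith) hyx
      have hθ1 : θ < 1 := (div_lt_one hyx).2 (by linarith)
      let z := AffineMap.lineMap (k := ℝ) x y θ
      have hzi : z i = c := by
        simp only [z, AffineMap.lineMap_apply, θ]
        simp only [vsub_eq_sub, vadd_eq_add, PiLp.add_apply, PiLp.smul_apply, PiLp.sub_apply,
          smul_eq_mul]
        field_simp
        ring
      have hzo : z ∈ openSegment ℝ x y := by
        rw [openSegment_eq_image_lineMap]
        exact ⟨θ, ⟨hθ0, hθ1⟩, rfl⟩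
      have hzP : z ∈ P := hq.simplePolytope.convex.openSegment_subset hxP hyP hzo
      have hzab : z = a + ((z j - a j) / (b j - a j)) • (b - a) := by
        refine EuclideanSpace.ext_two hij ?_ ?_
        · have h1 : a i = c := haL.2
          have h2 : b i = c := hbL.2
          simp [hzi, h1, h2]
        · have : b j - a j ≠ 0 := sub_ne_zero.2 habj.symm
          simp only [PiLp.add_apply, PiLp.smul_apply, PiLp.sub_apply, smul_eq_mul]
          field_simp
          ring
      have hzG : z ∈ G.1 := by
        rw [hiff z hzP, hzab, map_add, map_smul, map_sub, (hiff a (hKP haL.1)).1 haG,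
          (hiff b (hKP hbL.1)).1 hbG]
        simp
      exact hx.ne (hGc x (G.isExtreme.2 hxP hyP hzG hzo))
    rcases hside with h | h
    · exact ⟨σ₁, h₁.mono fun x hx => ⟨hx, h x (hKP hx)⟩⟩
    · exact ⟨σ₂, h₂.mono fun x hx => ⟨hx, h x (hKP hx)⟩⟩

/-- The orbit map of a quasitoric manifold over a polygon has a global section. -/
theorem IsQuasitoric.exists_section (hq : IsQuasitoric P q) : ∃ σ, IsSectionOn q σ P := by
  classical
  have hP := hq.simplePolytope
  let B : BoxIntegral.Box (Fin 2) → Set (EuclideanSpace ℝ (Fin 2)) := fun J =>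
    {x | WithLp.ofLp x ∈ BoxIntegral.Box.Icc J}
  have hB : ∀ J x, x ∈ B J ↔ ∀ i, J.lower i ≤ x i ∧ x i ≤ J.upper i := by
    intro J x
    simp only [B, Set.mem_ofPred_eq, BoxIntegral.Box.Icc_def, Set.mem_Icc, Pi.le_def, forall_and]
  have hBc : ∀ J, IsClosed (B J) := fun J =>
    (BoxIntegral.Box.isCompact_Icc J).isClosed.preimage (PiLp.continuous_ofLp 2 _)
  have hBv : ∀ J, Convex ℝ (B J) := fun J =>
    (convex_Icc J.lower J.upper).linear_preimage
      (WithLp.linearEquiv 2 ℝ (Fin 2 → ℝ)).toLinearMap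
  obtain ⟨R, hR⟩ := hP.isCompact.isBounded.subset_closedBall 0
  let I : BoxIntegral.Box (Fin 2) := ⟨fun _ => -(|R| + 1), fun _ => |R| + 1, fun _ => by
    have := abs_nonneg R; linarith⟩
  -- Small boxes carry local sections. Sections over the four quarters of a box are glued first
  -- across the horizontal and then across the vertical midline.
  have key : ∃ σ, IsSectionOn q σ (P ∩ B I) := by
    refine BoxIntegral.Box.subbox_induction_on' (p := fun J => ∃ σ, IsSectionOn q σ (P ∩ B J)) I
      (fun J _ hJ => ?_) (fun z _ => ?_)
    · let c : Fin 2 → ℝ := fun i => (J.lower i + J.upper i) / 2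
      have hKc : IsCompact (P ∩ B J) := hP.isCompact.inter_right (hBc J)
      have hKv : Convex ℝ (P ∩ B J) := hP.convex.inter (hBv J)
      have hlin : ∀ i : Fin 2, IsLinearMap ℝ fun x : EuclideanSpace ℝ (Fin 2) => x i := fun i =>
        ⟨fun _ _ => rfl, fun _ _ => rfl⟩
      have hci : Continuous fun x : EuclideanSpace ℝ (Fin 2) => x 0 := by fun_prop
      -- `S` records the coordinates in which the quarter is the upper half.
      have hq4 : ∀ (S : Set (Fin 2)) (A : Set (EuclideanSpace ℝ (Fin 2))), A ⊆ P ∩ B J →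
          (∀ x ∈ A, ∀ i, (i ∈ S → c i ≤ x i) ∧ (i ∉ S → x i ≤ c i)) →
          ∃ σ, IsSectionOn q σ A := by
        intro S A hA hAS
        obtain ⟨σ, hσ⟩ := hJ S
        refine ⟨σ, hσ.mono fun x hx => ⟨(hA hx).1, ?_⟩⟩
        rw [hB]
        intro i
        have h1 := (hB J x).1 (hA hx).2 i
        have h2 := hAS x hx i
        by_cases hi : i ∈ S
        · simp only [BoxIntegral.Box.splitCenterBox, Set.piecewise, hi, if_true]
          exact ⟨h2.1 hi, h1.2⟩
        · simp only [BoxIntegral.Box.splitCenterBox, Set.piecewise, hi, if_false]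
          exact ⟨h1.1, h2.2 hi⟩
      refine hq.isSectionOn_of_line (i := 0) (j := 1) (by simp) hKc hKv Set.inter_subset_left
        (c 0) ?_ ?_
      · refine hq.isSectionOn_of_line (i := 1) (j := 0) (by simp)
          (hKc.inter_right (isClosed_le hci continuous_const))
          (hKv.inter (convex_halfSpace_le (hlin 0) (c 0)))
          (Set.inter_subset_left.trans Set.inter_subset_left) (c 1) ?_ ?_
        · refine hq4 ∅ _ (Set.inter_subset_left.trans Set.inter_subset_left) ?_
          rintro x ⟨⟨-, hx0⟩, hx1⟩ i
          refine ⟨fun h => absurd h (Set.notMem_empty i), fun _ => ?_⟩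
          fin_cases i
          · exact hx0
          · exact hx1
        · refine hq4 {1} _ (Set.inter_subset_left.trans Set.inter_subset_left) ?_
          rintro x ⟨⟨-, hx0⟩, hx1⟩ i
          fin_cases i
          · exact ⟨fun h => absurd h (by simp), fun _ => hx0⟩
          · exact ⟨fun _ => hx1, fun h => absurd rfl h⟩
      · refine hq.isSectionOn_of_line (i := 1) (j := 0) (by simp)
          (hKc.inter_right (isClosed_le continuous_const hci))
          (hKv.inter (convex_halfSpace_ge (hlin 0) (c 0)))
          (Set.inter_subset_left.trans Set.inter_subset_left) (c 1) ?_ ?_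
        · refine hq4 {0} _ (Set.inter_subset_left.trans Set.inter_subset_left) ?_
          rintro x ⟨⟨-, hx0⟩, hx1⟩ i
          fin_cases i
          · exact ⟨fun _ => hx0, fun h => absurd rfl h⟩
          · exact ⟨fun h => absurd h (by simp), fun _ => hx1⟩
        · refine hq4 Set.univ _ (Set.inter_subset_left.trans Set.inter_subset_left) ?_
          rintro x ⟨⟨-, hx0⟩, hx1⟩ i
          refine ⟨fun _ => ?_, fun h => absurd (Set.mem_univ i) h⟩
          fin_cases i
          · exact hx0
          · exact hx1
    · have hcont : Continuous (WithLp.toLp 2 : (Fin 2 → ℝ) → EuclideanSpace ℝ (Fin 2)) :=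
        PiLp.continuous_toLp 2 _
      have hsub : ∀ (J : BoxIntegral.Box (Fin 2)) (U : Set (EuclideanSpace ℝ (Fin 2))),
          BoxIntegral.Box.Icc J ⊆ WithLp.toLp 2 ⁻¹' U → B J ⊆ U := fun J U h x hx => by
        have := h hx
        simpa using this
      by_cases hz : WithLp.toLp 2 z ∈ P
      · obtain ⟨U, hU, σ, hσ⟩ := hq.exists_local_section hz
        refine ⟨_, mem_nhdsWithin_of_mem_nhds (hcont.continuousAt hU), fun J _ m _ hJ _ => ?_⟩
        exact ⟨σ, hσ.mono fun x hx => ⟨hsub J U hJ hx.2, hx.1⟩⟩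
      -- Small boxes around a point outside `P` miss `P`, so any function is a section over the
      -- empty set.
      · have hU : Pᶜ ∈ nhds (WithLp.toLp 2 z : EuclideanSpace ℝ (Fin 2)) :=
          hP.isCompact.isClosed.isOpen_compl.mem_nhds hz
        refine ⟨_, mem_nhdsWithin_of_mem_nhds (hcont.continuousAt hU), fun J _ m _ hJ _ => ?_⟩
        obtain ⟨p, hp⟩ : P.Nonempty := hP.interior_nonempty.mono interior_subset
        obtain ⟨U, hU, σ, hσ⟩ := hq.exists_local_section hp
        exact ⟨σ, hσ.mono fun x hx => absurd hx.1 (hsub J _ hJ hx.2)⟩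
  obtain ⟨σ, hσ⟩ := key
  refine ⟨σ, hσ.mono fun x hx => ⟨hx, ?_⟩⟩
  rw [hB]
  intro i
  have h1 := mem_closedBall_zero_iff.1 (hR hx)
  have h2 : |x i| ≤ ‖x‖ := by
    have := PiLp.norm_apply_le x i
    rwa [Real.norm_eq_abs] at this
  have h3 := le_abs_self R
  have h4 := abs_le.1 h2
  constructor
  · change -(|R| + 1) ≤ x i; linarith [h4.1]
  · change x i ≤ |R| + 1; linarith [h4.2]

end PlanarSections

/-! ### Isotropy directions over the edges and their determinants. -/

section CharacteristicVectors

variable {M : Type*} [TopologicalSpace M] [MulAction (Torus 2) M]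
  {P : Set (EuclideanSpace ℝ (Fin 2))} {q : M → P}

/-- `v` is a primitive vector spanning the isotropy circle over the relative interior of `G`. -/
def IsCharVec (q : M → P) (G : Facet P) (v : Fin 2 → ℤ) : Prop :=
  IsPrimitiveVec v ∧ ∀ x : M, (q x : EuclideanSpace ℝ (Fin 2)) ∈ G.1 →
    (q x : EuclideanSpace ℝ (Fin 2)) ∉ P.extremePoints ℝ →
    ∀ t : Torus 2, t • x = x ↔ t ∈ (oneParam v).range

theorem IsPrimitiveVec.neg {n : ℕ} {v : Fin n → ℤ} (h : IsPrimitiveVec v) :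
    IsPrimitiveVec (-v) := by
  obtain ⟨χ, hχ⟩ := h
  exact ⟨-χ, by rw [neg_dotProduct_neg, hχ]⟩

omit [TopologicalSpace M] in
theorem IsCharVec.neg {G : Facet P} {v : Fin 2 → ℤ} (h : IsCharVec q G v) :
    IsCharVec q G (-v) :=
  ⟨h.1.neg, fun x hx hx' t => by rw [oneParam_range_neg]; exact h.2 x hx hx' t⟩

theorem Facet.exists_mem_notMem_extremePoints (hP : IsSimplePolytope P) (G : Facet P) :
    ∃ p ∈ G.1, p ∉ P.extremePoints ℝ := by
  obtain ⟨a, b, hab, hG, ha, hb⟩ := G.exists_eq_segment hP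
  refine ⟨midpoint ℝ a b, hG ▸ midpoint_mem_segment a b, fun h => ?_⟩
  have hm : midpoint ℝ a b ∈ segment ℝ a b := midpoint_mem_segment a b
  rcases eq_or_eq_of_mem_segment_of_mem_extremePoints ha.1 hb.1 h hm with h | h
  · exact hab ((midpoint_eq_left_iff ℝ).1 h)
  · exact hab ((midpoint_eq_right_iff ℝ).1 h)

theorem notMem_extremePoints_of_mem_openSegment {a b p : EuclideanSpace ℝ (Fin 2)}
    (ha : a ∈ P) (hb : b ∈ P) (hab : a ≠ b) (hp : p ∈ openSegment ℝ a b) :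
    p ∉ P.extremePoints ℝ := by
  intro h
  have h1 := h.2 ha hb hp
  rw [← h1] at hp
  exact hab (left_mem_openSegment_iff.1 hp)

theorem IsPrimitiveVec.of_mul_eq_one {n : ℕ} {A B : Matrix (Fin n) (Fin n) ℤ} (h : A * B = 1)
    (i : Fin n) : IsPrimitiveVec (A i) :=
  ⟨fun k => B k i, by
    have := congrFun (congrFun h i) i
    rw [Matrix.mul_apply', Matrix.one_apply_eq] at this
    exact this⟩

variable [T2Space M] [ContinuousSMul (Torus 2) M]

/-- Every facet has a characteristic vector. -/
theorem IsQuasitoric.exists_charVec (hq : IsQuasitoric P q) (G : Facet P) :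
    ∃ v, IsCharVec q G v := by
  obtain ⟨σ, hσ⟩ := hq.exists_section
  obtain ⟨a, b, hab, hG, ha, hb⟩ := G.exists_eq_segment hq.simplePolytope
  have hsub : openSegment ℝ a b ⊆ G.1 := hG ▸ openSegment_subset_segment ℝ a b
  have hext : ∀ p ∈ openSegment ℝ a b, p ∉ P.extremePoints ℝ := fun p hp =>
    notMem_extremePoints_of_mem_openSegment ha.1 hb.1 hab hp
  -- Over the open edge exactly one chart coordinate vanishes. The other one stays nonzero nearby,
  -- so the same coordinate vanishes and the stabiliser is locally constant; connectedness of the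
  -- edge then makes it constant.
  have hpt : ∀ p ∈ openSegment ℝ a b, ∃ v, IsPrimitiveVec v ∧
      (∀ t : Torus 2, t • σ p = σ p ↔ t ∈ (oneParam v).range) ∧
      ∀ᶠ p' in nhdsWithin p (openSegment ℝ a b),
        ∀ t : Torus 2, t • σ p' = σ p' ↔ t ∈ (oneParam v).range := by
    intro p hp
    obtain ⟨ψ, δ, hy, hψ⟩ := hq.exists_chart (σ p)
    obtain ⟨A, B, hAB, hA⟩ := exists_matrix_of_torusAut δ
    have hqp : ∀ p' ∈ openSegment ℝ a b, (q (σ p') : EuclideanSpace ℝ (Fin 2)) = p' :=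
      fun p' hp' => hσ.2 p' (G.subset (hsub hp'))
    obtain ⟨i, j, hij, hi, hj⟩ := hq.chart_of_mem_facet hψ hy
      (by rw [hqp p hp]; exact hext p hp) (by rw [hqp p hp]; exact hsub hp)
    refine ⟨A i, IsPrimitiveVec.of_mul_eq_one hAB i,
      fun t => hψ.smul_eq_iff_mem_range hA hy hij hi hj t, ?_⟩
    have hσc : Filter.Tendsto σ (nhdsWithin p (openSegment ℝ a b)) (nhds (σ p)) :=
      (hσ.1 p (G.subset (hsub hp))).mono (hsub.trans G.subset)
    have hψc : Filter.Tendsto (fun x => ψ x j) (nhds (σ p)) (nhds (ψ (σ p) j)) :=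
      ((continuous_apply j).continuousAt.comp (ψ.continuousAt hy)).tendsto
    filter_upwards [self_mem_nhdsWithin, hσc (ψ.open_source.mem_nhds hy),
      (hψc.comp hσc).eventually_ne hj] with p' hp' hs' hj' t
    obtain ⟨i', j', hij', hi', hj''⟩ := hq.chart_of_mem_facet hψ hs'
      (by rw [hqp p' hp']; exact hext p' hp') (by rw [hqp p' hp']; exact hsub hp')
    have hii : i' = i := by
      rcases Fin.eq_or_eq_of_ne_two hij i' with h | h
      · exact h
      · exact absurd (h ▸ hi') hj'
    subst hii
    exact hψ.smul_eq_iff_mem_range hA hs' hij hi' hj' t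
  obtain ⟨p₀, hp₀⟩ : (openSegment ℝ a b).Nonempty :=
    ⟨_, midpoint_mem_openSegment a b⟩
  obtain ⟨v, hv, hv₀, -⟩ := hpt p₀ hp₀
  have hconst : ∀ p ∈ openSegment ℝ a b,
      ∀ t : Torus 2, t • σ p₀ = σ p₀ ↔ t • σ p = σ p := by
    intro p hp
    refine (convex_openSegment a b).isPreconnected.induction₂
      (fun p p' => ∀ t : Torus 2, t • σ p = σ p ↔ t • σ p' = σ p') (fun p hp => ?_)
      (fun _ _ _ _ _ _ h1 h2 t => (h1 t).trans (h2 t)) (fun _ _ _ _ h t => (h t).symm) hp₀ hp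
    obtain ⟨w, -, hw, hev⟩ := hpt p hp
    filter_upwards [hev] with p' hp' t
    rw [hw t, hp' t]
  refine ⟨v, hv, fun x hx hxe t => ?_⟩
  have hxo : (q x : EuclideanSpace ℝ (Fin 2)) ∈ openSegment ℝ a b := by
    rw [hG, ← insert_endpoints_openSegment] at hx
    rcases hx with h | h | h
    · exact absurd (h ▸ ha) hxe
    · exact absurd (h ▸ hb) hxe
    · exact h
  obtain ⟨u, hu⟩ := (hq.eq_iff (σ (q x)) x).1 (Subtype.ext (hσ.2 _ (q x).2))
  have hu' : u • x = σ (q x) := hu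
  -- Points of one orbit have the same stabiliser, the torus being commutative.
  rw [← hv₀, hconst _ hxo, ← hu', ← mul_smul, mul_comm, mul_smul, smul_left_cancel_iff]

theorem IsQuasitoric.smul_eq_of_mem_range (hq : IsQuasitoric P q) {G : Facet P} {v : Fin 2 → ℤ}
    (hv : IsCharVec q G v) {x : M} (hx : (q x : EuclideanSpace ℝ (Fin 2)) ∈ G.1) {t : Torus 2}
    (ht : t ∈ (oneParam v).range) : t • x = x := by
  by_cases h : (q x : EuclideanSpace ℝ (Fin 2)) ∈ P.extremePoints ℝ
  · exact hq.smul_eq_of_mem_extremePoints h t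
  · exact (hv.2 x hx h t).2 ht

theorem Matrix.minor_mul_self_eq_one {A B : Matrix (Fin 2) (Fin 2) ℤ} (hAB : A * B = 1)
    {i j : Fin 2} (hij : i ≠ j) :
    (A i 0 * A j 1 - A i 1 * A j 0) * (A i 0 * A j 1 - A i 1 * A j 0) = 1 := by
  have h1 : A.det * B.det = 1 := by rw [← Matrix.det_mul, hAB, Matrix.det_one]
  have h2 : A.det * A.det = 1 := by
    rcases Int.eq_one_or_neg_one_of_mul_eq_one h1 with h | h <;> rw [h] <;> rfl
  rw [Matrix.det_fin_two] at h2
  fin_cases i <;> fin_cases j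
  · exact absurd rfl hij
  · simp only [Fin.zero_eta, Fin.mk_one]; linear_combination h2
  · simp only [Fin.zero_eta, Fin.mk_one]; linear_combination h2
  · exact absurd rfl hij

omit [T2Space M] [ContinuousSMul (Torus 2) M] in
/-- Near a vertex each of its facets has points that are close to the origin of a given chart. -/
theorem IsQuasitoric.exists_mem_facet_near (hq : IsQuasitoric P q)
    {ψ : OpenPartialHomeomorph M (Fin 2 → ℂ)} {v : EuclideanSpace ℝ (Fin 2)}
    (hv : v ∈ P.extremePoints ℝ) {G : Facet P} (hvG : v ∈ G.1)
    {σ : EuclideanSpace ℝ (Fin 2) → M} (hσ : IsSectionOn q σ P) (hy : σ v ∈ ψ.source)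
    (h0 : ψ (σ v) = 0) {ε : ℝ} (hε : 0 < ε) :
    ∃ p ∈ G.1, p ∉ P.extremePoints ℝ ∧ σ p ∈ ψ.source ∧ ‖ψ (σ p)‖ < ε := by
  obtain ⟨g, hgP, hgv, hg⟩ : ∃ g ∈ P, v ≠ g ∧ G.1 = segment ℝ v g := by
    obtain ⟨a, b, hab, hG, ha, hb⟩ := G.exists_eq_segment hq.simplePolytope
    have hvG' := hvG
    rw [hG] at hvG'
    rcases eq_or_eq_of_mem_segment_of_mem_extremePoints ha.1 hb.1 hv hvG' with rfl | rfl
    · exact ⟨b, hb.1, hab, hG⟩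
    · exact ⟨a, ha.1, hab.symm, by rw [hG, segment_symm]⟩
  have hlim : Filter.Tendsto (fun t : ℝ => AffineMap.lineMap (k := ℝ) v g t)
      (nhdsWithin 0 (Set.Ioo 0 1)) (nhdsWithin v P) := by
    rw [tendsto_nhdsWithin_iff]
    constructor
    · have h := (AffineMap.lineMap_continuous (R := ℝ) (p := v) (q := g)).tendsto 0
      rw [AffineMap.lineMap_apply_zero] at h
      exact h.mono_left nhdsWithin_le_nhds
    · filter_upwards [self_mem_nhdsWithin] with t ht
      exact hq.simplePolytope.convex.lineMap_mem hv.1 hgP ⟨ht.1.le, ht.2.le⟩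
  have hσl := (hσ.1 v hv.1).tendsto.comp hlim
  have hψl : Filter.Tendsto (fun x => ‖ψ x‖) (nhds (σ v)) (nhds 0) := by
    have := (ψ.continuousAt hy).norm.tendsto
    rwa [h0, norm_zero] at this
  have hne : (nhdsWithin (0 : ℝ) (Set.Ioo 0 1)).NeBot := left_nhdsWithin_Ioo_neBot one_pos
  have hmem : ∀ᶠ t : ℝ in nhdsWithin 0 (Set.Ioo 0 1), t ∈ Set.Ioo (0 : ℝ) 1 := self_mem_nhdsWithin
  obtain ⟨t, ht, hs, hn⟩ := (hmem.and
    ((hσl.eventually (ψ.open_source.mem_nhds hy)).and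
      ((hψl.comp hσl).eventually (gt_mem_nhds hε)))).exists
  have hto : AffineMap.lineMap (k := ℝ) v g t ∈ openSegment ℝ v g := by
    rw [openSegment_eq_image_lineMap]
    exact ⟨t, ht, rfl⟩
  exact ⟨_, hg ▸ openSegment_subset_segment ℝ v g hto,
    notMem_extremePoints_of_mem_openSegment hv.1 hgP hgv hto, hs, hn⟩

/-- The characteristic vectors of the two facets at a vertex form a lattice basis. -/
theorem IsQuasitoric.charVec_minor (hq : IsQuasitoric P q) {v : EuclideanSpace ℝ (Fin 2)}
    (hv : v ∈ P.extremePoints ℝ) {G H : Facet P} (hGH : G ≠ H) (hvG : v ∈ G.1) (hvH : v ∈ H.1)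
    {a b : Fin 2 → ℤ} (ha : IsCharVec q G a) (hb : IsCharVec q H b) :
    (a 0 * b 1 - a 1 * b 0) * (a 0 * b 1 - a 1 * b 0) = 1 := by
  obtain ⟨σ, hσ⟩ := hq.exists_section
  obtain ⟨ψ, δ, hy, hψ⟩ := hq.exists_chart (σ v)
  obtain ⟨A, B, hAB, hA⟩ := exists_matrix_of_torusAut δ
  have h0 : ψ (σ v) = 0 := funext fun i =>
    hq.chart_of_mem_extremePoints hψ hy (by rw [hσ.2 v hv.1]; exact hv) i
  have ht0 : (0 : Fin 2 → ℂ) ∈ ψ.target := h0 ▸ ψ.map_source hy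
  obtain ⟨ε, hε, hball⟩ := Metric.isOpen_iff.1 ψ.open_target 0 ht0
  -- Near the vertex an edge lies over a coordinate axis, and its direction is up to sign the row of
  -- `A` for the vanishing coordinate.
  have key : ∀ (K : Facet P), v ∈ K.1 → ∀ c, IsCharVec q K c → ∃ p ∈ K.1,
      p ∉ P.extremePoints ℝ ∧ σ p ∈ ψ.source ∧ ‖ψ (σ p)‖ < ε ∧ ∃ i j, i ≠ j ∧ ψ (σ p) i = 0 ∧
      ψ (σ p) j ≠ 0 ∧ (A i = c ∨ A i = -c) := by
    intro K hvK c hc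
    obtain ⟨p, hpK, hpe, hps, hpn⟩ := hq.exists_mem_facet_near hv hvK hσ hy h0 hε
    have hqp : (q (σ p) : EuclideanSpace ℝ (Fin 2)) = p := hσ.2 p (K.subset hpK)
    obtain ⟨i, j, hij, hi, hj⟩ := hq.chart_of_mem_facet hψ hps (by rwa [hqp]) (by rwa [hqp])
    refine ⟨p, hpK, hpe, hps, hpn, i, j, hij, hi, hj,
      eq_or_eq_neg_of_range_eq hc.1 (IsPrimitiveVec.of_mul_eq_one hAB i) ?_⟩
    ext t
    rw [← hψ.smul_eq_iff_mem_range hA hps hij hi hj t]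
    exact (hc.2 (σ p) (by rwa [hqp]) (by rwa [hqp]) t).symm
  obtain ⟨p, hpG, hpe, hps, hpn, i, j, hij, hi, hj, hia⟩ := key G hvG a ha
  obtain ⟨p', hpH, hpe', hps', hpn', i', j', hij', hi', hj', hib⟩ := key H hvH b hb
  by_cases hii : i = i'
  · exfalso
    subst hii
    have hjj : j' = j := by
      rcases Fin.eq_or_eq_of_ne_two hij j' with h | h
      · exact absurd h hij'.symm
      · exact h
    subst hjj
    -- If `G` and `H` belonged to the same axis, the image of its positive part in `P` would be a
    -- connected set of non-vertex boundary points meeting two different edges. The edges being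
    -- finitely many and closed, some non-vertex point would lie on two of them.
    let w : ℝ → Fin 2 → ℂ := fun r => Pi.single j' (r : ℂ)
    have hwt : ∀ r ∈ Set.Ioo 0 ε, w r ∈ ψ.target := by
      intro r hr
      apply hball
      rw [mem_ball_zero_iff, Pi.norm_single, Complex.norm_real, Real.norm_of_nonneg hr.1.le]
      exact hr.2
    have hwc : Continuous w :=
      (continuous_single (A := fun _ : Fin 2 => ℂ) j').comp Complex.continuous_ofReal
    let ξ : ℝ → EuclideanSpace ℝ (Fin 2) := fun r => q (ψ.symm (w r))
    have hξc : ContinuousOn ξ (Set.Ioo 0 ε) :=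
      (continuous_subtype_val.comp hq.isQuotientMap.continuous).comp_continuousOn
        (ψ.continuousOn_symm.comp hwc.continuousOn hwt)
    have hξ : ∀ r ∈ Set.Ioo 0 ε, ξ r ∉ P.extremePoints ℝ ∧ ∃ K : Facet P, ξ r ∈ K.1 := by
      intro r hr
      have hval : ∀ k, ψ (ψ.symm (w r)) k = w r k := fun k => by rw [ψ.right_inv (hwt r hr)]
      have hr0 : (r : ℂ) ≠ 0 := Complex.ofReal_ne_zero.2 hr.1.ne'
      rcases hq.chart_cases hψ (ψ.map_target (hwt r hr)) with h | h | h
      · have := h.1 i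
        rw [hval] at this
        exact absurd (Pi.single_eq_of_ne hij _) this
      · exact h.2
      · have := h.1 j'
        rw [hval] at this
        exact absurd ((Pi.single_eq_same (M := fun _ : Fin 2 => ℂ) j' (r : ℂ)).symm.trans this) hr0
    have hpr : ∀ p ∈ P, σ p ∈ ψ.source → ‖ψ (σ p)‖ < ε → ψ (σ p) i = 0 → ψ (σ p) j' ≠ 0 →
        p ∈ ξ '' Set.Ioo 0 ε := by
      intro p hp hs hn hi hj
      refine ⟨‖ψ (σ p) j'‖, ⟨norm_pos_iff.2 hj, (norm_le_pi_norm _ j').trans_lt hn⟩, ?_⟩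
      have hw : w ‖ψ (σ p) j'‖ = fun k => (‖ψ (σ p) k‖ : ℂ) := by
        funext k
        rcases Fin.eq_or_eq_of_ne_two hij k with rfl | rfl
        · simp only [w, Pi.single_eq_of_ne hij, hi, norm_zero, Complex.ofReal_zero]
        · simp only [w, Pi.single_eq_same]
      have := (hq.eq_iff _ _).2 (hψ.norm_mem hs).2
      simp only [ξ, hw, this, hσ.2 p hp]
    have hfin := finite_facet hq.simplePolytope
    have hpre := (isPreconnected_Ioo (a := (0 : ℝ)) (b := ε)).image ξ hξc
    have hcl : IsClosed (⋃ K : {K : Facet P // K ≠ G}, K.1.1) :=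
      isClosed_iUnion_of_finite fun K => (K.1.isCompact hq.simplePolytope).isClosed
    obtain ⟨z, hz, hzG, hzK⟩ := isPreconnected_closed_iff.1 hpre G.1 _
      (G.isCompact hq.simplePolytope).isClosed hcl (by
        rintro _ ⟨r, hr, rfl⟩
        obtain ⟨K, hK⟩ := (hξ r hr).2
        by_cases hKG : K = G
        · exact Or.inl (hKG ▸ hK)
        · exact Or.inr (Set.mem_iUnion.2 ⟨⟨K, hKG⟩, hK⟩))
      ⟨p, hpr p (G.subset hpG) hps hpn hi hj, hpG⟩
      ⟨p', hpr p' (H.subset hpH) hps' hpn' hi' hj', Set.mem_iUnion.2 ⟨⟨H, hGH.symm⟩, hpH⟩⟩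
    obtain ⟨K, hK⟩ := Set.mem_iUnion.1 hzK
    obtain ⟨r, hr, rfl⟩ := hz
    exact K.2 (Facet.eq_of_mem_of_notMem_extremePoints hq.simplePolytope (hξ r hr).1 hK hzG)
  · have hd := Matrix.minor_mul_self_eq_one hAB hii
    rcases hia with h1 | h1 <;> rcases hib with h2 | h2 <;> rw [h1, h2] at hd <;>
      try simp only [Pi.neg_apply] at hd
    all_goals linear_combination hd

end CharacteristicVectors

/-! ### Comparison with the models `M(P, η)`. -/

section Models

variable {M : Type*} [TopologicalSpace M] [MulAction (Torus 2) M]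
  {P : Set (EuclideanSpace ℝ (Fin 2))} {q : M → P}

theorem SignClass.circle_mk {n : ℕ} (v : Fin n → ℤ) :
    (SignClass.mk v).circle = (oneParam v).range := rfl

/-- The isotropy groups of a quasitoric manifold are those of its model. -/
theorem IsQuasitoric.smul_eq_iff_mem_isotropyTorus [T2Space M] [ContinuousSMul (Torus 2) M]
    (hq : IsQuasitoric P q) {η : Facet P → SignClass 2}
    (hη : ∀ G, ∃ v, IsCharVec q G v ∧ η G = SignClass.mk v) (x : M) (t : Torus 2) :
    t • x = x ↔ t ∈ isotropyTorus P η (q x) := by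
  choose lam hlam hmk using hη
  have hc : ∀ G, (η G).circle = (oneParam (lam G)).range := fun G => by rw [hmk]; rfl
  have hle : ∀ G : Facet P, (q x : EuclideanSpace ℝ (Fin 2)) ∈ G.1 →
      (oneParam (lam G)).range ≤ isotropyTorus P η (q x) := fun G hG => by
    rw [← hc]
    exact le_iSup (fun G : {G : Facet P // (q x : EuclideanSpace ℝ (Fin 2)) ∈ G.1} =>
      (η G.1).circle) ⟨G, hG⟩
  have hge : isotropyTorus P η (q x) ≤ MulAction.stabilizer (Torus 2) x := by
    refine iSup_le fun G => ?_
    rw [hc]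
    exact fun t ht => hq.smul_eq_of_mem_range (hlam G.1) G.2 ht
  refine ⟨fun ht => ?_, fun ht => hge ht⟩
  by_cases hext : (q x : EuclideanSpace ℝ (Fin 2)) ∈ P.extremePoints ℝ
  · obtain ⟨G, hG⟩ := exists_facet_of_mem_extremePoints hq.simplePolytope hext
    obtain ⟨H, hHG, hH, -⟩ := Facet.exists_neighbor hq.simplePolytope hext hG
    -- At a vertex the stabiliser is the whole torus, and so is the group generated by the two
    -- adjacent circles, whose directions form a basis.
    have htop := sup_range_oneParam_eq_top
      (hq.charVec_minor hext hHG.symm hG hH (hlam G) (hlam H)) rfl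
    exact sup_le (hle G hG) (hle H hH) (htop ▸ Subgroup.mem_top t)
  · rcases hq.mem_interior_or_facet (q x).2 with hi | ⟨G, hG⟩
    · rw [hq.eq_one_of_mem_interior hi ht]
      exact one_mem _
    · exact hle G hG (((hlam G).2 x hG hext t).1 ht)

instance {n : ℕ} (P : Set (EuclideanSpace ℝ (Fin n))) (η : Facet P → SignClass n)
    [CompactSpace P] : CompactSpace (ModelManifold P η) :=
  inferInstanceAs (CompactSpace (Quotient (modelSetoid P η)))

/-- With a global section `σ`, the map `(t, p) ↦ t • σ p` identifies exactly the pairs related in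
the model. The induced bijection goes from a compact space to a Hausdorff one, hence is a
homeomorphism. -/
theorem IsQuasitoric.isEquivariantlyHomeomorphicToModel [T2Space M] [ContinuousSMul (Torus 2) M]
    (hq : IsQuasitoric P q) {η : Facet P → SignClass 2}
    (hη : ∀ G, ∃ v, IsCharVec q G v ∧ η G = SignClass.mk v) :
    IsEquivariantlyHomeomorphicToModel P η q := by
  obtain ⟨σ, hσ⟩ := hq.exists_section
  have hqσ : ∀ p : P, q (σ p) = p := fun p => Subtype.ext (hσ.2 p p.2)
  have hst : ∀ (p : P) (t u : Torus 2), t • σ p = u • σ p ↔ t * u⁻¹ ∈ isotropyTorus P η p := by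
    intro p t u
    have := hq.smul_eq_iff_mem_isotropyTorus hη (σ p) (t * u⁻¹)
    rw [hqσ] at this
    rw [← this, mul_comm, mul_smul, inv_smul_eq_iff]
  have : CompactSpace P := isCompact_iff_compactSpace.1 hq.simplePolytope.isCompact
  let g : Torus 2 × P → M := fun a => a.1 • σ a.2
  have hgc : Continuous g :=
    continuous_fst.smul ((continuousOn_iff_continuous_domRestrict.1 hσ.1).comp continuous_snd)
  let f : ModelManifold P η → M := Quotient.lift (s := modelSetoid P η) g (by
    rintro ⟨t, p⟩ ⟨u, p'⟩ ⟨h, h'⟩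
    obtain rfl : p = p' := h
    exact (hst p t u).2 h')
  have hfc : Continuous f := hgc.quotient_lift _
  have hfb : Function.Bijective f := by
    constructor
    · intro x y
      induction x using Quotient.inductionOn with
      | h a =>
        induction y using Quotient.inductionOn with
        | h b =>
          intro hab
          have hab' : a.1 • σ a.2 = b.1 • σ b.2 := hab
          have h1 : a.2 = b.2 := by
            have := congrArg q hab'
            rwa [hq.smul_eq, hq.smul_eq, hqσ, hqσ] at this
          refine Quotient.sound (s := modelSetoid P η) ⟨h1, ?_⟩
          rw [h1] at hab' ⊢
          exact (hst b.2 a.1 b.1).1 hab'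
    · intro x
      obtain ⟨t, ht⟩ := (hq.eq_iff x (σ (q x))).1 (hqσ (q x)).symm
      exact ⟨Quotient.mk (modelSetoid P η) (t, q x), ht⟩
  let e : ModelManifold P η ≃ₜ M :=
    Continuous.homeoOfEquivCompactToT2 (f := Equiv.ofBijective f hfb) hfc
  have he : ∀ m, e m = f m := fun m => rfl
  refine ⟨e.symm, fun t x => ?_, fun x => ?_⟩
  · obtain ⟨m, rfl⟩ := e.surjective x
    rw [Homeomorph.symm_apply_apply, Homeomorph.symm_apply_eq, he, he]
    induction m using Quotient.inductionOn with
    | h a =>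
      change t • a.1 • σ a.2 = (t * a.1) • σ a.2
      rw [mul_smul]
  · obtain ⟨m, rfl⟩ := e.surjective x
    rw [Homeomorph.symm_apply_apply, he]
    induction m using Quotient.inductionOn with
    | h a =>
      change a.2 = q (a.1 • σ a.2)
      rw [hq.smul_eq, hqσ]

theorem IsEquivariantlyHomeomorphicToModel.smul_eq_iff {η : Facet P → SignClass 2}
    (h : IsEquivariantlyHomeomorphicToModel P η q) (x : M) (t : Torus 2) :
    t • x = x ↔ t ∈ isotropyTorus P η (q x) := by
  obtain ⟨f, hf, hproj⟩ := h
  rw [← f.injective.eq_iff, hf, ← hproj x]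
  generalize f x = m
  induction m using Quotient.inductionOn with
  | h a =>
    change Quotient.mk (modelSetoid P η) (t * a.1, a.2) = Quotient.mk (modelSetoid P η) a ↔
      t ∈ isotropyTorus P η a.2
    rw [Quotient.eq]
    change (a.2 = a.2 ∧ t * a.1 * a.1⁻¹ ∈ isotropyTorus P η a.2) ↔ _
    rw [mul_inv_cancel_right]
    simp

/-- A model of `M` has the same characteristic vectors as `M`. -/
theorem IsQuasitoric.eq_or_eq_neg_of_model (hq : IsQuasitoric P q)
    {η : Facet P → SignClass 2} (h : IsEquivariantlyHomeomorphicToModel P η q) {G : Facet P}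
    {v w : Fin 2 → ℤ} (hv : IsCharVec q G v) (hw : IsPrimitiveVec w) (hG : η G = SignClass.mk w) :
    w = v ∨ w = -v := by
  obtain ⟨p, hp, hpe⟩ := G.exists_mem_notMem_extremePoints hq.simplePolytope
  obtain ⟨x, hx⟩ := hq.isQuotientMap.surjective ⟨p, G.subset hp⟩
  have hqx : (q x : EuclideanSpace ℝ (Fin 2)) = p := by rw [hx]
  refine eq_or_eq_neg_of_range_eq hv.1 hw ?_
  have hiso : isotropyTorus P η (q x) = (oneParam w).range := by
    rw [← SignClass.circle_mk, ← hG]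
    refine le_antisymm (iSup_le fun H => ?_)
      (le_iSup (fun G : {G : Facet P // (q x : EuclideanSpace ℝ (Fin 2)) ∈ G.1} =>
        (η G.1).circle) ⟨G, by rwa [hqx]⟩)
    have hHG : H.1 = G := Facet.eq_of_mem_of_notMem_extremePoints hq.simplePolytope
      (by rwa [hqx]) H.2 (by rwa [hqx])
    rw [hHG]
  ext t
  rw [← hiso, ← h.smul_eq_iff, ← hv.2 x (by rwa [hqx]) (by rwa [hqx]) t]

end Models

/-! ### Existence and uniqueness of the matrix class over a triangle. -/

section TriangleClassification

variable {M : Type*} [TopologicalSpace M] [T2Space M] [MulAction (Torus 2) M]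
  [ContinuousSMul (Torus 2) M] {P : Set (EuclideanSpace ℝ (Fin 2))} {q : M → P}

theorem isPrimitiveVec_row (A : Matrix.SpecialLinearGroup (Fin 2) ℤ) (i : Fin 2) :
    IsPrimitiveVec (A.1 i) := by
  have h : A.1 * (A⁻¹).1 = 1 := by
    have := congrArg Subtype.val (mul_inv_cancel A)
    exact this
  exact IsPrimitiveVec.of_mul_eq_one h i

/-- Any two edges share a vertex, so the three directions have pairwise determinants `±1`. After
fixing signs the first two are the rows of a matrix in `SL(2, ℤ)` and the third is `±` their sum or
difference. -/
theorem IsQuasitoric.existsUnique_class (hq : IsQuasitoric P q)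
    (hcard : Nat.card (Facet P) = 3) (F : Fin 3 ≃ Facet P) : ∃! c : SLModSign,
      IsEquivariantlyHomeomorphicToModel P (etaPrime F c) q ∨
      IsEquivariantlyHomeomorphicToModel P (etaDoublePrime F c) q := by
  obtain ⟨a, ha⟩ := hq.exists_charVec (F 0)
  obtain ⟨b', hb'⟩ := hq.exists_charVec (F 1)
  obtain ⟨c, hc⟩ := hq.exists_charVec (F 2)
  have hminor : ∀ {i j : Fin 3}, i ≠ j → ∀ {v w}, IsCharVec q (F i) v → IsCharVec q (F j) w →
      v 0 * w 1 - v 1 * w 0 = 1 ∨ v 0 * w 1 - v 1 * w 0 = -1 := by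
    intro i j hij v w hv hw
    obtain ⟨p, hp, hpi, hpj⟩ := exists_common_vertex hq.simplePolytope hcard
      (F.injective.ne hij)
    exact Int.eq_one_or_neg_one_of_mul_eq_one
      (hq.charVec_minor hp (F.injective.ne hij) hpi hpj hv hw)
  obtain ⟨b, hb, hab⟩ : ∃ b, IsCharVec q (F 1) b ∧ a 0 * b 1 - a 1 * b 0 = 1 := by
    rcases hminor (by decide) ha hb' with h | h
    · exact ⟨b', hb', h⟩
    · refine ⟨-b', hb'.neg, ?_⟩
      simp only [Pi.neg_apply]
      linear_combination -h
  let A : Matrix.SpecialLinearGroup (Fin 2) ℤ := ⟨Matrix.of ![a, b], by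
    rw [Matrix.det_fin_two]
    simpa using hab⟩
  have hA0 : A.1 0 = a := rfl
  have hA1 : A.1 1 = b := rfl
  -- Cramer's rule in the basis `a, b`; the coefficients are determinants, hence `±1`.
  have hc0 : c 0 = (a 0 * c 1 - a 1 * c 0) * b 0 - (b 0 * c 1 - b 1 * c 0) * a 0 := by
    linear_combination (-c 0) * hab
  have hc1 : c 1 = (a 0 * c 1 - a 1 * c 0) * b 1 - (b 0 * c 1 - b 1 * c 0) * a 1 := by
    linear_combination (-c 1) * hab
  have hsum : (IsCharVec q (F 2) (a + b)) ∨ (IsCharVec q (F 2) (a - b)) := by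
    rcases hminor (by decide) ha hc with h1 | h1 <;> rcases hminor (by decide) hb hc with h2 | h2 <;>
      rw [h1, h2] at hc0 hc1
    · right
      have : a - b = -c := by
        funext k; fin_cases k <;> simp only [Pi.sub_apply, Pi.neg_apply] <;>
          [(change a 0 - b 0 = -c 0; linarith); (change a 1 - b 1 = -c 1; linarith)]
      rw [this]; exact hc.neg
    · left
      have : a + b = c := by
        funext k; fin_cases k <;> simp only [Pi.add_apply] <;>
          [(change a 0 + b 0 = c 0; linarith); (change a 1 + b 1 = c 1; linarith)]
      rw [this]; exact hc
    · left
      have : a + b = -c := by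
        funext k; fin_cases k <;> simp only [Pi.add_apply, Pi.neg_apply] <;>
          [(change a 0 + b 0 = -c 0; linarith); (change a 1 + b 1 = -c 1; linarith)]
      rw [this]; exact hc.neg
    · right
      have : a - b = c := by
        funext k; fin_cases k <;> simp only [Pi.sub_apply] <;>
          [(change a 0 - b 0 = c 0; linarith); (change a 1 - b 1 = c 1; linarith)]
      rw [this]; exact hc
  refine ⟨Quotient.mk slSetoid A, ?_, ?_⟩
  · rcases hsum with h | h
    · left
      refine hq.isEquivariantlyHomeomorphicToModel fun G => ?_
      obtain ⟨i, rfl⟩ := F.surjective G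
      have e : etaPrime F (Quotient.mk slSetoid A) (F i) = ![SignClass.mk (A.1 0),
        SignClass.mk (A.1 1), SignClass.mk (A.1 0 + A.1 1)] (F.symm (F i)) := rfl
      rw [F.symm_apply_apply] at e
      fin_cases i
      · exact ⟨a, ha, e⟩
      · exact ⟨b, hb, e⟩
      · exact ⟨a + b, h, e⟩
    · right
      refine hq.isEquivariantlyHomeomorphicToModel fun G => ?_
      obtain ⟨i, rfl⟩ := F.surjective G
      have e : etaDoublePrime F (Quotient.mk slSetoid A) (F i) = ![SignClass.mk (A.1 0),
        SignClass.mk (A.1 1), SignClass.mk (A.1 0 - A.1 1)] (F.symm (F i)) := rfl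
      rw [F.symm_apply_apply] at e
      fin_cases i
      · exact ⟨a, ha, e⟩
      · exact ⟨b, hb, e⟩
      · exact ⟨a - b, h, e⟩
  · intro C hC
    induction C using Quotient.inductionOn with
    | h A' =>
      have hrows : (A'.1 0 = a ∨ A'.1 0 = -a) ∧ (A'.1 1 = b ∨ A'.1 1 = -b) := by
        rcases hC with hC | hC
        · have e : ∀ i, etaPrime F (Quotient.mk slSetoid A') (F i) = ![SignClass.mk (A'.1 0),
            SignClass.mk (A'.1 1), SignClass.mk (A'.1 0 + A'.1 1)] i := fun i => by
            conv_rhs => rw [← F.symm_apply_apply i]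
            rfl
          exact ⟨hq.eq_or_eq_neg_of_model hC ha (isPrimitiveVec_row A' 0) (e 0),
            hq.eq_or_eq_neg_of_model hC hb (isPrimitiveVec_row A' 1) (e 1)⟩
        · have e : ∀ i, etaDoublePrime F (Quotient.mk slSetoid A') (F i) = ![SignClass.mk (A'.1 0),
            SignClass.mk (A'.1 1), SignClass.mk (A'.1 0 - A'.1 1)] i := fun i => by
            conv_rhs => rw [← F.symm_apply_apply i]
            rfl
          exact ⟨hq.eq_or_eq_neg_of_model hC ha (isPrimitiveVec_row A' 0) (e 0),
            hq.eq_or_eq_neg_of_model hC hb (isPrimitiveVec_row A' 1) (e 1)⟩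
      -- The isotropy circles fix each row up to sign; changing only one sign would make the
      -- determinant `-1`.
      have hdet : A'.1 0 0 * A'.1 1 1 - A'.1 0 1 * A'.1 1 0 = 1 := by
        have := A'.2
        rwa [Matrix.det_fin_two] at this
      apply Quotient.sound (s := slSetoid)
      obtain ⟨h0 | h0, h1 | h1⟩ := hrows
      · left
        refine Subtype.ext (funext fun i => ?_)
        fin_cases i
        · exact hA0.trans h0.symm
        · exact hA1.trans h1.symm
      · rw [h0, h1] at hdet
        simp only [Pi.neg_apply] at hdet
        exfalso; linarith
      · rw [h0, h1] at hdet
        simp only [Pi.neg_apply] at hdet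
        exfalso; linarith
      · right
        refine Subtype.ext (funext fun i => ?_)
        fin_cases i
        · change A.1 0 = -(A'.1 0)
          rw [h0, neg_neg, hA0]
        · change A.1 1 = -(A'.1 1)
          rw [h1, neg_neg, hA1]

end TriangleClassification

/-! ### Degrees of line families over `ℂP²` and of collapsed discs. -/

section ProjectivePlaneDegrees

theorem ComplexProjectiveSpace.eq_mk_of_proj_eq {n : ℕ} {x : ComplexProjectiveSpace n}
    {u : EuclideanSpace ℂ (Fin (n + 1))} (hu : u.ofLp ≠ 0) (h : x.proj u = u) :
    x = ComplexProjectiveSpace.mk ⟨u.ofLp, hu⟩ := by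
  obtain ⟨v, rfl⟩ := ComplexProjectiveSpace.mk_surjective x
  rw [ComplexProjectiveSpace.proj_mk] at h
  obtain ⟨c, hc⟩ := eq_smul_of_lineProj_eq h
  have hc' : u.ofLp = c • v.1 := by rw [hc]; rfl
  have hc0 : c ≠ 0 := by rintro rfl; exact hu (by rw [hc', zero_smul])
  rw [ComplexProjectiveSpace.mk_eq_mk_iff]
  exact ⟨c⁻¹, by change c⁻¹ • u.ofLp = v.1; rw [hc', smul_smul, inv_mul_cancel₀ hc0, one_smul]⟩

theorem ComplexProjectiveSpace.mk_smul {n : ℕ} {v : Fin (n + 1) → ℂ} (hv : v ≠ 0) {c : ℂ}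
    (hcv : c • v ≠ 0) :
    ComplexProjectiveSpace.mk ⟨c • v, hcv⟩ = ComplexProjectiveSpace.mk ⟨v, hv⟩ :=
  ComplexProjectiveSpace.mk_eq_mk_iff.2 ⟨c, rfl⟩

theorem continuous_circle_coe : Continuous ((↑) : Circle → ℂ) := continuous_subtype_val

variable {V : Type*} [NormedAddCommGroup V] [InnerProductSpace ℂ V]

/-- The family of lines `Φ` over `ℂP²`, pulled back to `ℂ³ ∖ {0}`, has a nowhere vanishing section
`Ψ` for which `z ↦ Ψ (z x) / Ψ x` has winding number `a`. -/
def HasLineDeg (Φ : ComplexProjectiveSpace 2 → V →L[ℂ] V) (a : ℤ) : Prop :=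
  ∃ Ψ : (Fin 3 → ℂ) → V, ContinuousOn Ψ {0}ᶜ ∧
    (∀ x (hx : x ≠ 0), Ψ x ≠ 0 ∧ Φ (ComplexProjectiveSpace.mk ⟨x, hx⟩) (Ψ x) = Ψ x) ∧
    (∀ r : ℝ, 0 < r → ∀ x, Ψ ((r : ℂ) • x) = Ψ x) ∧
    ∀ x, x ≠ 0 → HasDeg (fun z : Circle => lineRatio (Ψ x) (Ψ ((z : ℂ) • x))) a

/-- `ℂ³ ∖ {0}` is `((ℂ × ℂ) × ℝ) × ℝ` without the origin, so `exists_section_sphere` applies with `W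
= ℂ × ℂ`. -/
theorem exists_trivialization {Φ : ComplexProjectiveSpace 2 → V →L[ℂ] V} (hΦ : Continuous Φ)
    (hl : ∀ x, IsLineProj (Φ x)) :
    ∃ Ψ : (Fin 3 → ℂ) → V, ContinuousOn Ψ {0}ᶜ ∧
    (∀ x (hx : x ≠ 0), Ψ x ≠ 0 ∧ Φ (ComplexProjectiveSpace.mk ⟨x, hx⟩) (Ψ x) = Ψ x) ∧
    (∀ r : ℝ, 0 < r → ∀ x, Ψ ((r : ℂ) • x) = Ψ x) := by
  classical
  let f : ((ℂ × ℂ) × ℝ) × ℝ → Fin 3 → ℂ := fun y => ![y.1.1.1, y.1.1.2, y.1.2 + y.2 * Complex.I]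
  let e : (Fin 3 → ℂ) → ((ℂ × ℂ) × ℝ) × ℝ := fun x => (((x 0, x 1), (x 2).re), (x 2).im)
  have hfc : Continuous f := by
    refine continuous_pi fun i => ?_
    fin_cases i
    · exact (by fun_prop : Continuous fun y : ((ℂ × ℂ) × ℝ) × ℝ => y.1.1.1)
    · exact (by fun_prop : Continuous fun y : ((ℂ × ℂ) × ℝ) × ℝ => y.1.1.2)
    · exact (by fun_prop : Continuous fun y : ((ℂ × ℂ) × ℝ) × ℝ => (y.1.2 : ℂ) + y.2 * Complex.I)
  have hec : Continuous e := by fun_prop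
  have hfe : ∀ x, f (e x) = x := by
    intro x
    funext i
    fin_cases i
    · rfl
    · rfl
    · exact Complex.re_add_im (x 2)
  have hef : ∀ y, e (f y) = y := by
    rintro ⟨⟨⟨y1, y2⟩, y3⟩, y4⟩
    simp [e, f]
  have he0 : e 0 = 0 := by simp [e]
  have hf0 : ∀ y, y ≠ 0 → f y ≠ 0 := fun y hy h => hy (by rw [← hef y, h, he0])
  have hex0 : ∀ x, x ≠ 0 → e x ≠ 0 := fun x hx h => hx (by
    rw [← hfe x, h]
    funext i
    fin_cases i <;> simp [f])
  have hfs : ∀ (r : ℝ) y, f (r • y) = (r : ℂ) • f y := by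
    rintro r ⟨⟨⟨y1, y2⟩, y3⟩, y4⟩
    funext i
    fin_cases i
    · simp [f]
    · simp [f]
    · simp [f]; ring
  have hes : ∀ (r : ℝ) x, e ((r : ℂ) • x) = r • e x := by
    intro r x
    rw [← hfe x, ← hfs, hef, hef]
  let Q : ((ℂ × ℂ) × ℝ) × ℝ → V →L[ℂ] V := fun y =>
    if h : f y ≠ 0 then Φ (ComplexProjectiveSpace.mk ⟨f y, h⟩) else 0
  have hQ : ∀ y (h : f y ≠ 0), Q y = Φ (ComplexProjectiveSpace.mk ⟨f y, h⟩) := fun y h => dif_pos h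
  have hQc : ContinuousOn Q {0}ᶜ := by
    rw [continuousOn_iff_continuous_domRestrict]
    have : Continuous fun y : ({0}ᶜ : Set (((ℂ × ℂ) × ℝ) × ℝ)) =>
        Φ (ComplexProjectiveSpace.mk ⟨f y.1, hf0 y.1 y.2⟩) :=
      hΦ.comp (ComplexProjectiveSpace.continuous_mk.comp
        ((hfc.comp continuous_subtype_val).subtype_mk _))
    exact this.congr fun y => (hQ y.1 (hf0 y.1 y.2)).symm
  obtain ⟨v, hvc, hv, hvs⟩ := exists_section_sphere (W := ℂ × ℂ) (Q := Q) (by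
      rw [rank_prod', Complex.rank_real_complex]; norm_num) hQc
    (fun y hy => by rw [hQ y (hf0 y hy)]; exact hl _)
    (fun r hr y => by
      by_cases h : f y ≠ 0
      · have h' : f (r • y) ≠ 0 := by
          rw [hfs]; exact smul_ne_zero (Complex.ofReal_ne_zero.2 hr.ne') h
        rw [hQ _ h, hQ _ h']
        congr 1
        exact ComplexProjectiveSpace.mk_eq_mk_iff.2 ⟨r, (hfs r y).symm⟩
      · have h' : ¬ f (r • y) ≠ 0 := by
          rw [hfs]; push Not at h ⊢; rw [h, smul_zero]
        simp only [Q, dif_neg h, dif_neg h'])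
  refine ⟨fun x => v (e x), hvc.comp hec.continuousOn fun x hx => hex0 x hx, fun x hx => ?_,
    fun r hr x => ?_⟩
  · obtain ⟨h1, h2⟩ := hv (e x) (hex0 x hx)
    refine ⟨h1, ?_⟩
    rw [hQ _ (by rw [hfe]; exact hx)] at h2
    simpa only [hfe] using h2
  · beta_reduce
    rw [hes, hvs r hr]

/-- `Ψ (z x)` stays in the line over `[x]`, so its ratio to `Ψ x` is a loop in `ℂ ∖ {0}`. Its
winding number does not depend on `x` because `ℂ³ ∖ {0}` is path connected. -/
theorem exists_hasLineDeg {Φ : ComplexProjectiveSpace 2 → V →L[ℂ] V} (hΦ : Continuous Φ)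
    (hl : ∀ x, IsLineProj (Φ x)) : ∃ a, HasLineDeg Φ a := by
  obtain ⟨Ψ, hΨc, hΨ, hΨr⟩ := exists_trivialization hΦ hl
  have hz : ∀ (z : Circle) (x : Fin 3 → ℂ), x ≠ 0 → (z : ℂ) • x ≠ 0 := fun z x hx =>
    smul_ne_zero z.coe_ne_zero hx
  have hne : ∀ (z : Circle) (x : Fin 3 → ℂ), x ≠ 0 →
      lineRatio (Ψ x) (Ψ ((z : ℂ) • x)) ≠ 0 := fun z x hx => by
    refine (hl _).lineRatio_ne_zero (hΨ x hx).1 (hΨ _ (hz z x hx)).1 (hΨ x hx).2 ?_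
    have := (hΨ _ (hz z x hx)).2
    rwa [ComplexProjectiveSpace.mk_smul hx] at this
  have hpath : ∀ x y : Fin 3 → ℂ, x ≠ 0 → y ≠ 0 → ∀ a,
      HasDeg (fun z : Circle => lineRatio (Ψ x) (Ψ ((z : ℂ) • x))) a →
      HasDeg (fun z : Circle => lineRatio (Ψ y) (Ψ ((z : ℂ) • y))) a := by
    intro x y hx hy a ha
    have hr : 1 < Module.rank ℝ (Fin 3 → ℂ) := by
      rw [← Module.finrank_eq_rank, Module.finrank_pi_fintype]
      simp [Complex.finrank_real_complex]
    obtain ⟨γ, hγ⟩ := (isPathConnected_compl_singleton_of_one_lt_rank hr 0).joinedIn x hx y hy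
    have hγ0 : ∀ t, γ.extend t ≠ 0 := fun t => by
      have : γ.extend t ∈ Set.range γ := by
        rw [← γ.extend_range]; exact Set.mem_range_self t
      obtain ⟨s, hs⟩ := this
      rw [← hs]; exact hγ s
    have hγc : Continuous γ.extend := γ.continuous_extend
    have := HasDeg.of_homotopy (a := 0) (b := 1) (n := a)
      (κ := fun t z => lineRatio (Ψ (γ.extend t)) (Ψ ((z : ℂ) • γ.extend t))) (by
        rw [← continuousOn_univ]
        refine ContinuousOn.lineRatio (v := fun p : ℝ × Circle => Ψ (γ.extend p.1))
          (w := fun p : ℝ × Circle => Ψ ((p.2 : ℂ) • γ.extend p.1)) ?_ ?_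
          (fun p _ => (hΨ _ (hγ0 p.1)).1)
        · exact (hΨc.comp_continuous (hγc.comp continuous_fst) fun p => hγ0 p.1).continuousOn
        · refine (hΨc.comp_continuous ?_ fun p : ℝ × Circle => hz p.2 _ (hγ0 p.1)).continuousOn
          exact (continuous_circle_coe.comp continuous_snd).smul (hγc.comp continuous_fst))
      (fun t z => hne z _ (hγ0 t)) (by simpa using ha)
    simpa using this
  have hx0 : (fun _ : Fin 3 => (1 : ℂ)) ≠ 0 := fun h => one_ne_zero (congrFun h 0)
  obtain ⟨a, ha⟩ := exists_hasDeg
    (c := fun z : Circle => lineRatio (Ψ fun _ => 1) (Ψ ((z : ℂ) • fun _ => 1))) (by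
      rw [← continuousOn_univ]
      refine ContinuousOn.lineRatio (v := fun _ : Circle => Ψ fun _ => 1)
        (w := fun z : Circle => Ψ ((z : ℂ) • fun _ => 1)) continuousOn_const ?_
        (fun p _ => (hΨ _ hx0).1)
      refine (hΨc.comp_continuous ?_ fun p => hz p _ hx0).continuousOn
      exact continuous_circle_coe.smul continuous_const) (fun z => hne z _ hx0)
  exact ⟨a, Ψ, hΨc, hΨ, hΨr, fun x hx => hpath _ x hx0 hx a ha⟩

theorem Circle.coe_mem_closedBall (z : Circle) : (z : ℂ) ∈ Metric.closedBall (0 : ℂ) 1 :=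
  mem_closedBall_zero_iff.2 z.norm_coe.le

/-- A disc in `ℂP²` with boundary collapsed to a point has a degree `d`: line families of degree
`a` over `ℂP²` restrict to families of degree `a * d`. -/
theorem exists_discDeg {g : ℂ → ComplexProjectiveSpace 2}
    (hg : ContinuousOn g (Metric.closedBall 0 1)) (hb : ∀ z : Circle, g z = g 1) :
    ∃ d : ℤ, ∀ (Φ : ComplexProjectiveSpace 2 → V →L[ℂ] V) (a : ℤ), (∀ x, IsLineProj (Φ x)) →
      HasLineDeg Φ a → ∀ (S : ℂ → V) (s : Circle → ℂ) (S₀ : V),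
      ContinuousOn S (Metric.closedBall 0 1) →
      (∀ ζ ∈ Metric.closedBall (0 : ℂ) 1, S ζ ≠ 0 ∧ Φ (g ζ) (S ζ) = S ζ) →
      (∀ z : Circle, S z = s z • S₀) → HasDeg s (a * d) := by
  -- `u` lifts the disc to `ℂ³ ∖ {0}`. On the boundary the lift stays in one line, and `d` is its
  -- winding number there.
  obtain ⟨u, huc, hu⟩ := exists_section_closedBall (Q := fun ζ => (g ζ).proj)
    (ComplexProjectiveSpace.continuous_proj.comp_continuousOn hg)
    (fun ζ _ => (g ζ).isLineProj_proj)
  have hu0 : ∀ ζ ∈ Metric.closedBall (0 : ℂ) 1, (u ζ).ofLp ≠ 0 := fun ζ hζ h =>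
    (hu ζ hζ).1 (by
      have := congrArg (WithLp.toLp 2) h
      simpa using this)
  have h1m : (1 : ℂ) ∈ Metric.closedBall (0 : ℂ) 1 := by simp
  have hcoe := Circle.coe_mem_closedBall
  let c : Circle → ℂ := fun z => lineRatio (u 1) (u z)
  have hcc : Continuous c := by
    rw [← continuousOn_univ]
    refine ContinuousOn.lineRatio (v := fun _ : Circle => u 1) (w := fun z : Circle => u z)
      continuousOn_const ?_ (fun _ _ => (hu 1 h1m).1)
    exact (huc.comp_continuous continuous_circle_coe hcoe).continuousOn
  have hfix : ∀ z : Circle, (g 1).proj (u z) = u z := fun z => by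
    have := (hu z (hcoe z)).2
    rwa [hb] at this
  have hcu : ∀ z : Circle, u z = c z • u 1 := fun z =>
    (g 1).isLineProj_proj.eq_lineRatio_smul (hu 1 h1m).1 (hu 1 h1m).2 (hfix z)
  have hc0 : ∀ z, c z ≠ 0 := fun z =>
    (g 1).isLineProj_proj.lineRatio_ne_zero (hu 1 h1m).1 (hu z (hcoe z)).1 (hu 1 h1m).2 (hfix z)
  -- Since `Ψ` ignores positive factors, only the phase of `c` matters.
  let c' : Circle → Circle := fun z => ⟨c z / ‖c z‖, by
    refine mem_sphere_zero_iff_norm.2 ?_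
    rw [norm_div, Complex.norm_real, norm_norm,
      div_self (norm_ne_zero_iff.2 (hc0 z))]⟩
  have hc'c : Continuous c' := by
    refine Continuous.subtype_mk ?_ _
    exact hcc.div (Complex.continuous_ofReal.comp hcc.norm)
      fun z => Complex.ofReal_ne_zero.2 (norm_ne_zero_iff.2 (hc0 z))
  have hc' : ∀ z, c z = (‖c z‖ : ℂ) * (c' z : ℂ) := fun z => by
    have h : (‖c z‖ : ℂ) ≠ 0 := Complex.ofReal_ne_zero.2 (norm_ne_zero_iff.2 (hc0 z))
    change c z = (‖c z‖ : ℂ) * (c z / ‖c z‖)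
    field_simp
  obtain ⟨d, hd⟩ := exists_hasDeg (c := fun z => (c' z : ℂ)) (by fun_prop)
    (fun z => (c' z).coe_ne_zero)
  refine ⟨d, ?_⟩
  rintro Φ a hl ⟨Ψ, hΨc, hΨ, hΨr, hΨd⟩ S s S₀ hSc hS hSs
  have hΨu : ∀ ζ ∈ Metric.closedBall (0 : ℂ) 1, Ψ (u ζ).ofLp ≠ 0 ∧
      Φ (g ζ) (Ψ (u ζ).ofLp) = Ψ (u ζ).ofLp := fun ζ hζ => by
    have h := hΨ _ (hu0 ζ hζ)
    rwa [← ComplexProjectiveSpace.eq_mk_of_proj_eq (hu0 ζ hζ) (hu ζ hζ).2] at h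
  -- `S` is compared with the pulled-back section `Ψ ∘ u`. The ratio `k` extends over the disc and
  -- has degree `0`, while on the boundary `Ψ ∘ u` winds like the degree-`a` loop `κ` composed with
  -- the degree-`d` loop `c'`.
  let k : ℂ → ℂ := fun ζ => lineRatio (Ψ (u ζ).ofLp) (S ζ)
  have hkc : ContinuousOn k (Metric.closedBall 0 1) := by
    refine ContinuousOn.lineRatio ?_ hSc (fun ζ hζ => (hΨu ζ hζ).1)
    exact hΨc.comp ((PiLp.continuous_ofLp 2 _).comp_continuousOn huc) hu0
  have hk0 : ∀ ζ ∈ Metric.closedBall (0 : ℂ) 1, k ζ ≠ 0 := fun ζ hζ =>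
    (hl _).lineRatio_ne_zero (hΨu ζ hζ).1 (hS ζ hζ).1 (hΨu ζ hζ).2 (hS ζ hζ).2
  have hkS : ∀ ζ ∈ Metric.closedBall (0 : ℂ) 1, S ζ = k ζ • Ψ (u ζ).ofLp := fun ζ hζ =>
    (hl _).eq_lineRatio_smul (hΨu ζ hζ).1 (hΨu ζ hζ).2 (hS ζ hζ).2
  have hkd : HasDeg (fun z => k z) 0 := by
    have := hasDeg_zero_of_extends (k := fun ζ => k (ballRetract ζ))
      (hkc.comp_continuous continuous_ballRetract ballRetract_mem)
      (fun ζ => hk0 _ (ballRetract_mem ζ))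
    exact this.congr fun z => by rw [ballRetract_of_mem (hcoe z)]
  let κ : Circle → ℂ := fun z => lineRatio (Ψ (u 1).ofLp) (Ψ ((z : ℂ) • (u 1).ofLp))
  have hκd : HasDeg (fun z => κ (c' z)) (a * d) := HasDeg.comp hc'c hd (hΨd _ (hu0 1 h1m))
  have hκ : ∀ z : Circle, Ψ ((z : ℂ) • (u 1).ofLp) = κ z • Ψ (u 1).ofLp := fun z => by
    have hz0 : (z : ℂ) • (u 1).ofLp ≠ 0 := smul_ne_zero z.coe_ne_zero (hu0 1 h1m)
    refine (hl _).eq_lineRatio_smul (hΨ _ (hu0 1 h1m)).1 (hΨ _ (hu0 1 h1m)).2 ?_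
    have := (hΨ _ hz0).2
    rwa [ComplexProjectiveSpace.mk_smul (hu0 1 h1m)] at this
  have hΨz : ∀ z : Circle, Ψ (u z).ofLp = κ (c' z) • Ψ (u 1).ofLp := fun z => by
    have : (u z).ofLp = ((‖c z‖ : ℝ) : ℂ) • ((c' z : ℂ) • (u 1).ofLp) := by
      rw [smul_smul, ← hc', hcu z]
      rfl
    rw [this, hΨr _ (norm_pos_iff.2 (hc0 z)), hκ]
  have hS₀ : S₀ ≠ 0 := by
    rintro rfl
    have := hSs 1
    rw [smul_zero] at this
    exact (hS _ (hcoe 1)).1 this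
  have hmain : ∀ z : Circle, s z • S₀ = (k z * κ (c' z)) • Ψ (u 1).ofLp := fun z => by
    rw [← hSs, hkS z (hcoe z), hΨz, smul_smul]
  let b : ℂ := lineRatio S₀ (Ψ (u 1).ofLp)
  have hs1 : s 1 ≠ 0 := by
    intro h
    have := hSs 1
    rw [h, zero_smul] at this
    exact (hS _ (hcoe 1)).1 this
  have hprop : Ψ (u 1).ofLp = b • S₀ := by
    have hm := hmain 1
    have hne : k (1 : Circle) * κ (c' 1) ≠ 0 := by
      intro h
      rw [h, zero_smul] at hm
      exact smul_ne_zero hs1 hS₀ hm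
    have e : Ψ (u 1).ofLp = ((k (1 : Circle) * κ (c' 1))⁻¹ * s 1) • S₀ := by
      rw [mul_smul, hm, smul_smul, inv_mul_cancel₀ hne, one_smul]
    have hb' : b = (k (1 : Circle) * κ (c' 1))⁻¹ * s 1 := by
      simp only [b]
      conv_lhs => rw [e]
      exact lineRatio_smul_self hS₀ _
    rw [hb']; exact e
  have hb0 : b ≠ 0 := by
    intro h
    rw [h, zero_smul] at hprop
    exact (hΨu 1 h1m).1 hprop
  have hsz : ∀ z, s z = k z * κ (c' z) * b := fun z => by
    have := hmain z
    rw [hprop, smul_smul] at this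
    exact smul_left_injective ℂ hS₀ this
  have := (hkd.mul hκd).mul (hasDeg_const hb0)
  rw [zero_add, add_zero] at this
  exact this.congr hsz

end ProjectivePlaneDegrees

/-! ### The line bundle attached to an edge. -/

section FacetLineFamilies

/-- `χ` is `a` rotated by a right angle, with sign corrected by the determinant. -/
theorem exists_dual_of_minor {a b : Fin 2 → ℤ}
    (h : (a 0 * b 1 - a 1 * b 0) * (a 0 * b 1 - a 1 * b 0) = 1) :
    ∃ χ : Fin 2 → ℤ, a ⬝ᵥ χ = 0 ∧ b ⬝ᵥ χ = 1 := by
  refine ⟨![-((a 0 * b 1 - a 1 * b 0) * a 1), (a 0 * b 1 - a 1 * b 0) * a 0], ?_, ?_⟩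
  · simp only [dotProduct, Fin.sum_univ_two, Matrix.cons_val_zero, Matrix.cons_val_one]
    ring
  · simp only [dotProduct, Fin.sum_univ_two, Matrix.cons_val_zero, Matrix.cons_val_one]
    linear_combination h

theorem Facet.exists_eq_segment_left {P : Set (EuclideanSpace ℝ (Fin 2))} (hP : IsSimplePolytope P)
    {F : Facet P} {v : EuclideanSpace ℝ (Fin 2)} (hv : v ∈ P.extremePoints ℝ) (hvF : v ∈ F.1) :
    ∃ w ∈ P.extremePoints ℝ, v ≠ w ∧ F.1 = segment ℝ v w := by
  obtain ⟨a, b, hab, hF, ha, hb⟩ := F.exists_eq_segment hP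
  rw [hF] at hvF
  rcases eq_or_eq_of_mem_segment_of_mem_extremePoints ha.1 hb.1 hv hvF with rfl | rfl
  · exact ⟨b, hb, hab, hF⟩
  · exact ⟨a, ha, hab.symm, by rw [hF, segment_symm]⟩

/-- The union of the facets other than `F` and `G`. -/
def otherFacets {P : Set (EuclideanSpace ℝ (Fin 2))} (F G : Facet P) :
    Set (EuclideanSpace ℝ (Fin 2)) := ⋃ K : {K : Facet P // K ≠ F ∧ K ≠ G}, K.1.1

theorem mem_otherFacets {P : Set (EuclideanSpace ℝ (Fin 2))} {F G : Facet P}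
    {p : EuclideanSpace ℝ (Fin 2)} : p ∈ otherFacets F G ↔ ∃ K, K ≠ F ∧ K ≠ G ∧ p ∈ K.1 := by
  simp [otherFacets, and_assoc]

theorem isClosed_otherFacets {P : Set (EuclideanSpace ℝ (Fin 2))} (hP : IsSimplePolytope P)
    (F G : Facet P) : IsClosed (otherFacets F G) := by
  have := finite_facet hP
  exact isClosed_iUnion_of_finite fun K => (K.1.isCompact hP).isClosed

/-- A vector of `ℂ³` depending on a torus element through two characters. -/
noncomputable def torusVec (r : Fin 3 → ℝ) (χa χb : Fin 2 → ℤ) (t : Torus 2) :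
    EuclideanSpace ℂ (Fin 3) :=
  WithLp.toLp 2 ![(r 0 : ℂ), (torusChar χa t : ℂ) * r 1, (torusChar χb t : ℂ) * r 2]

theorem continuous_torusVec {X : Type*} [TopologicalSpace X] {r : X → Fin 3 → ℝ} {t : X → Torus 2}
    (χa χb : Fin 2 → ℤ) (hr : Continuous r) (ht : Continuous t) :
    Continuous fun x => torusVec (r x) χa χb (t x) := by
  refine (PiLp.continuous_toLp 2 _).comp (continuous_pi fun i => ?_)
  have h : ∀ χ : Fin 2 → ℤ, Continuous fun x => (torusChar χ (t x) : ℂ) := fun χ =>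
    continuous_circle_coe.comp ((continuous_torusChar χ).comp ht)
  have hr' : ∀ i, Continuous fun x => (r x i : ℂ) := fun i =>
    Complex.continuous_ofReal.comp ((continuous_apply i).comp hr)
  fin_cases i
  · exact hr' 0
  · exact (h χa).mul (hr' 1)
  · exact (h χb).mul (hr' 2)

theorem torusVec_ne_zero {r : Fin 3 → ℝ} (hr : r ≠ 0) (χa χb : Fin 2 → ℤ) (t : Torus 2) :
    torusVec r χa χb t ≠ 0 := by
  intro h
  apply hr
  have h' : ∀ i, (torusVec r χa χb t).ofLp i = 0 := fun i => by rw [h]; rfl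
  funext i
  fin_cases i
  · exact Complex.ofReal_eq_zero.1 (h' 0)
  · exact Complex.ofReal_eq_zero.1
      ((mul_eq_zero.1 (h' 1)).resolve_left (Circle.coe_ne_zero _))
  · exact Complex.ofReal_eq_zero.1
      ((mul_eq_zero.1 (h' 2)).resolve_left (Circle.coe_ne_zero _))

theorem torusVec_mul {r : Fin 3 → ℝ} {χa χb : Fin 2 → ℤ} {s : Torus 2} (t : Torus 2)
    (ha : r 1 = 0 ∨ torusChar χa s = 1) (hb : r 2 = 0 ∨ torusChar χb s = 1) :
    torusVec r χa χb (t * s) = torusVec r χa χb t := by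
  unfold torusVec
  congr 3
  · rcases ha with h | h <;> simp [h]
  · congr 1
    rcases hb with h | h <;> simp [h]

theorem torusVec_mul_eq_smul {r : Fin 3 → ℝ} {χa χb : Fin 2 → ℤ} {s : Torus 2} {z : Circle}
    (t : Torus 2) (h0 : r 0 = 0) (ha : torusChar χa s = z) (hb : torusChar χb s = z) :
    torusVec r χa χb (t * s) = (z : ℂ) • torusVec r χa χb t := by
  unfold torusVec
  rw [← WithLp.toLp_smul]
  congr 1
  funext i
  fin_cases i
  · simp [h0]
  · simp [ha]; ring
  · simp [hb]; ring

variable {M : Type*} [TopologicalSpace M] [T2Space M] [MulAction (Torus 2) M]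
  [ContinuousSMul (Torus 2) M] {P : Set (EuclideanSpace ℝ (Fin 2))} {q : M → P}
  {σ : EuclideanSpace ℝ (Fin 2) → M}

omit [T2Space M] [ContinuousSMul (Torus 2) M] in
theorem IsQuasitoric.exists_smul_section (hq : IsQuasitoric P q) (hσ : IsSectionOn q σ P) (x : M) :
    ∃ t : Torus 2, t • σ (q x) = x := by
  have h : q x = q (σ (q x)) := Subtype.ext (hσ.2 _ (q x).2).symm
  exact (hq.eq_iff _ _).1 h

theorem IsQuasitoric.isQuotientMap_smul_section (hq : IsQuasitoric P q) (hσ : IsSectionOn q σ P) :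
    Topology.IsQuotientMap fun a : Torus 2 × P => a.1 • σ a.2 := by
  have : CompactSpace P := isCompact_iff_compactSpace.1 hq.simplePolytope.isCompact
  have hc : Continuous fun a : Torus 2 × P => a.1 • σ a.2 :=
    continuous_fst.smul ((continuousOn_iff_continuous_domRestrict.1 hσ.1).comp continuous_snd)
  refine hc.isClosedMap.isQuotientMap hc fun x => ?_
  obtain ⟨t, ht⟩ := hq.exists_smul_section hσ x
  exact ⟨(t, q x), ht⟩

/-- Families over a quasitoric manifold are given by invariant families over `𝕋² × P`. -/
theorem IsQuasitoric.exists_descent {Y : Type*} [TopologicalSpace Y] (hq : IsQuasitoric P q)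
    (hσ : IsSectionOn q σ P) {lam : Facet P → Fin 2 → ℤ} (hlam : ∀ G, IsCharVec q G (lam G))
    {Θ : Torus 2 → EuclideanSpace ℝ (Fin 2) → Y}
    (hΘ : Continuous fun a : Torus 2 × P => Θ a.1 a.2)
    (hinv : ∀ (K : Facet P), ∀ p ∈ K.1, ∀ (z : Circle) (t : Torus 2),
      Θ (t * oneParam (lam K) z) p = Θ t p) :
    ∃ Φ : M → Y, Continuous Φ ∧ ∀ p ∈ P, ∀ t : Torus 2, Φ (t • σ p) = Θ t p := by
  have hiso : ∀ p : P, ∀ s ∈ isotropyTorus P (fun G => SignClass.mk (lam G)) p, ∀ t,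
      Θ (t * s) p = Θ t p := by
    intro p s hs
    refine Subgroup.iSup_induction _ (C := fun s => ∀ t, Θ (t * s) p = Θ t p) hs
      (fun K s hs t => ?_) (fun t => by rw [mul_one]) (fun s s' h h' t => ?_)
    · obtain ⟨z, rfl⟩ := hs
      exact hinv K.1 p K.2 z t
    · rw [← mul_assoc, h', h]
  -- `τ` is chosen without continuity: by invariance of `Θ` the choice does not matter, and
  -- continuity comes from the quotient map.
  choose τ hτ using hq.exists_smul_section hσ
  have hkey : ∀ p ∈ P, ∀ t : Torus 2, Θ (τ (t • σ p)) (q (t • σ p)) = Θ t p := by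
    intro p hp t
    have hqp : (q (t • σ p) : EuclideanSpace ℝ (Fin 2)) = p := by rw [hq.smul_eq, hσ.2 p hp]
    have h1 := hτ (t • σ p)
    rw [hqp] at h1 ⊢
    have h2 : (t⁻¹ * τ (t • σ p)) • σ p = σ p := by rw [mul_smul, h1, inv_smul_smul]
    rw [hq.smul_eq_iff_mem_isotropyTorus (η := fun G => SignClass.mk (lam G))
      (fun G => ⟨lam G, hlam G, rfl⟩)] at h2
    have e : q (σ p) = ⟨p, hp⟩ := Subtype.ext (hσ.2 p hp)
    rw [e] at h2
    have := hiso ⟨p, hp⟩ _ h2 t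
    rwa [mul_inv_cancel_left] at this
  refine ⟨fun x => Θ (τ x) (q x), ?_, hkey⟩
  rw [(hq.isQuotientMap_smul_section hσ).continuous_iff]
  exact hΘ.congr fun a => (hkey a.2 a.2.2 a.1).symm

/-- The line bundle of a facet `F`, seen as a family of lines in `ℂ³`, with its explicit form over
a facet `G` adjacent to `F` and over the facets disjoint from `F`. -/
theorem IsQuasitoric.exists_lineFamily (hq : IsQuasitoric P q) (hσ : IsSectionOn q σ P)
    {lam : Facet P → Fin 2 → ℤ} (hlam : ∀ G, IsCharVec q G (lam G)) {F G : Facet P}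
    {v : EuclideanSpace ℝ (Fin 2)} (hv : v ∈ P.extremePoints ℝ) (hGF : G ≠ F) (hvF : v ∈ F.1)
    (hvG : v ∈ G.1) :
    ∃ (Φ : M → EuclideanSpace ℂ (Fin 3) →L[ℂ] EuclideanSpace ℂ (Fin 3))
      (r₀ r₁ : EuclideanSpace ℝ (Fin 2) → ℝ) (χ : Fin 2 → ℤ),
      Continuous Φ ∧ (∀ x, IsLineProj (Φ x)) ∧ Continuous r₀ ∧ Continuous r₁ ∧ r₀ v = 0 ∧
      (∀ p ∈ G.1, r₀ p ≠ 0 ∨ r₁ p ≠ 0) ∧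
      (∀ p ∈ G.1, p ∈ P.extremePoints ℝ → p ≠ v → r₁ p = 0) ∧
      lam G ⬝ᵥ χ = 0 ∧ lam F ⬝ᵥ χ = 1 ∧
      (∀ p ∈ G.1, ∀ t : Torus 2, Φ (t • σ p) =
        lineProj (WithLp.toLp 2 ![(r₀ p : ℂ), (torusChar χ t : ℂ) * r₁ p, 0])) ∧
      ∀ K : Facet P, Disjoint F.1 K.1 → ∀ p ∈ K.1, ∀ t : Torus 2,
        Φ (t • σ p) = lineProj (WithLp.toLp 2 ![1, 0, 0]) := by
  have hP := hq.simplePolytope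
  obtain ⟨w, hw, hvw, hF⟩ := F.exists_eq_segment_left hP hv hvF
  have hwF : w ∈ F.1 := hF ▸ right_mem_segment ℝ v w
  obtain ⟨H, hHF, hwH, hwK⟩ := Facet.exists_neighbor hP hw hwF
  obtain ⟨G', hG'F, hvG', hvK⟩ := Facet.exists_neighbor hP hv hvF
  obtain rfl : G = G' := (hvK G hvG).resolve_left hGF
  have hGH : G ≠ H := by
    rintro rfl
    exact hGF (Facet.eq_of_mem_mem hP hv hw hvw hvG hwH hvF hwF)
  -- Both characters restrict to the identity on the circle of `F`; `χa` is trivial on that of `G`,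
  -- and `χb` on that of the other neighbour `H`.
  obtain ⟨χa, hχaG, hχaF⟩ := exists_dual_of_minor
    (hq.charVec_minor hv hGF hvG hvF (hlam G) (hlam F))
  obtain ⟨χb, hχbH, hχbF⟩ := exists_dual_of_minor
    (hq.charVec_minor hw hHF hwH hwF (hlam H) (hlam F))
  -- Distance functions serve as coefficients: the first vanishes exactly on `F`, the second exactly
  -- on the edges other than `F, G`, the third exactly on those other than `F, H`. They have no
  -- common zero.
  let r : EuclideanSpace ℝ (Fin 2) → Fin 3 → ℝ := fun p =>
    ![Metric.infDist p F.1, Metric.infDist p (otherFacets F G), Metric.infDist p (otherFacets F H)]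
  have hrc : Continuous r := by
    refine continuous_pi fun i => ?_
    fin_cases i
    · exact Metric.continuous_infDist_pt _
    · exact Metric.continuous_infDist_pt _
    · exact Metric.continuous_infDist_pt _
  have hr0 : ∀ p, r p 0 = 0 ↔ p ∈ F.1 := fun p =>
    ((F.isCompact hP).isClosed.mem_iff_infDist_zero ⟨v, hvF⟩).symm
  have hr1 : ∀ p, r p 1 = 0 ↔ p ∈ otherFacets F G := fun p =>
    ((isClosed_otherFacets hP F G).mem_iff_infDist_zero
      ⟨w, mem_otherFacets.2 ⟨H, hHF, hGH.symm, hwH⟩⟩).symm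
  have hr2 : ∀ p, r p 2 = 0 ↔ p ∈ otherFacets F H := fun p =>
    ((isClosed_otherFacets hP F H).mem_iff_infDist_zero
      ⟨v, mem_otherFacets.2 ⟨G, hGF, hGH, hvG⟩⟩).symm
  have hvertex : ∀ p ∈ F.1, ∀ K : Facet P, p ∈ K.1 → K ≠ F →
      (p = v ∧ K = G) ∨ (p = w ∧ K = H) := by
    intro p hpF K hpK hKF
    have hpe : p ∈ P.extremePoints ℝ := by
      by_contra h
      exact hKF (Facet.eq_of_mem_of_notMem_extremePoints hP h hpK hpF)
    rw [hF] at hpF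
    rcases eq_or_eq_of_mem_segment_of_mem_extremePoints hv.1 hw.1 hpe hpF with rfl | rfl
    · exact Or.inl ⟨rfl, (hvK K hpK).resolve_left hKF⟩
    · exact Or.inr ⟨rfl, (hwK K hpK).resolve_left hKF⟩
  have hr : ∀ p, r p ≠ 0 := by
    intro p h
    have hpF := (hr0 p).1 (congrFun h 0)
    obtain ⟨K, hKF, hKG, hpK⟩ := mem_otherFacets.1 ((hr1 p).1 (congrFun h 1))
    obtain ⟨K', hKF', hKH', hpK'⟩ := mem_otherFacets.1 ((hr2 p).1 (congrFun h 2))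
    rcases hvertex p hpF K hpK hKF with ⟨-, h1⟩ | ⟨h1, -⟩
    · exact hKG h1
    · rcases hvertex p hpF K' hpK' hKF' with ⟨h2, -⟩ | ⟨-, h2⟩
      · exact hvw (h2.symm.trans h1)
      · exact hKH' h2
  -- Over `F` the first coordinate vanishes and the circle multiplies the vector by a unit scalar.
  -- Over any other edge each remaining coordinate has a trivial character or a zero coefficient.
  have hinv : ∀ (K : Facet P), ∀ p ∈ K.1, ∀ (z : Circle) (t : Torus 2),
      lineProj (torusVec (r p) χa χb (t * oneParam (lam K) z)) =
        lineProj (torusVec (r p) χa χb t) := by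
    intro K p hpK z t
    by_cases hKF : K = F
    · subst hKF
      rw [torusVec_mul_eq_smul (z := z) t ((hr0 p).2 hpK)
        (by rw [torusChar_oneParam, hχaF, zpow_one]) (by rw [torusChar_oneParam, hχbF, zpow_one]),
        lineProj_smul z.coe_ne_zero]
    · rw [torusVec_mul t]
      · by_cases hKG : K = G
        · right; rw [hKG, torusChar_oneParam, hχaG, zpow_zero]
        · left; exact (hr1 p).2 (mem_otherFacets.2 ⟨K, hKF, hKG, hpK⟩)
      · by_cases hKH : K = H
        · right; rw [hKH, torusChar_oneParam, hχbH, zpow_zero]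
        · left; exact (hr2 p).2 (mem_otherFacets.2 ⟨K, hKF, hKH, hpK⟩)
  obtain ⟨Φ, hΦ, hΦe⟩ := hq.exists_descent hσ hlam
    (Θ := fun t p => lineProj (torusVec (r p) χa χb t))
    (continuousOn_lineProj.comp_continuous
      (continuous_torusVec χa χb (hrc.comp (continuous_subtype_val.comp continuous_snd))
        continuous_fst) fun a => torusVec_ne_zero (hr a.2) χa χb a.1) hinv
  have hG2 : ∀ p ∈ G.1, r p 2 = 0 := fun p hp =>
    (hr2 p).2 (mem_otherFacets.2 ⟨G, hGF, hGH, hp⟩)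
  refine ⟨Φ, fun p => r p 0, fun p => r p 1, χa, hΦ, fun x => ?_, (continuous_apply 0).comp hrc,
    (continuous_apply 1).comp hrc, (hr0 v).2 hvF, fun p hp => ?_, fun p hp hpe hpv => ?_, hχaG,
    hχaF, fun p hp t => ?_, fun K hK p hp t => ?_⟩
  · obtain ⟨t, ht⟩ := hq.exists_smul_section hσ x
    refine ⟨torusVec (r (q x)) χa χb t, torusVec_ne_zero (hr _) χa χb t, ?_⟩
    rw [← hΦe _ (q x).2, ht]
  · by_contra! h
    exact hr p (funext fun i => by fin_cases i; exacts [h.1, h.2, hG2 p hp])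
  · obtain ⟨K, hKG, hpK, -⟩ := Facet.exists_neighbor hP hpe hp
    refine (hr1 p).2 (mem_otherFacets.2 ⟨K, ?_, hKG, hpK⟩)
    rintro rfl
    exact hGF (Facet.eq_of_mem_mem hP hpe hv hpv hp hvG hpK hvF)
  · rw [hΦe p (G.subset hp), torusVec, hG2 p hp, Complex.ofReal_zero, mul_zero]
  · have hKF : K ≠ F := by
      rintro rfl
      exact Set.disjoint_left.1 hK hp hp
    have h1 : r p 1 = 0 := (hr1 p).2 (mem_otherFacets.2 ⟨K, hKF, by
      rintro rfl
      exact Set.disjoint_left.1 hK hvF hvG, hp⟩)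
    have h2 : r p 2 = 0 := (hr2 p).2 (mem_otherFacets.2 ⟨K, hKF, by
      rintro rfl
      exact Set.disjoint_left.1 hK hwF hwH, hp⟩)
    have h0 : (r p 0 : ℂ) ≠ 0 := Complex.ofReal_ne_zero.2 fun h =>
      Set.disjoint_left.1 hK ((hr0 p).1 h) hp
    rw [hΦe p (K.subset hp), ← lineProj_smul h0 (WithLp.toLp 2 ![1, 0, 0]), torusVec, h1, h2,
      ← WithLp.toLp_smul]
    simp

end FacetLineFamilies

/-! ### Spheres over edges as discs with collapsed boundary. -/

section EdgeDiscs

/-- The argument of a complex number, as an element of the circle. -/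
noncomputable def phase (ζ : ℂ) : Circle := Circle.exp ζ.arg

theorem phase_eq (ζ : ℂ) (h : ζ ≠ 0) : (phase ζ : ℂ) = ζ / (‖ζ‖ : ℂ) := by
  have h1 : (‖ζ‖ : ℂ) ≠ 0 := Complex.ofReal_ne_zero.2 (norm_ne_zero_iff.2 h)
  rw [eq_div_iff h1, mul_comm]
  exact Complex.norm_mul_exp_arg_mul_I ζ

theorem phase_coe (z : Circle) : phase z = z :=
  Circle.ext (by rw [phase_eq _ z.coe_ne_zero, z.norm_coe, Complex.ofReal_one, div_one])

theorem continuousAt_phase {ζ : ℂ} (h : ζ ≠ 0) : ContinuousAt phase ζ := by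
  refine (Topology.IsInducing.subtypeVal (t := (Submonoid.unitSphere ℂ : Set ℂ))).continuousAt_iff.2 ?_
  have h1 : ContinuousAt (fun ζ : ℂ => ζ / (‖ζ‖ : ℂ)) ζ :=
    continuousAt_id.div (Complex.continuous_ofReal.comp continuous_norm).continuousAt
      (Complex.ofReal_ne_zero.2 (norm_ne_zero_iff.2 h))
  refine h1.congr ?_
  filter_upwards [isOpen_ne.mem_nhds h] with y hy
  exact (phase_eq y hy).symm

theorem lineMap_norm_mem_segment (v w : EuclideanSpace ℝ (Fin 2)) {ζ : ℂ}
    (hζ : ζ ∈ Metric.closedBall (0 : ℂ) 1) :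
    AffineMap.lineMap v w ‖ζ‖ ∈ segment ℝ v w := by
  rw [segment_eq_image_lineMap]
  exact ⟨‖ζ‖, ⟨norm_nonneg _, mem_closedBall_zero_iff.1 hζ⟩, rfl⟩

theorem continuous_lineMap_norm (v w : EuclideanSpace ℝ (Fin 2)) :
    Continuous fun ζ : ℂ => AffineMap.lineMap v w ‖ζ‖ :=
  AffineMap.lineMap_continuous.comp continuous_norm

variable {M : Type*} [TopologicalSpace M] [T2Space M] [MulAction (Torus 2) M]
  [ContinuousSMul (Torus 2) M] {P : Set (EuclideanSpace ℝ (Fin 2))} {q : M → P}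
  {σ : EuclideanSpace ℝ (Fin 2) → M}

/-- The disc swept out from the edge `vw` by the circle `μ`. -/
noncomputable def edgeDisc (σ : EuclideanSpace ℝ (Fin 2) → M) (μ : Fin 2 → ℤ)
    (v w : EuclideanSpace ℝ (Fin 2)) (ζ : ℂ) : M :=
  oneParam μ (phase ζ) • σ (AffineMap.lineMap v w ‖ζ‖)

/-- `phase` jumps at `0`, but the centre goes to the fixed point `σ v`, so compactness of the torus
still gives continuity there. -/
theorem IsQuasitoric.continuousOn_edgeDisc (hq : IsQuasitoric P q) (hσ : IsSectionOn q σ P)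
    (μ : Fin 2 → ℤ) {v w : EuclideanSpace ℝ (Fin 2)} (hv : v ∈ P.extremePoints ℝ) (hw : w ∈ P) :
    ContinuousOn (edgeDisc σ μ v w) (Metric.closedBall 0 1) := by
  have hmem : ∀ ζ ∈ Metric.closedBall (0 : ℂ) 1, AffineMap.lineMap v w ‖ζ‖ ∈ P := fun ζ hζ =>
    hq.simplePolytope.convex.segment_subset hv.1 hw (lineMap_norm_mem_segment v w hζ)
  have hc : ContinuousOn (fun ζ : ℂ => σ (AffineMap.lineMap v w ‖ζ‖)) (Metric.closedBall 0 1) :=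
    hσ.1.comp (continuous_lineMap_norm v w).continuousOn hmem
  intro ζ hζ
  by_cases h : ζ = 0
  · subst h
    have hfix : ∀ t : Torus 2, t • σ v = σ v := hq.smul_eq_of_mem_extremePoints (by
      rw [hσ.2 v hv.1]; exact hv)
    have h0 : AffineMap.lineMap v w ‖(0 : ℂ)‖ = v := by simp
    have h1 := hc 0 hζ
    rw [ContinuousWithinAt, h0] at h1
    rw [ContinuousWithinAt, edgeDisc, h0, hfix]
    refine tendsto_smul_of_tendsto_smul (f := fun _ => σ v) tendsto_const_nhds h1 ?_
    simp only [hfix]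
    exact tendsto_const_nhds
  · exact ((continuous_oneParam μ).continuousAt.comp (continuousAt_phase h)).continuousWithinAt.smul
      (hc ζ hζ)

theorem IsQuasitoric.edgeDisc_coe (hq : IsQuasitoric P q) (hσ : IsSectionOn q σ P)
    (μ : Fin 2 → ℤ) {v w : EuclideanSpace ℝ (Fin 2)} (hw : w ∈ P.extremePoints ℝ) (z : Circle) :
    edgeDisc σ μ v w z = σ w := by
  rw [edgeDisc, z.norm_coe, AffineMap.lineMap_apply_one]
  exact hq.smul_eq_of_mem_extremePoints (by rw [hσ.2 w hw.1]; exact hw) _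

end EdgeDiscs

/-! ### The intersection pattern that excludes all polygons but triangles. -/

section Triangle

variable [MulAction (Torus 2) (ComplexProjectiveSpace 2)]
  [ContinuousSMul (Torus 2) (ComplexProjectiveSpace 2)] {P : Set (EuclideanSpace ℝ (Fin 2))}
  {q : ComplexProjectiveSpace 2 → P} {σ : EuclideanSpace ℝ (Fin 2) → ComplexProjectiveSpace 2}

/-- Every edge `vw` carries a degree `d` that pairs to `±1` with the degrees of the line bundle of
the adjacent edge at `v`, and to `0` with that of a disjoint edge. -/
theorem IsQuasitoric.exists_edgeDegree (hq : IsQuasitoric P q) (hσ : IsSectionOn q σ P)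
    {lam : Facet P → Fin 2 → ℤ} (hlam : ∀ G, IsCharVec q G (lam G)) {G : Facet P}
    {v w : EuclideanSpace ℝ (Fin 2)} (hv : v ∈ P.extremePoints ℝ) (hw : w ∈ P.extremePoints ℝ)
    (hvw : v ≠ w) (hG : G.1 = segment ℝ v w) :
    ∃ d : ℤ, ∀ (Φ : ComplexProjectiveSpace 2 →
        EuclideanSpace ℂ (Fin 3) →L[ℂ] EuclideanSpace ℂ (Fin 3)) (a : ℤ),
      (∀ x, IsLineProj (Φ x)) → HasLineDeg Φ a →
      (∀ (F : Facet P) (r₀ r₁ : EuclideanSpace ℝ (Fin 2) → ℝ) (χ : Fin 2 → ℤ), G ≠ F → v ∈ F.1 →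
        Continuous r₀ → Continuous r₁ → r₀ v = 0 →
        (∀ p ∈ G.1, r₀ p ≠ 0 ∨ r₁ p ≠ 0) →
        (∀ p ∈ G.1, p ∈ P.extremePoints ℝ → p ≠ v → r₁ p = 0) →
        lam G ⬝ᵥ χ = 0 → lam F ⬝ᵥ χ = 1 →
        (∀ p ∈ G.1, ∀ t : Torus 2, Φ (t • σ p) =
          lineProj (WithLp.toLp 2 ![(r₀ p : ℂ), (torusChar χ t : ℂ) * r₁ p, 0])) →
        IsUnit (a * d)) ∧
      ((∀ p ∈ G.1, ∀ t : Torus 2, Φ (t • σ p) = lineProj (WithLp.toLp 2 ![1, 0, 0])) →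
        a * d = 0) := by
  have hvG : v ∈ G.1 := hG ▸ left_mem_segment ℝ v w
  have hwG : w ∈ G.1 := hG ▸ right_mem_segment ℝ v w
  obtain ⟨ν, hν⟩ := (hlam G).1
  -- `μ` completes `lam G` to a lattice basis, so the circle of `μ` sweeps the sphere over `G` once.
  let μ : Fin 2 → ℤ := ![-ν 1, ν 0]
  have hμ : lam G 0 * μ 1 - lam G 1 * μ 0 = 1 := by
    simp only [dotProduct, Fin.sum_univ_two] at hν
    simp only [μ, Matrix.cons_val_zero, Matrix.cons_val_one]
    linear_combination hν
  have hpG : ∀ ζ ∈ Metric.closedBall (0 : ℂ) 1, AffineMap.lineMap v w ‖ζ‖ ∈ G.1 := fun ζ hζ =>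
    hG ▸ lineMap_norm_mem_segment v w hζ
  have hbd := hq.edgeDisc_coe hσ μ (v := v) hw
  obtain ⟨d, hd⟩ := exists_discDeg (V := EuclideanSpace ℂ (Fin 3))
    (hq.continuousOn_edgeDisc hσ μ hv hw.1)
    (fun z => by rw [hbd z, ← Circle.coe_one, hbd 1])
  refine ⟨d, fun Φ a hl ha => ⟨?_, fun hΦ => ?_⟩⟩
  · intro F r₀ r₁ χ hGF hvF hr₀ hr₁ hr₀v hr hr₁w hχG hχF hΦ
    -- Since `χ` kills `lam G` and is `1` on `lam F`, the number `μ ⬝ᵥ χ` is inverse to the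
    -- determinant of `lam G, lam F`.
    have hε : IsUnit (μ ⬝ᵥ χ) := by
      refine IsUnit.of_mul_eq_one (lam G 0 * lam F 1 - lam G 1 * lam F 0) ?_
      simp only [dotProduct, Fin.sum_univ_two] at hχG hχF ⊢
      linear_combination (lam G 0 * μ 1 - lam G 1 * μ 0) * hχF + hμ
        + (μ 0 * lam F 1 - μ 1 * lam F 0) * hχG
    -- The explicit generator of the line has a phase in its second coordinate, discontinuous at the
    -- centre. Dividing by that phase moves it to the first coordinate, where `r₀ v = 0` absorbs it.
    -- On the boundary `r₁ w = 0`, so only the winding `-(μ ⬝ᵥ χ)` remains.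
    let S : ℂ → EuclideanSpace ℂ (Fin 3) := fun ζ =>
      WithLp.toLp 2 ![(phase ζ : ℂ) ^ (-(μ ⬝ᵥ χ)) * r₀ (AffineMap.lineMap v w ‖ζ‖),
        r₁ (AffineMap.lineMap v w ‖ζ‖), 0]
    have hS : ∀ ζ, (phase ζ : ℂ) ^ (μ ⬝ᵥ χ) • S ζ =
        WithLp.toLp 2 ![(r₀ (AffineMap.lineMap v w ‖ζ‖) : ℂ),
          (torusChar χ (oneParam μ (phase ζ)) : ℂ) * r₁ (AffineMap.lineMap v w ‖ζ‖), 0] := by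
      intro ζ
      rw [← WithLp.toLp_smul, torusChar_oneParam]
      congr 1
      funext i
      fin_cases i
      · change (phase ζ : ℂ) ^ (μ ⬝ᵥ χ) * ((phase ζ : ℂ) ^ (-(μ ⬝ᵥ χ)) * _) = _
        rw [← mul_assoc, ← zpow_add₀ (Circle.coe_ne_zero _), add_neg_cancel, zpow_zero, one_mul]
        rfl
      · simp
      · simp
    have hS0 : ∀ ζ ∈ Metric.closedBall (0 : ℂ) 1, S ζ ≠ 0 := by
      intro ζ hζ h
      have h' : ∀ i, (S ζ).ofLp i = 0 := fun i => by rw [h]; rfl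
      rcases hr _ (hpG ζ hζ) with h1 | h1
      · exact h1 (Complex.ofReal_eq_zero.1
          ((mul_eq_zero.1 (h' 0)).resolve_left (zpow_ne_zero _ (Circle.coe_ne_zero _))))
      · exact h1 (Complex.ofReal_eq_zero.1 (h' 1))
    have hr₁w' : r₁ w = 0 := hr₁w w hwG hw hvw.symm
    have hcont : Continuous fun ζ : ℂ =>
        (phase ζ : ℂ) ^ (-(μ ⬝ᵥ χ)) * r₀ (AffineMap.lineMap v w ‖ζ‖) := by
      have hrc : Continuous fun ζ : ℂ => (r₀ (AffineMap.lineMap v w ‖ζ‖) : ℂ) :=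
        Complex.continuous_ofReal.comp (hr₀.comp (continuous_lineMap_norm v w))
      rw [continuous_iff_continuousAt]
      intro ζ
      by_cases h : ζ = 0
      · subst h
        have h0 : (r₀ (AffineMap.lineMap v w ‖(0 : ℂ)‖) : ℂ) = 0 := by simp [hr₀v]
        rw [ContinuousAt, h0, mul_zero, tendsto_zero_iff_norm_tendsto_zero]
        have h1 := hrc.tendsto 0
        rw [h0, tendsto_zero_iff_norm_tendsto_zero] at h1
        refine h1.congr fun ζ => ?_
        rw [norm_mul, norm_zpow, Circle.norm_coe, one_zpow, one_mul]
      · exact ((continuous_circle_coe.continuousAt.comp (continuousAt_phase h)).zpow₀ _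
          (Or.inl (Circle.coe_ne_zero _))).mul hrc.continuousAt
    have hSc : Continuous S := by
      refine (PiLp.continuous_toLp 2 _).comp (continuous_pi fun i => ?_)
      fin_cases i
      · exact hcont
      · exact Complex.continuous_ofReal.comp (hr₁.comp (continuous_lineMap_norm v w))
      · exact continuous_const
    have hdeg := hd Φ a hl ha S (fun z => (z : ℂ) ^ (-(μ ⬝ᵥ χ)))
      (WithLp.toLp 2 ![(r₀ w : ℂ), 0, 0]) hSc.continuousOn
      (fun ζ hζ => ⟨hS0 ζ hζ, by
        rw [edgeDisc, hΦ _ (hpG ζ hζ), ← hS,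
          lineProj_smul (zpow_ne_zero _ (Circle.coe_ne_zero _)), lineProj_self (hS0 ζ hζ)]⟩)
      (fun z => by
        simp only [S, phase_coe, z.norm_coe, AffineMap.lineMap_apply_one, hr₁w']
        rw [← WithLp.toLp_smul]
        simp)
    rw [hdeg.unique (hasDeg_zpow _)]
    exact hε.neg
  · have h0 : (WithLp.toLp 2 ![1, 0, 0] : EuclideanSpace ℂ (Fin 3)) ≠ 0 := fun h =>
      one_ne_zero (congrArg (fun x : EuclideanSpace ℂ (Fin 3) => x.ofLp 0) h)
    exact (hd Φ a hl ha (fun _ => WithLp.toLp 2 ![1, 0, 0]) (fun _ => 1) (WithLp.toLp 2 ![1, 0, 0])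
      continuousOn_const
      (fun ζ hζ => ⟨h0, by rw [edgeDisc, hΦ _ (hpG ζ hζ), lineProj_self h0]⟩)
      (fun z => (one_smul _ _).symm)).unique (hasDeg_const one_ne_zero)

/-- The orbit polytope of a quasitoric structure on `ℂP²` is a triangle. -/
theorem IsQuasitoric.card_facet_eq_three (hq : IsQuasitoric P q) : Nat.card (Facet P) = 3 := by
  have hP := hq.simplePolytope
  refine (card_facet_eq_three_or hP).resolve_right ?_
  rintro ⟨F₁, F₂, F₃, v, w, hv, hw, hv1, hv2, hw2, hw3, h12, h23, h13⟩
  obtain ⟨σ, hσ⟩ := hq.exists_section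
  choose lam hlam using hq.exists_charVec
  have hvw : v ≠ w := by
    rintro rfl
    exact Set.disjoint_left.1 h13 hv1 hw3
  obtain ⟨u, hu, hwu, hF₃⟩ := F₃.exists_eq_segment_left hP hw hw3
  obtain ⟨d₂, hd₂⟩ := hq.exists_edgeDegree hσ hlam hv hw hvw
    (F₂.eq_segment_of_mem hP hv hw hv2 hw2 hvw)
  obtain ⟨d₃, hd₃⟩ := hq.exists_edgeDegree hσ hlam hw hu hwu hF₃
  obtain ⟨Φ₁, r₀, r₁, χ, hΦ₁, hl₁, hr₀, hr₁, hr₀v, hr, hr₁w, hχG, hχF, hadj₁, hdisj₁⟩ :=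
    hq.exists_lineFamily hσ hlam hv h12.symm hv1 hv2
  obtain ⟨a₁, ha₁⟩ := exists_hasLineDeg hΦ₁ hl₁
  have h1 : IsUnit (a₁ * d₂) := (hd₂ Φ₁ a₁ hl₁ ha₁).1 F₁ r₀ r₁ χ h12.symm hv1 hr₀ hr₁ hr₀v hr hr₁w
    hχG hχF hadj₁
  have h0 : a₁ * d₃ = 0 := (hd₃ Φ₁ a₁ hl₁ ha₁).2 (hdisj₁ F₃ h13)
  obtain ⟨Φ₂, r₀', r₁', χ', hΦ₂, hl₂, hr₀', hr₁', hr₀v', hr', hr₁w', hχG', hχF', hadj₂, -⟩ :=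
    hq.exists_lineFamily hσ hlam hw h23.symm hw2 hw3
  obtain ⟨a₂, ha₂⟩ := exists_hasLineDeg hΦ₂ hl₂
  have h2 : IsUnit (a₂ * d₃) := (hd₃ Φ₂ a₂ hl₂ ha₂).1 F₂ r₀' r₁' χ' h23.symm hw2 hr₀' hr₁' hr₀v' hr'
    hr₁w' hχG' hχF' hadj₂
  -- `a₁ = 0` contradicts the pairing of `F₁` with `F₂`, and `d₃ = 0` that of `F₂` with `F₃`.
  rcases mul_eq_zero.1 h0 with h | h
  · exact not_isUnit_zero (by rwa [h, zero_mul] at h1)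
  · exact not_isUnit_zero (by rwa [h, mul_zero] at h2)

end Triangle

theorem mainTheorem6
    [MulAction (Torus 2) (ComplexProjectiveSpace 2)]
    [ContinuousSMul (Torus 2) (ComplexProjectiveSpace 2)]
    (P : Set (EuclideanSpace ℝ (Fin 2))) (q : ComplexProjectiveSpace 2 → P)
    (hq : IsQuasitoric P q) :
    Nat.card (Facet P) = 3 ∧
    ∀ F : Fin 3 ≃ Facet P, ∃! c : SLModSign,
      IsEquivariantlyHomeomorphicToModel P (etaPrime F c) q ∨
      IsEquivariantlyHomeomorphicToModel P (etaDoublePrime F c) q := by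
  have h := hq.card_facet_eq_three
  exact ⟨h, fun F => hq.existsUnique_class h F⟩
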